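/- Let $0<\lambda_0<\lambda_1<1$, $\mu=\lambda_0/\lambda_1$, $0<\gamma<1$, ${\cal L}=\{\mathrm{Re}\,s=\gamma\}$, ${\cal D}^+=\{\mathrm{Re}\,s\le\gamma\}$, ${\cal D}^-=\{\mathrm{Re}\,s\ge\gamma\}$, and $$G_0(s)=\begin{pmatrix}\lambda_1^{-s}\cot\frac{\pi s}{2}&0&0\\0&\mu^{-s-1}\tan\frac{\pi s}{2}&0\\2&-\lambda_1^{s+1}\tan\frac{\pi s}{2}&2\lambda_0^s\end{pmatrix}.$$ *Definitions.* A function or vector function $y$ has order $\alpha$ at infinity in $D$ if $s^{\alpha}y(s)$ is bounded and bounded away from zero as $s\to\infty$, $s\in D$. A matrix function is normal at infinity in $D$ if its determinant and its columns have orders there and the order of the determinant is the sum of the orders of the columns. A pair $X^\pm$ of matrix functions, analytic in a neighbourhood of each point of ${\cal D}^\pm$ respectively, is a canonical factorization of $G_0$ if $G_0=X^+(X^-)^{-1}$ on ${\cal L}$, $\det X^\pm\ne0$ in ${\cal D}^\pm$, and $X^\pm$ is normal at infinity in ${\cal D}^\pm$. If the $j$-th columns of $X^+$ and of $X^-$ both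 have the integer order $\kappa_j$ at infinity ($j=1,2,3$), then $\kappa_1,\kappa_2,\kappa_3$ are called partial indices of $G_0$. For $l=1,2,3$ and complex sequences $A^\pm_{lm},B^\pm_{lm}$ ($m\ge0$) put $$\Psi_l^+(s)=\sum_{m\ge0}\frac{A^+_{lm}}{s-2m-1},\quad \Psi_l^-(s)=\sum_{m\ge0}\frac{A^-_{lm}}{s+2m+1},\quad \Omega_l^+(s)=\sum_{m\ge0}\frac{B^+_{lm}}{s-2m-2},\quad \Omega_l^-(s)=\sum_{m\ge0}\frac{B^-_{lm}}{s+2m},$$ and consider the systems ($n=0,1,\dots$, $l=1,2,3$, $\delta_{lk}$ the Kronecker symbol) $$B_{ln}^-=\frac{2\lambda_1^{2n}}{\pi}\Big(\sum_m\frac{A_{lm}^+}{2n+2m+1}-\delta_{l1}\Big),$$ $$A_{ln}^+=\frac{2\lambda_1^{2n+1}}{\pi}\Big(\sum_m\frac{B_{lm}^-}{2n+2m+1}+\sum_m\frac{B_{lm}^+}{2n-2m-1}+\delta_{l2}\Big),$$ $$A_{ln}^-=-\frac{2}{\pi}\mu^{2n+1}\Big(\sum_m\frac{B_{lm}^+}{2n+2m+3}+\sum_m\frac{B_{lm}^-}{2n-2m+1}-\delta_{l2}\Big),$$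 $$B_{ln}^+=-\frac{2}{\pi}\mu^{2n+2}\Big(\sum_m\frac{A_{lm}^-}{2n+2m+3}+\delta_{l3}\Big).$$ *Theorem.* The systems have exactly one solution for which all the series in them converge absolutely. For this solution, the series $\Psi_l^\pm(s),\Omega_l^\pm(s)$ converge at all non-integer $s$. Let $X^\pm=(\chi^\pm_{ml})$ be given at non-integer $s$ by $$\chi_{1l}^+=\tfrac12\{\lambda_1^{-s}\cot\tfrac{\pi s}{2}[\Psi_l^++\delta_{l1}]+\Omega_l^-+\Omega_l^++\delta_{l2}\},\quad \chi_{1l}^-=\tfrac12\{\lambda_1^{s}\tan\tfrac{\pi s}{2}[\Omega_l^-+\Omega_l^++\delta_{l2}]+\Psi_l^++\delta_{l1}\},$$ $$\chi_{2l}^+=\tfrac1{\lambda_0}\{\mu^{-s}\tan\tfrac{\pi s}{2}[\Omega_l^-+\Omega_l^++\delta_{l2}]+\Psi_l^-+\delta_{l3}\},\quad \chi_{2l}^-=\tfrac1{\lambda_1}\{\mu^{s}\cot\tfrac{\pi s}{2}[\Psi_l^-+\delta_{l3}]+\Omega_l^-+\Omega_l^++\delta_{l2}\},$$ $$\chi_{3l}^+=\Psi_l^++\delta_{l1},\quad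 \chi_{3l}^-=\tfrac12[\Psi_l^-+\delta_{l3}],$$ and extended by their limits to the integers in ${\cal D}^\pm$. Then: 1. $\det X^+(s)=\frac1{2\lambda_0}$ for $s\in{\cal D}^+$, $\det X^-(s)=\frac1{4\lambda_1}$ for $s\in{\cal D}^-$, and, at all non-integer $s$, the function $$\chi=1-[\Omega_1^++\Omega_1^-][\Psi_2^++\Psi_2^+\Psi_3^--\Psi_2^-\Psi_3^+]+[\Omega_2^++\Omega_2^-+1][\Psi_1^++\Psi_3^-+\Psi_1^+\Psi_3^--\Psi_1^-\Psi_3^+]$$ $$-[\Omega_3^++\Omega_3^-][\Psi_2^-+\Psi_1^+\Psi_2^--\Psi_1^-\Psi_2^+]+\Omega_2^++\Omega_2^-$$ equals $1$. 2. $X^\pm$ is a canonical factorization of $G_0$ on ${\cal L}$ (in particular, $X^\pm$ are analytic in ${\cal D}^\pm$, $G_0=X^+(X^-)^{-1}$ on ${\cal L}$, and $X^\pm$ are normal at infinity in ${\cal D}^\pm$), and all the columns of $X^+$ and $X^-$ have order $0$ at infinity in ${\cal D}^+$ and ${\cal D}^-$, respectively. Moreover, for each $M>0$, as $s\to\infty$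 in the sector $|\mathrm{Im}\,s|\le -M\,\mathrm{Re}\,s$ (for $X^+$) or $|\mathrm{Im}\,s|\le M\,\mathrm{Re}\,s$ (for $X^-$), $$X^+(s)=\begin{pmatrix}0&\frac12&0\\0&0&\frac1{\lambda_0}\\1&0&0\end{pmatrix}+O(s^{-1}),\qquad X^-(s)=\begin{pmatrix}\frac12&0&0\\0&\frac1{\lambda_1}&0\\0&0&\frac12\end{pmatrix}+O(s^{-1}).$$ 3. The partial indices of $G_0$ are uniquely determined and $\kappa_1=\kappa_2=\kappa_3=0$. -/

import Mathlib

namespace AnnularFactorization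

open Filter Topology

/-- The closed half-plane `Re s ≤ γ` to the left of the contour `Re s = γ`. -/
def DPlus (γ : ℝ) : Set ℂ := {s | s.re ≤ γ}

/-- The closed half-plane `Re s ≥ γ` to the right of the contour `Re s = γ`. -/
def DMinus (γ : ℝ) : Set ℂ := {s | γ ≤ s.re}

/-- The contour `Re s = γ`. -/
def contour (γ : ℝ) : Set ℂ := {s | s.re = γ}

/-- `s → ∞` within the set `D`. -/
noncomputable def atInfinityIn (D : Set ℂ) : Filter ℂ := Bornology.cobounded ℂ ⊓ 𝓟 D

/-- The (scalar or vector) function `y` has order `α` at infinity in `D`: `y s = s ^ (-α) • ỹ s`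
where `ỹ` is bounded and bounded away from zero as `s → ∞` in `D`. For a vector (with the sup norm
on `Fin n → ℂ`) whose entries have orders `α₁, …, αₙ` this is the order `min {α₁, …, αₙ}`. -/
def HasOrderAtInfinity {E : Type*} [NormedAddCommGroup E] (D : Set ℂ) (y : ℂ → E) (α : ℝ) : Prop :=
  ∃ c C : ℝ, 0 < c ∧ ∀ᶠ s in atInfinityIn D, c ≤ ‖s‖ ^ α * ‖y s‖ ∧ ‖s‖ ^ α * ‖y s‖ ≤ C

/-- The `j`-th column of a matrix function. -/
def column (X : ℂ → Matrix (Fin 3) (Fin 3) ℂ) (j : Fin 3) : ℂ → (Fin 3 → ℂ) :=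
  fun s i => X s i j

/-- Normal form at infinity in `D`: the order of the determinant is the sum of the orders of the
columns. -/
def IsNormalAtInfinity (D : Set ℂ) (X : ℂ → Matrix (Fin 3) (Fin 3) ℂ) : Prop :=
  ∃ (α : ℝ) (κ : Fin 3 → ℝ), HasOrderAtInfinity D (fun s => (X s).det) α ∧
    (∀ j, HasOrderAtInfinity D (column X j) (κ j)) ∧ α = ∑ j, κ j

/-- Piecewise analytic canonical factorization `G = X⁺ (X⁻)⁻¹` on the contour `Re s = γ`. -/
structure IsCanonicalFactorization (γ : ℝ) (G Xp Xm : ℂ → Matrix (Fin 3) (Fin 3) ℂ) : Prop where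
  analytic_plus : ∀ i j, AnalyticOnNhd ℂ (fun s => Xp s i j) (DPlus γ)
  analytic_minus : ∀ i j, AnalyticOnNhd ℂ (fun s => Xm s i j) (DMinus γ)
  factorization : ∀ s ∈ contour γ, G s = Xp s * (Xm s)⁻¹
  det_plus_ne_zero : ∀ s ∈ DPlus γ, (Xp s).det ≠ 0
  det_minus_ne_zero : ∀ s ∈ DMinus γ, (Xm s).det ≠ 0
  normal_plus : IsNormalAtInfinity (DPlus γ) Xp
  normal_minus : IsNormalAtInfinity (DMinus γ) Xm

/-- `κ` is a system of partial indices of `G` on the contour `Re s = γ`: the orders at infinity of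
the columns of a canonical matrix of factorization. -/
def IsPartialIndices (γ : ℝ) (G : ℂ → Matrix (Fin 3) (Fin 3) ℂ) (κ : Fin 3 → ℤ) : Prop :=
  ∃ Xp Xm : ℂ → Matrix (Fin 3) (Fin 3) ℂ, IsCanonicalFactorization γ G Xp Xm ∧
    ∀ j, HasOrderAtInfinity (DPlus γ) (column Xp j) (κ j) ∧
      HasOrderAtInfinity (DMinus γ) (column Xm j) (κ j)

/-- The triangular matrix coefficient `G₀(s)`. -/
noncomputable def G0 (lam0 lam1 : ℝ) (s : ℂ) : Matrix (Fin 3) (Fin 3) ℂ :=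
  !![(lam1 : ℂ) ^ (-s) * Complex.cot (Real.pi * s / 2), 0, 0;
    0, ((lam0 / lam1 : ℝ) : ℂ) ^ (-s - 1) * Complex.tan (Real.pi * s / 2), 0;
    2, -(lam1 : ℂ) ^ (s + 1) * Complex.tan (Real.pi * s / 2), 2 * (lam0 : ℂ) ^ s]

/-- The Kronecker symbol. -/
noncomputable def kron (l k : Fin 3) : ℂ := if l = k then 1 else 0

/-- The coefficients `A⁺_{lm}`, `A⁻_{lm}`, `B⁺_{lm}`, `B⁻_{lm}`. The indices `l = 1, 2, 3` are the
elements `0, 1, 2` of `Fin 3`. -/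
structure Coeffs where
  Ap : Fin 3 → ℕ → ℂ
  Am : Fin 3 → ℕ → ℂ
  Bp : Fin 3 → ℕ → ℂ
  Bm : Fin 3 → ℕ → ℂ

/-- The coefficients solve the infinite linear systems, all the series in which converge
absolutely. -/
structure SolvesSystems (lam0 lam1 : ℝ) (K : Coeffs) : Prop where
  summable_Ap : ∀ l (n : ℕ), Summable fun m : ℕ => K.Ap l m / (2 * n + 2 * m + 1)
  summable_Am : ∀ l (n : ℕ), Summable fun m : ℕ => K.Am l m / (2 * n + 2 * m + 3)
  summable_Bm : ∀ l (n : ℕ), Summable fun m : ℕ => K.Bm l m / (2 * n + 2 * m + 1)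
  summable_Bm' : ∀ l (n : ℕ), Summable fun m : ℕ => K.Bm l m / (2 * n - 2 * m + 1)
  summable_Bp : ∀ l (n : ℕ), Summable fun m : ℕ => K.Bp l m / (2 * n + 2 * m + 3)
  summable_Bp' : ∀ l (n : ℕ), Summable fun m : ℕ => K.Bp l m / (2 * n - 2 * m - 1)
  eq_Bm : ∀ l (n : ℕ), K.Bm l n = 2 * (lam1 : ℂ) ^ (2 * n) / Real.pi *
    ((∑' m : ℕ, K.Ap l m / (2 * n + 2 * m + 1)) - kron l 0)
  eq_Ap : ∀ l (n : ℕ), K.Ap l n = 2 * (lam1 : ℂ) ^ (2 * n + 1) / Real.pi *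
    ((∑' m : ℕ, K.Bm l m / (2 * n + 2 * m + 1)) + (∑' m : ℕ, K.Bp l m / (2 * n - 2 * m - 1))
      + kron l 1)
  eq_Am : ∀ l (n : ℕ), K.Am l n = -(2 / Real.pi) * ((lam0 : ℂ) / lam1) ^ (2 * n + 1) *
    ((∑' m : ℕ, K.Bp l m / (2 * n + 2 * m + 3)) + (∑' m : ℕ, K.Bm l m / (2 * n - 2 * m + 1))
      - kron l 1)
  eq_Bp : ∀ l (n : ℕ), K.Bp l n = -(2 / Real.pi) * ((lam0 : ℂ) / lam1) ^ (2 * n + 2) *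
    ((∑' m : ℕ, K.Am l m / (2 * n + 2 * m + 3)) + kron l 2)

/-- `Ψ_l⁺(s)` -/
noncomputable def PsiP (K : Coeffs) (l : Fin 3) (s : ℂ) : ℂ := ∑' m : ℕ, K.Ap l m / (s - 2 * m - 1)

/-- `Ψ_l⁻(s)` -/
noncomputable def PsiM (K : Coeffs) (l : Fin 3) (s : ℂ) : ℂ := ∑' m : ℕ, K.Am l m / (s + 2 * m + 1)

/-- `Ω_l⁺(s)` -/
noncomputable def OmP (K : Coeffs) (l : Fin 3) (s : ℂ) : ℂ := ∑' m : ℕ, K.Bp l m / (s - 2 * m - 2)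

/-- `Ω_l⁻(s)` -/
noncomputable def OmM (K : Coeffs) (l : Fin 3) (s : ℂ) : ℂ := ∑' m : ℕ, K.Bm l m / (s + 2 * m)

/-- The four series `Ψ_l^±(s)`, `Ω_l^±(s)` converge. -/
def SeriesConverge (K : Coeffs) (l : Fin 3) (s : ℂ) : Prop :=
  (Summable fun m : ℕ => K.Ap l m / (s - 2 * m - 1)) ∧
  (Summable fun m : ℕ => K.Am l m / (s + 2 * m + 1)) ∧
  (Summable fun m : ℕ => K.Bp l m / (s - 2 * m - 2)) ∧
  (Summable fun m : ℕ => K.Bm l m / (s + 2 * m))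

/-- The closed form of the entries `χ_{ml}⁺(s)`, meaningful when `s` is not an integer. -/
noncomputable def XplusFormula (lam0 lam1 : ℝ) (K : Coeffs) (s : ℂ) :
    Matrix (Fin 3) (Fin 3) ℂ :=
  Matrix.of ![
    fun l => 1 / 2 * ((lam1 : ℂ) ^ (-s) * Complex.cot (Real.pi * s / 2) * (PsiP K l s + kron l 0)
      + OmM K l s + OmP K l s + kron l 1),
    fun l => 1 / (lam0 : ℂ) * (((lam0 / lam1 : ℝ) : ℂ) ^ (-s) * Complex.tan (Real.pi * s / 2) *
      (OmM K l s + OmP K l s + kron l 1) + PsiM K l s + kron l 2),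
    fun l => PsiP K l s + kron l 0]

/-- The closed form of the entries `χ_{ml}⁻(s)`, meaningful when `s` is not an integer. -/
noncomputable def XminusFormula (lam0 lam1 : ℝ) (K : Coeffs) (s : ℂ) :
    Matrix (Fin 3) (Fin 3) ℂ :=
  Matrix.of ![
    fun l => 1 / 2 * ((lam1 : ℂ) ^ s * Complex.tan (Real.pi * s / 2) *
      (OmM K l s + OmP K l s + kron l 1) + PsiP K l s + kron l 0),
    fun l => 1 / (lam1 : ℂ) * (((lam0 / lam1 : ℝ) : ℂ) ^ s * Complex.cot (Real.pi * s / 2) *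
      (PsiM K l s + kron l 2) + OmM K l s + OmP K l s + kron l 1),
    fun l => 1 / 2 * (PsiM K l s + kron l 2)]

/-- `X⁺(s)`: the closed form, extended by its limit to the removable singularities. -/
noncomputable def Xplus (lam0 lam1 : ℝ) (K : Coeffs) (s : ℂ) : Matrix (Fin 3) (Fin 3) ℂ :=
  Matrix.of fun i l => limUnder (𝓝[≠] s) fun z => XplusFormula lam0 lam1 K z i l

/-- `X⁻(s)`: the closed form, extended by its limit to the removable singularities. -/
noncomputable def Xminus (lam0 lam1 : ℝ) (K : Coeffs) (s : ℂ) : Matrix (Fin 3) (Fin 3) ℂ :=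
  Matrix.of fun i l => limUnder (𝓝[≠] s) fun z => XminusFormula lam0 lam1 K z i l

/-- The function `χ(s)` through which both determinants are expressed. -/
noncomputable def chi (K : Coeffs) (s : ℂ) : ℂ :=
  1 - (OmP K 0 s + OmM K 0 s) *
      (PsiP K 1 s + PsiP K 1 s * PsiM K 2 s - PsiM K 1 s * PsiP K 2 s)
    + (OmP K 1 s + OmM K 1 s + 1) *
      (PsiP K 0 s + PsiM K 2 s + PsiP K 0 s * PsiM K 2 s - PsiM K 0 s * PsiP K 2 s)
    - (OmP K 2 s + OmM K 2 s) *
      (PsiM K 1 s + PsiP K 0 s * PsiM K 1 s - PsiM K 0 s * PsiP K 1 s)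
    + OmP K 1 s + OmM K 1 s

/-- The limit of `X⁺(s)` as `s → ∞` inside the left half-plane. -/
noncomputable def XplusInfinity (lam0 : ℝ) : Matrix (Fin 3) (Fin 3) ℂ :=
  !![0, 1 / 2, 0; 0, 0, 1 / (lam0 : ℂ); 1, 0, 0]

/-- The limit of `X⁻(s)` as `s → ∞` inside the right half-plane. -/
noncomputable def XminusInfinity (lam1 : ℝ) : Matrix (Fin 3) (Fin 3) ℂ :=
  !![1 / 2, 0, 0; 0, 1 / (lam1 : ℂ), 0; 0, 0, 1 / 2]

/-- The closed sector about the negative real axis, `|arg (-s)| ≤ arctan M`. -/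
def leftSector (M : ℝ) : Set ℂ := {s | |s.im| ≤ M * (-s.re)}

/-- The closed sector about the positive real axis, `|arg s| ≤ arctan M`. -/
def rightSector (M : ℝ) : Set ℂ := {s | |s.im| ≤ M * s.re}

end AnnularFactorization

open AnnularFactorization Asymptotics

namespace AnnularFactorization

open Filter Topology

/-! ### Orthonormality of the discrete Hilbert matrix on the odd reciprocals. -/

section HilbertMatrix

/-! Attach each coefficient to its pole. The `A⁺`, `A⁻` form one two-sided sequence `a`, with `a j`
at the odd integer `2j + 1`; the `B⁻`, `B⁺` form one sequence `b`, with `b k` at the even integer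
`-2k`. The systems then read `a = w · H b + α`, `b = v · H' a + β`, where `H` is the discrete
Hilbert matrix `2 / (π (2 (j + k) + 1))` and `H'` consists of its two diagonal blocks. `H` is an
isometry of `ℓ²` (`hasSum_hil_mul_hil`), `H'` has norm at most one, `|v| ≤ 1` and `|w| ≤ max (λ₁, μ)
< 1`, so there is exactly one solution in `ℓ²` (`existsUnique_fixedPoint`). The powers of `λ₁` and
`μ` force every solution with absolutely convergent series to decay geometrically
(`SolvesSystems.geomDecay`), hence to lie in `ℓ²`.

The same equations are residue conditions on `P = Ψ⁺ + δ_{l1}`, `O = Ω⁻ + Ω⁺ + δ_{l2}`, `Q = Ψ⁻ +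
δ_{l3}` (`SolvesSystems.rowData`). They say that in the entries of `X^±` the poles at the integers
of the half-plane in question cancel those of `cot` and `tan`. Away from the integers `cot` and
`tan` are bounded, the exponential factor decays into the half-plane, and the series are `O(1/s)`;
the maximum principle fills in the discs about the integers. So `X^±` are analytic and bounded, with
limits at rate `1/s` in sectors (`tame_of_exponential`, `Tame.isBigO`).

Row operations give `2λ₀ det X⁺ = χ = 4λ₁ det X⁻` off the integers. The two sides glue across the
contour to a bounded entire function, constant by Liouville and equal to its limit `1`
(`Setting.det_eq`). The identity `G₀ X⁻ = X⁺` is algebra, and bounded matrices of constant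
determinant have columns of order zero.

If `Y^±` is another canonical factorization, `(X^±)⁻¹ Y^±` glue to an entire matrix `Z` with
nonvanishing determinant, whose columns have the orders `κ_j`. Liouville for the columns gives `κ_j
≤ 0`; by normality `det Z` has order `∑ κ_j`, and Liouville for `1 / det Z` gives `∑ κ_j ≥ 0`
(`IsPartialIndices.eq_zero`). -/

theorem hasSum_of_eq {ι M : Type*} [AddCommMonoid M] [TopologicalSpace M] {f g : ι → M} {a b : M}
    (h : HasSum f a) (hf : ∀ i, g i = f i) (hb : b = a) : HasSum g b := by
  obtain rfl : g = f := funext hf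
  rwa [hb]

/-- The reciprocal of an odd integer. -/
noncomputable def oddInv (j : ℤ) : ℝ := 1 / (2 * j + 1)

theorem two_mul_add_one_ne_zero_real (j : ℤ) : (2 * (j : ℝ) + 1) ≠ 0 := by
  have h : (2 * j + 1 : ℤ) ≠ 0 := by omega
  exact_mod_cast h

/-- The reflection `n ↦ -(n + 1)` changes the sign of `2n + 1`; it exchanges the two halves of every
two-sided sequence below. -/
theorem oddInv_neg_add_one (n : ℤ) : oddInv (-(n + 1)) = -oddInv n := by
  have h := two_mul_add_one_ne_zero_real n
  have h' : (2 * -((n : ℝ) + 1) + 1) ≠ 0 := by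
    intro h0; apply h; linarith
  unfold oddInv
  push_cast
  rw [div_eq_iff h', neg_mul, div_mul_eq_mul_div, eq_comm, neg_eq_iff_eq_neg, div_eq_iff h]
  ring

theorem hasSum_odd_of_hasSum_even {f : ℕ → ℝ} {a b : ℝ} (hf : HasSum f a)
    (he : HasSum (fun n => f (2 * n)) b) : HasSum (fun n => f (2 * n + 1)) (a - b) := by
  have hos : Summable (fun n => f (2 * n + 1)) :=
    hf.summable.comp_injective (i := fun n => 2 * n + 1) (fun a b h => by simpa using h)
  have h := (HasSum.even_add_odd he hos.hasSum).unique hf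
  rw [show a - b = ∑' n, f (2 * n + 1) by linarith]
  exact hos.hasSum

/-- Removing the even terms from `ζ(2)` leaves `π²/6 - π²/24 = π²/8`, and the reflection doubles it.
The terms `n = 0` of both series are `1 / 0 = 0`. -/
theorem hasSum_oddInv_sq : HasSum (fun j : ℤ => oddInv j ^ 2) (Real.pi ^ 2 / 4) := by
  have hz := hasSum_zeta_two
  have he : HasSum (fun n : ℕ => (1 : ℝ) / ((2 * n : ℕ) : ℝ) ^ 2) (Real.pi ^ 2 / 24) := by
    refine hasSum_of_eq (hz.mul_left (1 / 4 : ℝ)) (fun n => ?_) (by ring)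
    push_cast; rw [mul_pow, ← div_div]; ring
  have ho := hasSum_odd_of_hasSum_even hz he
  have hp : HasSum (fun n : ℕ => oddInv (n : ℤ) ^ 2) (Real.pi ^ 2 / 8) := by
    refine hasSum_of_eq ho (fun n => ?_) (by ring)
    unfold oddInv; push_cast; rw [div_pow, one_pow]
  have hn : HasSum (fun n : ℕ => oddInv (-((n : ℤ) + 1)) ^ 2) (Real.pi ^ 2 / 8) := by
    simpa only [oddInv_neg_add_one, neg_sq] using hp
  exact hasSum_of_eq (HasSum.of_nat_of_neg_add_one (f := fun j : ℤ => oddInv j ^ 2) hp hn)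
    (fun _ => rfl) (by ring)

theorem tendsto_oddInv_nat : Tendsto (fun n : ℕ => oddInv (n : ℤ)) atTop (𝓝 0) := by
  have h : Tendsto (fun n : ℕ => oddInv (n : ℤ) ^ 2) atTop (𝓝 0) :=
    (hasSum_oddInv_sq.summable.comp_injective (i := fun n : ℕ => (n : ℤ))
      Nat.cast_injective).tendsto_atTop_zero
  have := h.sqrt
  simp only [Real.sqrt_sq_eq_abs, Real.sqrt_zero] at this
  exact (tendsto_zero_iff_abs_tendsto_zero _).2 this

/-- Telescoping. On the nonnegative indices the terms are nonnegative, so convergence of partial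
sums already gives unconditional summability; the negative indices follow by reflection. -/
theorem hasSum_oddInv_sub_succ : HasSum (fun j : ℤ => oddInv j - oddInv (j + 1)) 0 := by
  have key : HasSum (fun n : ℕ => oddInv (n : ℤ) - oddInv ((n : ℤ) + 1)) (oddInv 0) := by
    rw [hasSum_iff_tendsto_nat_of_nonneg]
    · have : (fun N : ℕ => ∑ i ∈ Finset.range N, (oddInv (i : ℤ) - oddInv ((i : ℤ) + 1)))
          = fun N : ℕ => oddInv 0 - oddInv (N : ℤ) := by
        ext N
        have := Finset.sum_range_sub' (fun i : ℕ => oddInv (i : ℤ)) N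
        simpa using this
      rw [this]
      simpa using tendsto_oddInv_nat.const_sub (oddInv 0)
    · intro n
      rw [sub_nonneg]
      unfold oddInv
      push_cast
      apply one_div_le_one_div_of_le <;> nlinarith [(Nat.cast_nonneg n : (0 : ℝ) ≤ n)]
  have hn : HasSum (fun n : ℕ => oddInv (-((n : ℤ) + 1)) - oddInv (-((n : ℤ) + 1) + 1))
      (- oddInv 0) := by
    -- The term at index `-1` straddles the sign change and equals `-2`; all later terms repeat
    -- those of `key`.
    rw [← hasSum_nat_add_iff' 1]
    refine hasSum_of_eq key (fun n => ?_) ?_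
    · rw [oddInv_neg_add_one, show (-(((n + 1 : ℕ) : ℤ) + 1) + 1) = -((n : ℤ) + 1) by push_cast; ring,
        oddInv_neg_add_one]
      push_cast; ring
    · simp [oddInv]
      norm_num
  have := HasSum.of_nat_of_neg_add_one (f := fun j : ℤ => oddInv j - oddInv (j + 1)) key hn
  rwa [add_neg_cancel] at this

theorem hasSum_oddInv_sub_add_nat (d : ℕ) :
    HasSum (fun j : ℤ => oddInv j - oddInv (j + d)) 0 := by
  induction d with
  | zero => simp
  | succ d ih =>
    have h := hasSum_oddInv_sub_succ.add
      ((Equiv.addRight (1 : ℤ)).hasSum_iff (f := fun j : ℤ => oddInv j - oddInv (j + d)) |>.2 ih)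
    rw [add_zero] at h
    refine hasSum_of_eq h (fun j => ?_) rfl
    simp only [Function.comp_apply, Equiv.coe_addRight]
    rw [show j + ((d + 1 : ℕ) : ℤ) = j + 1 + d by push_cast; ring]
    ring

/-- The entry `2 / (π (2 n + 1))` of the symmetric discrete Hilbert matrix `(j, k) ↦ hil (j + k)`. -/
noncomputable def hil (n : ℤ) : ℝ := 2 / Real.pi * oddInv n

/-- For `d ≠ 0`, partial fractions turn the product into `1 / (2d)` times a telescoping difference.
-/
theorem hasSum_oddInv_mul_add_nat (d : ℕ) :
    HasSum (fun j : ℤ => oddInv j * oddInv (j + d)) (if d = 0 then Real.pi ^ 2 / 4 else 0) := by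
  split_ifs with h
  · subst h
    simpa [sq] using hasSum_oddInv_sq
  · have hd : (d : ℝ) ≠ 0 := by exact_mod_cast h
    have := (hasSum_oddInv_sub_add_nat d).mul_left (1 / (2 * (d : ℝ)))
    rw [mul_zero] at this
    refine hasSum_of_eq this (fun j => ?_) rfl
    have h1 := two_mul_add_one_ne_zero_real j
    have h2 := two_mul_add_one_ne_zero_real (j + d)
    unfold oddInv
    push_cast at h2 ⊢
    rw [div_sub_div _ _ h1 h2]
    field_simp
    ring

/-- The factor `2 / π` in `hil` is chosen so that the diagonal value `π²/4` is normalized to `1`.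
The product is symmetric in `k`, `k'` and invariant under shifts of `j`, which reduces everything to
`k' = k + d` with `d ≥ 0`. -/
theorem hasSum_hil_mul_hil (k k' : ℤ) :
    HasSum (fun j : ℤ => hil (j + k) * hil (j + k')) (if k = k' then 1 else 0) := by
  wlog h : k ≤ k' generalizing k k'
  · have := this k' k (by omega)
    simp_rw [eq_comm (a := k')] at this
    simpa only [mul_comm] using this
  obtain ⟨d, rfl⟩ := Int.le.dest h
  have h1 := ((Equiv.addRight k).hasSum_iff
    (f := fun j : ℤ => oddInv j * oddInv (j + d))).2 (hasSum_oddInv_mul_add_nat d)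
  have h2 := h1.mul_left ((2 / Real.pi) ^ 2)
  refine hasSum_of_eq h2 (fun j => ?_) ?_
  · simp only [hil, Function.comp_apply, Equiv.coe_addRight, add_assoc]
    ring
  · have := Real.pi_ne_zero
    by_cases hd : d = 0
    · subst hd; simp; field_simp
      norm_num
    · simp [hd]

end HilbertMatrix

/-- Square-summable two-sided complex sequences. -/
noncomputable abbrev Ltwo := lp (fun _ : ℤ => ℂ) 2

theorem hasSum_norm_sq (x : Ltwo) : HasSum (fun i => ‖x i‖ ^ 2) (‖x‖ ^ 2) := by
  have := lp.hasSum_norm (p := 2) (by norm_num) x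
  simpa using this

theorem memlp_two_iff (f : ℤ → ℂ) :
    Memℓp f 2 ↔ Summable fun i => ‖f i‖ ^ 2 := by
  rw [memℓp_gen_iff (by norm_num)]
  simp

/-- The rows of the discrete Hilbert matrix as elements of `ℓ²`. -/
noncomputable def hilRow (k : ℤ) : Ltwo :=
  ⟨fun j => (hil (j + k) : ℂ), (memlp_two_iff _).2 (by
    have := (hasSum_hil_mul_hil k k).summable
    convert this using 2 with j
    rw [Complex.norm_real, Real.norm_eq_abs, sq_abs, sq])⟩

theorem orthonormal_hilRow : Orthonormal ℂ hilRow := by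
  rw [orthonormal_iff_ite]
  intro i j
  rw [lp.inner_eq_tsum]
  have h := (Complex.hasSum_ofReal.2 (hasSum_hil_mul_hil i j)).tsum_eq
  have h2 : ((if i = j then (1 : ℝ) else 0 : ℝ) : ℂ) = if i = j then 1 else 0 := by
    split_ifs <;> simp
  refine Eq.trans (tsum_congr fun n => ?_) (h.trans h2)
  simp [hilRow, mul_comm]

/-- The operator on `ℓ²` with the symmetric matrix `hil (j + k)`. -/
noncomputable def hilOp : Ltwo →ₗᵢ[ℂ] Ltwo :=
  orthonormal_hilRow.orthogonalFamily.linearIsometry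

/-- `hilOp b` is the `ℓ²` sum of `b k` times the `k`-th row; since evaluation at `j` is continuous,
the sum may be read entrywise. -/
theorem hasSum_hilOp (b : Ltwo) (j : ℤ) :
    HasSum (fun k => (hil (j + k) : ℂ) * b k) (hilOp b j) := by
  have h := orthonormal_hilRow.orthogonalFamily.hasSum_linearIsometry b
  have h2 := h.mapL (lp.evalCLM ℂ (fun _ : ℤ => ℂ) 2 j)
  refine hasSum_of_eq h2 (fun k => ?_) rfl
  simp [hilRow, lp.evalCLM, mul_comm]

/-! ### The contraction on square-summable sequences. -/

section Operators

theorem norm_sq_le_of_forall {x y z : Ltwo} (h : ∀ i, ‖x i‖ ^ 2 ≤ ‖y i‖ ^ 2 + ‖z i‖ ^ 2) :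
    ‖x‖ ^ 2 ≤ ‖y‖ ^ 2 + ‖z‖ ^ 2 :=
  hasSum_le h (hasSum_norm_sq x) ((hasSum_norm_sq y).add (hasSum_norm_sq z))

/-- Multiplication of a square-summable sequence by a bounded sequence. -/
noncomputable def mulSeq (w : ℤ → ℂ) {C : ℝ} (hw : ∀ j, ‖w j‖ ≤ C) (x : Ltwo) : Ltwo :=
  ⟨fun j => w j * x j, (memlp_two_iff _).2 <| by
    refine Summable.of_nonneg_of_le (fun _ => by positivity) (fun j => ?_)
      ((hasSum_norm_sq x).summable.mul_left (C ^ 2))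
    rw [norm_mul, mul_pow]
    gcongr
    exact hw j⟩

@[simp] theorem mulSeq_apply (w : ℤ → ℂ) {C : ℝ} (hw : ∀ j, ‖w j‖ ≤ C) (x : Ltwo) (j : ℤ) :
    mulSeq w hw x j = w j * x j := rfl

theorem mulSeq_sub (w : ℤ → ℂ) {C : ℝ} (hw : ∀ j, ‖w j‖ ≤ C) (x y : Ltwo) :
    mulSeq w hw (x - y) = mulSeq w hw x - mulSeq w hw y := by
  ext j; simp [mul_sub]

theorem norm_mulSeq_le (w : ℤ → ℂ) {C : ℝ} (hw : ∀ j, ‖w j‖ ≤ C) (x : Ltwo) :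
    ‖mulSeq w hw x‖ ≤ C * ‖x‖ := by
  have hC : 0 ≤ C := (norm_nonneg _).trans (hw 0)
  refine le_of_sq_le_sq ?_ (by positivity)
  rw [mul_pow]
  refine hasSum_le (fun j => ?_) (hasSum_norm_sq (mulSeq w hw x))
    ((hasSum_norm_sq x).mul_left (C ^ 2))
  rw [mulSeq_apply, norm_mul, mul_pow]
  gcongr
  exact hw j

/-- The sequence equal to `x` on nonnegative and to `y` on negative indices. -/
noncomputable def mix (x y : Ltwo) : Ltwo :=
  ⟨fun k => if 0 ≤ k then x k else y k, (memlp_two_iff _).2 <| by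
    refine Summable.of_nonneg_of_le (fun _ => by positivity) (fun j => ?_)
      ((hasSum_norm_sq x).summable.add (hasSum_norm_sq y).summable)
    split_ifs
    · exact le_add_of_nonneg_right (by positivity)
    · exact le_add_of_nonneg_left (by positivity)⟩

theorem mix_apply (x y : Ltwo) (k : ℤ) : mix x y k = if 0 ≤ k then x k else y k := rfl

@[simp] theorem mix_natCast (x y : Ltwo) (n : ℕ) : mix x y (n : ℤ) = x n := by
  simp [mix_apply]

@[simp] theorem mix_neg_add_one (x y : Ltwo) (n : ℕ) :
    mix x y (-((n : ℤ) + 1)) = y (-((n : ℤ) + 1)) := by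
  rw [mix_apply, if_neg (by omega)]

theorem mix_sub (x y x' y' : Ltwo) : mix (x - x') (y - y') = mix x y - mix x' y' := by
  ext k
  simp only [mix_apply, lp.coeFn_sub, Pi.sub_apply]
  split_ifs <;> rfl

theorem norm_mix_sq_le (x y : Ltwo) : ‖mix x y‖ ^ 2 ≤ ‖x‖ ^ 2 + ‖y‖ ^ 2 := by
  refine norm_sq_le_of_forall fun i => ?_
  rw [mix_apply]
  split_ifs
  · exact le_add_of_nonneg_right (by positivity)
  · exact le_add_of_nonneg_left (by positivity)

theorem norm_mix_zero_sq_add (a : Ltwo) : ‖mix a 0‖ ^ 2 + ‖mix 0 a‖ ^ 2 = ‖a‖ ^ 2 := by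
  refine ((hasSum_norm_sq (mix a 0)).add (hasSum_norm_sq (mix 0 a))).unique
    (hasSum_of_eq (hasSum_norm_sq a) (fun i => ?_) rfl)
  rw [mix_apply, mix_apply]
  split_ifs <;> simp

/-- The diagonal blocks of the discrete Hilbert matrix with respect to the splitting into
nonnegative and negative indices. -/
noncomputable def hilBlock (a : Ltwo) : Ltwo := mix (hilOp (mix a 0)) (hilOp (mix 0 a))

theorem hilBlock_sub (a a' : Ltwo) : hilBlock (a - a') = hilBlock a - hilBlock a' := by
  unfold hilBlock
  rw [← mix_sub, ← map_sub, ← map_sub, ← mix_sub, ← mix_sub, sub_zero]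

/-- Pythagoras on the output, the isometry on each half, and Pythagoras on the input. -/
theorem norm_hilBlock_le (a : Ltwo) : ‖hilBlock a‖ ≤ ‖a‖ := by
  refine le_of_sq_le_sq ?_ (norm_nonneg _)
  refine (norm_mix_sq_le _ _).trans ?_
  rw [hilOp.norm_map, hilOp.norm_map, norm_mix_zero_sq_add]

/-- Banach's fixed point theorem: the Hilbert matrix is isometric, its diagonal blocks and `v` do
not increase norms, so the Lipschitz constant is that of `w`. -/
theorem existsUnique_fixedPoint {w v : ℤ → ℂ} {ρ : ℝ} (hρ : ρ < 1) (hw : ∀ j, ‖w j‖ ≤ ρ)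
    (hv : ∀ j, ‖v j‖ ≤ 1) (α β : Ltwo) :
    ∃! a : Ltwo, a = mulSeq w hw (hilOp (mulSeq v hv (hilBlock a) + β)) + α := by
  have hρ0 : 0 ≤ ρ := (norm_nonneg _).trans (hw 0)
  set Φ : Ltwo → Ltwo := fun a => mulSeq w hw (hilOp (mulSeq v hv (hilBlock a) + β)) + α
  have hΦ : ContractingWith ⟨ρ, hρ0⟩ Φ := by
    refine ⟨by exact_mod_cast hρ, LipschitzWith.of_dist_le_mul fun a a' => ?_⟩
    have : Φ a - Φ a' = mulSeq w hw (hilOp (mulSeq v hv (hilBlock (a - a')))) := by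
      simp only [Φ]
      rw [hilBlock_sub, mulSeq_sub, map_sub, mulSeq_sub, map_add, map_add, add_sub_add_right_eq_sub,
        ← mulSeq_sub, ← mulSeq_sub, add_sub_add_right_eq_sub]
    rw [dist_eq_norm, dist_eq_norm, this]
    refine (norm_mulSeq_le _ _ _).trans ?_
    refine mul_le_mul_of_nonneg_left ?_ hρ0
    rw [hilOp.norm_map]
    refine (norm_mulSeq_le _ _ _).trans ?_
    rw [one_mul]
    exact norm_hilBlock_le _
  refine ⟨hΦ.fixedPoint, hΦ.fixedPoint_isFixedPt.symm, fun a ha => ?_⟩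
  exact hΦ.fixedPoint_unique (x := a) ha.symm

theorem hasSum_int_split {M : Type*} [NormedAddCommGroup M] [CompleteSpace M] {f : ℤ → M} {s : M}
    (h : HasSum f s) :
    (Summable fun n : ℕ => f n) ∧ (Summable fun n : ℕ => f (-((n : ℤ) + 1))) ∧
      s = (∑' n : ℕ, f n) + ∑' n : ℕ, f (-((n : ℤ) + 1)) := by
  have h1 : Summable fun n : ℕ => f n := h.summable.comp_injective Nat.cast_injective
  have h2 : Summable fun n : ℕ => f (-((n : ℤ) + 1)) :=
    h.summable.comp_injective (i := fun n : ℕ => -((n : ℤ) + 1)) (fun a b hab => by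
      simpa using hab)
  exact ⟨h1, h2, h.unique (HasSum.of_nat_of_neg_add_one h1.hasSum h2.hasSum)⟩

theorem ofReal_hil (n : ℤ) : (hil n : ℂ) = 2 / Real.pi * (1 / (2 * n + 1)) := by
  unfold hil oddInv; push_cast; rfl

theorem summable_of_mul_left {c : ℂ} (hc : c ≠ 0) {f g : ℕ → ℂ} (hf : Summable f)
    (h : ∀ n, f n = c * g n) : Summable g := by
  obtain rfl : f = fun n => c * g n := funext h
  exact (summable_mul_left_iff hc).1 hf

theorem two_div_pi_ne_zero : (2 / Real.pi : ℂ) ≠ 0 := by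
  have : (Real.pi : ℂ) ≠ 0 := by exact_mod_cast Real.pi_ne_zero
  exact div_ne_zero two_ne_zero this

/-- The columns `k = m` and `k = -(m + 1)` yield the denominators `2n + 2m + 1` and `2n - 2m - 1`,
the two kernels in the equation for `A⁺`. -/
theorem hilOp_natCast (b : Ltwo) (n : ℕ) :
    (Summable fun m : ℕ => b m / (2 * n + 2 * m + 1 : ℂ)) ∧
    (Summable fun m : ℕ => b (-((m : ℤ) + 1)) / (2 * n - 2 * m - 1 : ℂ)) ∧
    hilOp b n = 2 / Real.pi * ((∑' m : ℕ, b m / (2 * n + 2 * m + 1 : ℂ)) +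
      ∑' m : ℕ, b (-((m : ℤ) + 1)) / (2 * n - 2 * m - 1 : ℂ)) := by
  obtain ⟨h1, h2, h3⟩ := hasSum_int_split (hasSum_hilOp b n)
  have e1 : ∀ m : ℕ, (hil (n + m) : ℂ) * b m = 2 / Real.pi * (b m / (2 * n + 2 * m + 1 : ℂ)) := by
    intro m; rw [ofReal_hil]; push_cast; ring
  have e2 : ∀ m : ℕ, (hil (n + -((m : ℤ) + 1)) : ℂ) * b (-((m : ℤ) + 1)) =
      2 / Real.pi * (b (-((m : ℤ) + 1)) / (2 * n - 2 * m - 1 : ℂ)) := by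
    intro m; rw [ofReal_hil]; push_cast
    rw [show (2 * (n + -((m : ℂ) + 1)) + 1) = 2 * n - 2 * m - 1 by ring]; ring
  refine ⟨summable_of_mul_left two_div_pi_ne_zero h1 e1,
    summable_of_mul_left two_div_pi_ne_zero h2 e2, ?_⟩
  rw [h3, tsum_congr e1, tsum_congr e2, tsum_mul_left, tsum_mul_left, mul_add]

/-- In the row `-(n + 1)` both denominators change sign, which accounts for the factor `-(2 / π)` in
the equation for `A⁻`. -/
theorem hilOp_neg_add_one (b : Ltwo) (n : ℕ) :
    (Summable fun m : ℕ => b m / (2 * n - 2 * m + 1 : ℂ)) ∧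
    (Summable fun m : ℕ => b (-((m : ℤ) + 1)) / (2 * n + 2 * m + 3 : ℂ)) ∧
    hilOp b (-((n : ℤ) + 1)) = -(2 / Real.pi) * ((∑' m : ℕ, b m / (2 * n - 2 * m + 1 : ℂ)) +
      ∑' m : ℕ, b (-((m : ℤ) + 1)) / (2 * n + 2 * m + 3 : ℂ)) := by
  obtain ⟨h1, h2, h3⟩ := hasSum_int_split (hasSum_hilOp b (-((n : ℤ) + 1)))
  have e1 : ∀ m : ℕ, (hil (-((n : ℤ) + 1) + m) : ℂ) * b m =
      -(2 / Real.pi) * (b m / (2 * n - 2 * m + 1 : ℂ)) := by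
    intro m; rw [ofReal_hil]; push_cast
    rw [show (2 * (-((n : ℂ) + 1) + m) + 1) = -(2 * n - 2 * m + 1) by ring, div_neg]; ring
  have e2 : ∀ m : ℕ, (hil (-((n : ℤ) + 1) + -((m : ℤ) + 1)) : ℂ) * b (-((m : ℤ) + 1)) =
      -(2 / Real.pi) * (b (-((m : ℤ) + 1)) / (2 * n + 2 * m + 3 : ℂ)) := by
    intro m; rw [ofReal_hil]; push_cast
    rw [show (2 * (-((n : ℂ) + 1) + -((m : ℂ) + 1)) + 1) = -(2 * n + 2 * m + 3) by ring, div_neg]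
    ring
  refine ⟨summable_of_mul_left (neg_ne_zero.2 two_div_pi_ne_zero) h1 e1,
    summable_of_mul_left (neg_ne_zero.2 two_div_pi_ne_zero) h2 e2, ?_⟩
  rw [h3, tsum_congr e1, tsum_congr e2, tsum_mul_left, tsum_mul_left, mul_add]

theorem hilBlock_natCast (a : Ltwo) (n : ℕ) :
    (Summable fun m : ℕ => a m / (2 * n + 2 * m + 1 : ℂ)) ∧
    hilBlock a n = 2 / Real.pi * ∑' m : ℕ, a m / (2 * n + 2 * m + 1 : ℂ) := by
  obtain ⟨h1, -, h3⟩ := hilOp_natCast (mix a 0) n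
  simp only [mix_natCast, mix_neg_add_one] at h1 h3
  refine ⟨h1, ?_⟩
  rw [hilBlock, mix_natCast, h3]
  simp

theorem hilBlock_neg_add_one (a : Ltwo) (n : ℕ) :
    (Summable fun m : ℕ => a (-((m : ℤ) + 1)) / (2 * n + 2 * m + 3 : ℂ)) ∧
    hilBlock a (-((n : ℤ) + 1)) =
      -(2 / Real.pi) * ∑' m : ℕ, a (-((m : ℤ) + 1)) / (2 * n + 2 * m + 3 : ℂ) := by
  obtain ⟨-, h1, h3⟩ := hilOp_neg_add_one (mix 0 a) n
  simp only [mix_natCast, mix_neg_add_one] at h1 h3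
  refine ⟨h1, ?_⟩
  rw [hilBlock, mix_neg_add_one, h3]
  simp

end Operators

/-! ### The infinite systems as a fixed point problem. -/

section Systems

/-- The two-sided sequence with values `p n` at `n` and `q n` at `-(n + 1)`. -/
def zseq {M : Type*} (p q : ℕ → M) (j : ℤ) : M := if 0 ≤ j then p j.toNat else q (-(j + 1)).toNat

@[simp] theorem zseq_natCast {M : Type*} (p q : ℕ → M) (n : ℕ) : zseq p q (n : ℤ) = p n := by
  simp [zseq]

@[simp] theorem zseq_neg_add_one {M : Type*} (p q : ℕ → M) (n : ℕ) :
    zseq p q (-((n : ℤ) + 1)) = q n := by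
  rw [zseq, if_neg (by omega)]
  congr 1
  omega

theorem int_forall_iff {P : ℤ → Prop} :
    (∀ j, P j) ↔ (∀ n : ℕ, P n) ∧ ∀ n : ℕ, P (-((n : ℤ) + 1)) := by
  refine ⟨fun h => ⟨fun n => h n, fun n => h _⟩, fun h j => ?_⟩
  rcases le_or_gt 0 j with hj | hj
  · obtain ⟨n, rfl⟩ := Int.eq_ofNat_of_zero_le hj
    exact h.1 n
  · obtain ⟨n, hn⟩ := Int.eq_ofNat_of_zero_le (a := -j - 1) (by omega)
    rw [show j = -((n : ℤ) + 1) by omega]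
    exact h.2 n

/-- Geometric decay with ratio `ρ`. -/
def GeomDecay (ρ : ℝ) (p : ℕ → ℂ) : Prop := ∃ C, ∀ n, ‖p n‖ ≤ C * ρ ^ n

theorem GeomDecay.summable_sq {ρ : ℝ} (h0 : 0 ≤ ρ) (h1 : ρ < 1) {p : ℕ → ℂ}
    (h : GeomDecay ρ p) : Summable fun n => ‖p n‖ ^ 2 := by
  obtain ⟨C, hC⟩ := h
  refine Summable.of_nonneg_of_le (fun _ => by positivity) (fun n => ?_)
    ((summable_geometric_of_lt_one (r := ρ ^ 2) (by positivity) (by nlinarith)).mul_left (C ^ 2))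
  calc ‖p n‖ ^ 2 ≤ (C * ρ ^ n) ^ 2 := by gcongr; exact hC n
    _ = C ^ 2 * (ρ ^ 2) ^ n := by ring

theorem GeomDecay.mul_const {ρ : ℝ} {p : ℕ → ℂ} (h : GeomDecay ρ p) (c : ℂ) :
    GeomDecay ρ fun n => p n * c := by
  obtain ⟨C, hC⟩ := h
  refine ⟨C * ‖c‖, fun n => ?_⟩
  rw [norm_mul, mul_right_comm]
  gcongr
  exact hC n

theorem GeomDecay.mul_of_bounded {ρ : ℝ} {p q : ℕ → ℂ} (h : GeomDecay ρ p) {D : ℝ}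
    (hq : ∀ n, ‖q n‖ ≤ D) : GeomDecay ρ fun n => p n * q n := by
  obtain ⟨C, hC⟩ := h
  refine ⟨C * D, fun n => ?_⟩
  rw [norm_mul, mul_right_comm]
  have := (norm_nonneg _).trans (hC n)
  gcongr
  · exact hC n
  · exact hq n

theorem memlp_zseq {ρ : ℝ} (h0 : 0 ≤ ρ) (h1 : ρ < 1) {p q : ℕ → ℂ}
    (hp : GeomDecay ρ p) (hq : GeomDecay ρ q) : Memℓp (zseq p q) 2 := by
  rw [memlp_two_iff]
  refine Summable.of_nat_of_neg_add_one ?_ ?_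
  · simpa using hp.summable_sq h0 h1
  · simpa only [zseq_neg_add_one] using hq.summable_sq h0 h1

/-- The square-summable two-sided sequence made of two geometrically decaying sequences. -/
noncomputable def ltwoSeq {ρ : ℝ} (h0 : 0 ≤ ρ) (h1 : ρ < 1) {p q : ℕ → ℂ}
    (hp : GeomDecay ρ p) (hq : GeomDecay ρ q) : Ltwo := ⟨zseq p q, memlp_zseq h0 h1 hp hq⟩

@[simp] theorem ltwoSeq_natCast {ρ : ℝ} (h0 : 0 ≤ ρ) (h1 : ρ < 1) {p q : ℕ → ℂ}
    (hp : GeomDecay ρ p) (hq : GeomDecay ρ q) (n : ℕ) :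
    ltwoSeq h0 h1 hp hq (n : ℤ) = p n := zseq_natCast p q n

@[simp] theorem ltwoSeq_neg_add_one {ρ : ℝ} (h0 : 0 ≤ ρ) (h1 : ρ < 1) {p q : ℕ → ℂ}
    (hp : GeomDecay ρ p) (hq : GeomDecay ρ q) (n : ℕ) :
    ltwoSeq h0 h1 hp hq (-((n : ℤ) + 1)) = q n := zseq_neg_add_one p q n

theorem Ltwo_ext {x y : Ltwo} (h1 : ∀ n : ℕ, x n = y n)
    (h2 : ∀ n : ℕ, x (-((n : ℤ) + 1)) = y (-((n : ℤ) + 1))) : x = y := by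
  ext j
  exact int_forall_iff (P := fun j => x j = y j).2 ⟨h1, h2⟩ j

/-- The larger of the two ratios `lam1` and `lam0 / lam1`. -/
noncomputable def ratio (lam0 lam1 : ℝ) : ℝ := max lam1 (lam0 / lam1)

variable {lam0 lam1 : ℝ}

theorem ratio_nonneg (h1 : 0 < lam1) : 0 ≤ ratio lam0 lam1 := h1.le.trans (le_max_left _ _)

theorem ratio_lt_one (h0 : 0 < lam0) (h01 : lam0 < lam1) (h1 : lam1 < 1) :
    ratio lam0 lam1 < 1 :=
  max_lt h1 ((div_lt_one (h0.trans h01)).2 h01)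

theorem norm_lam1_le (h1 : 0 < lam1) : ‖(lam1 : ℂ)‖ ≤ ratio lam0 lam1 := by
  rw [Complex.norm_real, Real.norm_of_nonneg h1.le]
  exact le_max_left _ _

theorem norm_mu_le (h0 : 0 < lam0) (h1 : 0 < lam1) : ‖(lam0 / lam1 : ℂ)‖ ≤ ratio lam0 lam1 := by
  rw [← Complex.ofReal_div, Complex.norm_real, Real.norm_of_nonneg (by positivity)]
  exact le_max_right _ _

theorem norm_pow_le_ratio {z : ℂ} {ρ : ℝ} (hz : ‖z‖ ≤ ρ) (h1 : ρ ≤ 1) {m n : ℕ} (h : n ≤ m) :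
    ‖z ^ m‖ ≤ ρ ^ n := by
  have h0 := (norm_nonneg z).trans hz
  rw [norm_pow]
  exact (pow_le_pow_left₀ (norm_nonneg _) hz m).trans (pow_le_pow_of_le_one h0 h1 h)

theorem geomDecay_pow {z : ℂ} {ρ : ℝ} (hz : ‖z‖ ≤ ρ) (h1 : ρ ≤ 1) {f : ℕ → ℕ}
    (h : ∀ n, n ≤ f n) : GeomDecay ρ fun n => z ^ f n :=
  ⟨1, fun n => by rw [one_mul]; exact norm_pow_le_ratio hz h1 (h n)⟩

theorem norm_div_le_of_one_le {c z : ℂ} (hz : 1 ≤ ‖z‖) : ‖c / z‖ ≤ ‖c‖ := by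
  rw [norm_div]
  exact div_le_self (norm_nonneg _) hz

theorem one_le_norm_intCast {k : ℤ} (hk : k ≠ 0) : 1 ≤ ‖(k : ℂ)‖ := by
  rw [Complex.norm_intCast]
  exact_mod_cast Int.one_le_abs hk

/-- The denominators grow with `n`, so absolute convergence for `n = 0` bounds the sums for all `n`
at once. -/
theorem norm_div_two_mul_add_le {c : ℕ} (hc : 0 < c) (z : ℂ) (n m : ℕ) :
    ‖z / (2 * n + 2 * m + c : ℂ)‖ ≤ ‖z / (2 * (0 : ℕ) + 2 * m + c : ℂ)‖ := by
  have h : ∀ k : ℕ, ‖(2 * k + 2 * m + c : ℂ)‖ = 2 * k + 2 * m + c := fun k => by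
    rw [show (2 * k + 2 * m + c : ℂ) = ((2 * k + 2 * m + c : ℕ) : ℂ) by push_cast; ring,
      Complex.norm_natCast]
    push_cast; ring
  rw [norm_div, norm_div, h, h]
  have hc' : (0 : ℝ) < c := by exact_mod_cast hc
  gcongr
  simp

theorem norm_tsum_div_le {c : ℕ} (hc : 0 < c) {p : ℕ → ℂ}
    (h : Summable fun m : ℕ => p m / (2 * (0 : ℕ) + 2 * m + c : ℂ)) (n : ℕ) :
    ‖∑' m : ℕ, p m / (2 * n + 2 * m + c : ℂ)‖ ≤
      ∑' m : ℕ, ‖p m / (2 * (0 : ℕ) + 2 * m + c : ℂ)‖ :=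
  tsum_of_norm_bounded h.norm.hasSum fun m => norm_div_two_mul_add_le hc (p m) n m

theorem norm_tsum_div_int_le {p : ℕ → ℂ} (h : Summable fun m => ‖p m‖) {f : ℕ → ℂ}
    (hf : ∀ m, ∃ k : ℤ, k ≠ 0 ∧ f m = k) : ‖∑' m : ℕ, p m / f m‖ ≤ ∑' m, ‖p m‖ := by
  refine tsum_of_norm_bounded h.hasSum fun m => ?_
  obtain ⟨k, hk, he⟩ := hf m
  rw [he]
  exact norm_div_le_of_one_le (one_le_norm_intCast hk)

theorem GeomDecay.summable_norm {ρ : ℝ} (h0 : 0 ≤ ρ) (h1 : ρ < 1) {p : ℕ → ℂ}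
    (h : GeomDecay ρ p) : Summable fun n => ‖p n‖ := by
  obtain ⟨C, hC⟩ := h
  exact Summable.of_nonneg_of_le (fun _ => norm_nonneg _) hC
    ((summable_geometric_of_lt_one h0 h1).mul_left C)

theorem norm_kron_le (l k : Fin 3) : ‖kron l k‖ ≤ 1 := by
  unfold kron; split_ifs <;> simp

/-- A two-stage bootstrap. In the equations for `B^±` the denominators increase with `n`, so the
sums are bounded and the powers of `λ₁` and `μ` give decay. Those for `A^±` contain `2n - 2m ∓ 1`,
which is not monotone; but the `B^±` are absolutely summable by then, and every denominator is a
nonzero integer. -/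
theorem SolvesSystems.geomDecay (h0 : 0 < lam0) (h01 : lam0 < lam1) (h1 : lam1 < 1) {K : Coeffs}
    (hK : SolvesSystems lam0 lam1 K) (l : Fin 3) :
    GeomDecay (ratio lam0 lam1) (K.Ap l) ∧ GeomDecay (ratio lam0 lam1) (K.Am l) ∧
    GeomDecay (ratio lam0 lam1) (K.Bp l) ∧ GeomDecay (ratio lam0 lam1) (K.Bm l) := by
  have hl1 := h0.trans h01
  have hr0 := ratio_nonneg (lam0 := lam0) hl1
  have hr1 := ratio_lt_one h0 h01 h1
  have hBm : GeomDecay (ratio lam0 lam1) (K.Bm l) := by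
    have : ∀ n : ℕ, ‖2 / Real.pi * ((∑' m : ℕ, K.Ap l m / (2 * n + 2 * m + 1)) - kron l 0)‖ ≤
        ‖(2 / Real.pi : ℂ)‖ * ((∑' m : ℕ, ‖K.Ap l m / (2 * (0 : ℕ) + 2 * m + 1)‖) + 1) := fun n => by
      rw [norm_mul]
      gcongr
      refine (norm_sub_le _ _).trans (add_le_add ?_ (norm_kron_le _ _))
      exact_mod_cast norm_tsum_div_le (c := 1) one_pos (p := K.Ap l)
        (by exact_mod_cast hK.summable_Ap l 0) n
    obtain ⟨C, hC⟩ := (geomDecay_pow (f := fun n => 2 * n) (norm_lam1_le (lam0 := lam0) hl1) hr1.le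
      (fun n => by omega)).mul_of_bounded this
    refine ⟨C, fun n => (congrArg norm ?_).trans_le (hC n)⟩
    rw [hK.eq_Bm]; ring
  have hBp : GeomDecay (ratio lam0 lam1) (K.Bp l) := by
    have : ∀ n : ℕ, ‖-(2 / Real.pi) * ((∑' m : ℕ, K.Am l m / (2 * n + 2 * m + 3)) + kron l 2)‖ ≤
        ‖-(2 / Real.pi : ℂ)‖ * ((∑' m : ℕ, ‖K.Am l m / (2 * (0 : ℕ) + 2 * m + 3)‖) + 1) := fun n => by
      rw [norm_mul]
      gcongr
      refine (norm_add_le _ _).trans (add_le_add ?_ (norm_kron_le _ _))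
      exact_mod_cast norm_tsum_div_le (c := 3) three_pos (p := K.Am l)
        (by exact_mod_cast hK.summable_Am l 0) n
    obtain ⟨C, hC⟩ := (geomDecay_pow (f := fun n => 2 * n + 2) (norm_mu_le h0 hl1) hr1.le
      (fun n => by omega)).mul_of_bounded this
    refine ⟨C, fun n => (congrArg norm ?_).trans_le (hC n)⟩
    rw [hK.eq_Bp]; ring
  have sBm := hBm.summable_norm hr0 hr1
  have sBp := hBp.summable_norm hr0 hr1
  refine ⟨?_, ?_, hBp, hBm⟩
  · have : ∀ n : ℕ, ‖2 / Real.pi * ((∑' m : ℕ, K.Bm l m / (2 * n + 2 * m + 1)) +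
        (∑' m : ℕ, K.Bp l m / (2 * n - 2 * m - 1)) + kron l 1)‖ ≤
        ‖(2 / Real.pi : ℂ)‖ * ((∑' m : ℕ, ‖K.Bm l m‖) + (∑' m : ℕ, ‖K.Bp l m‖) + 1) := fun n => by
      rw [norm_mul]
      gcongr
      refine (norm_add₃_le).trans (add_le_add_three ?_ ?_ (norm_kron_le _ _))
      · exact norm_tsum_div_int_le sBm fun m => ⟨2 * n + 2 * m + 1, by omega, by push_cast; ring⟩
      · exact norm_tsum_div_int_le sBp fun m => ⟨2 * n - 2 * m - 1, by omega, by push_cast; ring⟩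
    obtain ⟨C, hC⟩ := (geomDecay_pow (f := fun n => 2 * n + 1) (norm_lam1_le (lam0 := lam0) hl1)
      hr1.le (fun n => by omega)).mul_of_bounded this
    refine ⟨C, fun n => (congrArg norm ?_).trans_le (hC n)⟩
    rw [hK.eq_Ap]; ring
  · have : ∀ n : ℕ, ‖-(2 / Real.pi) * ((∑' m : ℕ, K.Bp l m / (2 * n + 2 * m + 3)) +
        (∑' m : ℕ, K.Bm l m / (2 * n - 2 * m + 1)) - kron l 1)‖ ≤
        ‖-(2 / Real.pi : ℂ)‖ * ((∑' m : ℕ, ‖K.Bp l m‖) + (∑' m : ℕ, ‖K.Bm l m‖) + 1) := fun n => by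
      rw [norm_mul]
      gcongr
      refine (norm_sub_le _ _).trans (add_le_add ((norm_add_le _ _).trans (add_le_add ?_ ?_))
        (norm_kron_le _ _))
      · exact norm_tsum_div_int_le sBp fun m => ⟨2 * n + 2 * m + 3, by omega, by push_cast; ring⟩
      · exact norm_tsum_div_int_le sBm fun m => ⟨2 * n - 2 * m + 1, by omega, by push_cast; ring⟩
    obtain ⟨C, hC⟩ := (geomDecay_pow (f := fun n => 2 * n + 1) (norm_mu_le h0 hl1)
      hr1.le (fun n => by omega)).mul_of_bounded this
    refine ⟨C, fun n => (congrArg norm ?_).trans_le (hC n)⟩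
    rw [hK.eq_Am]; ring

/-- The multiplier of the equations at the odd integers. -/
noncomputable def oddWeight (lam0 lam1 : ℝ) : ℤ → ℂ :=
  zseq (fun n => (lam1 : ℂ) ^ (2 * n + 1)) (fun n => ((lam0 : ℂ) / lam1) ^ (2 * n + 1))

/-- The multiplier of the equations at the even integers. -/
noncomputable def evenWeight (lam0 lam1 : ℝ) : ℤ → ℂ :=
  zseq (fun n => (lam1 : ℂ) ^ (2 * n)) (fun n => ((lam0 : ℂ) / lam1) ^ (2 * n + 2))

theorem norm_oddWeight_le (h0 : 0 < lam0) (h01 : lam0 < lam1) (h1 : lam1 < 1) (j : ℤ) :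
    ‖oddWeight lam0 lam1 j‖ ≤ ratio lam0 lam1 := by
  have hr1 := (ratio_lt_one h0 h01 h1).le
  revert j
  rw [int_forall_iff]
  refine ⟨fun n => ?_, fun n => ?_⟩
  · rw [oddWeight, zseq_natCast]
    simpa using norm_pow_le_ratio (norm_lam1_le (lam0 := lam0) (h0.trans h01)) hr1
      (show 1 ≤ 2 * n + 1 by omega)
  · rw [oddWeight, zseq_neg_add_one]
    simpa using norm_pow_le_ratio (norm_mu_le h0 (h0.trans h01)) hr1
      (show 1 ≤ 2 * n + 1 by omega)

theorem norm_evenWeight_le (h0 : 0 < lam0) (h01 : lam0 < lam1) (h1 : lam1 < 1) (j : ℤ) :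
    ‖evenWeight lam0 lam1 j‖ ≤ 1 := by
  have hr1 := (ratio_lt_one h0 h01 h1).le
  revert j
  rw [int_forall_iff]
  refine ⟨fun n => ?_, fun n => ?_⟩
  · rw [evenWeight, zseq_natCast]
    simpa using norm_pow_le_ratio (norm_lam1_le (lam0 := lam0) (h0.trans h01)) hr1
      (show 0 ≤ 2 * n by omega)
  · rw [evenWeight, zseq_neg_add_one]
    simpa using norm_pow_le_ratio (norm_mu_le h0 (h0.trans h01)) hr1
      (show 0 ≤ 2 * n + 2 by omega)

/-- The free terms of the equations at the odd integers. -/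
noncomputable def oddFree (h0 : 0 < lam0) (h01 : lam0 < lam1) (h1 : lam1 < 1) (l : Fin 3) :
    Ltwo :=
  ltwoSeq (ratio_nonneg (lam0 := lam0) (h0.trans h01)) (ratio_lt_one h0 h01 h1)
    ((geomDecay_pow (norm_lam1_le (lam0 := lam0) (h0.trans h01)) (ratio_lt_one h0 h01 h1).le
      (f := fun n => 2 * n + 1) (fun n => by omega)).mul_const (2 / Real.pi * kron l 1))
    ((geomDecay_pow (norm_mu_le h0 (h0.trans h01)) (ratio_lt_one h0 h01 h1).le
      (f := fun n => 2 * n + 1) (fun n => by omega)).mul_const (2 / Real.pi * kron l 1))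

/-- The free terms of the equations at the even integers. -/
noncomputable def evenFree (h0 : 0 < lam0) (h01 : lam0 < lam1) (h1 : lam1 < 1) (l : Fin 3) :
    Ltwo :=
  ltwoSeq (ratio_nonneg (lam0 := lam0) (h0.trans h01)) (ratio_lt_one h0 h01 h1)
    ((geomDecay_pow (norm_lam1_le (lam0 := lam0) (h0.trans h01)) (ratio_lt_one h0 h01 h1).le
      (f := fun n => 2 * n) (fun n => by omega)).mul_const (-(2 / Real.pi) * kron l 0))
    ((geomDecay_pow (norm_mu_le h0 (h0.trans h01)) (ratio_lt_one h0 h01 h1).le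
      (f := fun n => 2 * n + 2) (fun n => by omega)).mul_const (-(2 / Real.pi) * kron l 2))

/-- The two-sided sequence at the even integers determined by the one at the odd integers. -/
noncomputable def evenSeq (h0 : 0 < lam0) (h01 : lam0 < lam1) (h1 : lam1 < 1) (l : Fin 3)
    (a : Ltwo) : Ltwo :=
  mulSeq _ (norm_evenWeight_le h0 h01 h1) (hilBlock a) + evenFree h0 h01 h1 l

/-- The affine map whose fixed points are the solutions of the systems. -/
noncomputable def systemMap (h0 : 0 < lam0) (h01 : lam0 < lam1) (h1 : lam1 < 1) (l : Fin 3)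
    (a : Ltwo) : Ltwo :=
  mulSeq _ (norm_oddWeight_le h0 h01 h1) (hilOp (evenSeq h0 h01 h1 l a)) + oddFree h0 h01 h1 l

variable (h0 : 0 < lam0) (h01 : lam0 < lam1) (h1 : lam1 < 1) (l : Fin 3) (a : Ltwo) (n : ℕ)

theorem evenSeq_natCast : evenSeq h0 h01 h1 l a n = 2 * (lam1 : ℂ) ^ (2 * n) / Real.pi *
    ((∑' m : ℕ, a m / (2 * n + 2 * m + 1)) - kron l 0) := by
  simp only [evenSeq, evenFree, lp.coeFn_add, Pi.add_apply, mulSeq_apply, evenWeight, zseq_natCast,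
    ltwoSeq_natCast, (hilBlock_natCast a n).2]
  ring

theorem evenSeq_neg_add_one : evenSeq h0 h01 h1 l a (-((n : ℤ) + 1)) =
    -(2 / Real.pi) * ((lam0 : ℂ) / lam1) ^ (2 * n + 2) *
    ((∑' m : ℕ, a (-((m : ℤ) + 1)) / (2 * n + 2 * m + 3)) + kron l 2) := by
  simp only [evenSeq, evenFree, lp.coeFn_add, Pi.add_apply, mulSeq_apply, evenWeight,
    zseq_neg_add_one, ltwoSeq_neg_add_one, (hilBlock_neg_add_one a n).2]
  ring

theorem systemMap_natCast : systemMap h0 h01 h1 l a n = 2 * (lam1 : ℂ) ^ (2 * n + 1) / Real.pi *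
    ((∑' m : ℕ, evenSeq h0 h01 h1 l a m / (2 * n + 2 * m + 1)) +
      (∑' m : ℕ, evenSeq h0 h01 h1 l a (-((m : ℤ) + 1)) / (2 * n - 2 * m - 1)) + kron l 1) := by
  simp only [systemMap, oddFree, lp.coeFn_add, Pi.add_apply, mulSeq_apply, oddWeight, zseq_natCast,
    ltwoSeq_natCast, (hilOp_natCast _ n).2.2]
  ring

theorem systemMap_neg_add_one : systemMap h0 h01 h1 l a (-((n : ℤ) + 1)) =
    -(2 / Real.pi) * ((lam0 : ℂ) / lam1) ^ (2 * n + 1) *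
    ((∑' m : ℕ, evenSeq h0 h01 h1 l a (-((m : ℤ) + 1)) / (2 * n + 2 * m + 3)) +
      (∑' m : ℕ, evenSeq h0 h01 h1 l a m / (2 * n - 2 * m + 1)) - kron l 1) := by
  simp only [systemMap, oddFree, lp.coeFn_add, Pi.add_apply, mulSeq_apply, oddWeight,
    zseq_neg_add_one, ltwoSeq_neg_add_one, (hilOp_neg_add_one _ n).2.2]
  ring

theorem existsUnique_systemMap : ∃! a : Ltwo, a = systemMap h0 h01 h1 l a :=
  existsUnique_fixedPoint (ratio_lt_one h0 h01 h1) _ _ _ _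

/-- Decay puts the `A^±` in `ℓ²`. Two of the equations then identify the `B^±` with `evenSeq`, and
the other two become the fixed point equation. -/
theorem SolvesSystems.exists_fixedPoint {K : Coeffs} (hK : SolvesSystems lam0 lam1 K) :
    ∃ a : Ltwo, a = systemMap h0 h01 h1 l a ∧ (∀ n : ℕ, K.Ap l n = a n) ∧
      (∀ n : ℕ, K.Am l n = a (-((n : ℤ) + 1))) ∧
      (∀ n : ℕ, K.Bm l n = evenSeq h0 h01 h1 l a n) ∧
      (∀ n : ℕ, K.Bp l n = evenSeq h0 h01 h1 l a (-((n : ℤ) + 1))) := by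
  obtain ⟨dAp, dAm, -, -⟩ := hK.geomDecay h0 h01 h1 l
  set a := ltwoSeq (ratio_nonneg (lam0 := lam0) (h0.trans h01)) (ratio_lt_one h0 h01 h1) dAp dAm
    with ha
  have e1 : ∀ n : ℕ, K.Ap l n = a n := fun n => by simp [ha]
  have e2 : ∀ n : ℕ, K.Am l n = a (-((n : ℤ) + 1)) := fun n => by rw [ha, ltwoSeq_neg_add_one]
  have e3 : ∀ n : ℕ, K.Bm l n = evenSeq h0 h01 h1 l a n := fun n => by
    rw [evenSeq_natCast, hK.eq_Bm]; simp only [e1]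
  have e4 : ∀ n : ℕ, K.Bp l n = evenSeq h0 h01 h1 l a (-((n : ℤ) + 1)) := fun n => by
    rw [evenSeq_neg_add_one, hK.eq_Bp]; simp only [e2]
  refine ⟨a, Ltwo_ext (fun n => ?_) (fun n => ?_), e1, e2, e3, e4⟩
  · rw [systemMap_natCast, ← e1, hK.eq_Ap]; simp only [e3, e4]
  · rw [systemMap_neg_add_one, ← e2, hK.eq_Am]; simp only [e3, e4]

end Systems

theorem existsUnique_solvesSystems {lam0 lam1 : ℝ} (h0 : 0 < lam0) (h01 : lam0 < lam1)
    (h1 : lam1 < 1) : ∃! K : Coeffs, SolvesSystems lam0 lam1 K := by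
  choose a ha hu using fun l => existsUnique_systemMap h0 h01 h1 l
  simp only at ha hu
  refine ⟨⟨fun l n => a l n, fun l n => a l (-((n : ℤ) + 1)),
    fun l n => evenSeq h0 h01 h1 l (a l) (-((n : ℤ) + 1)),
    fun l n => evenSeq h0 h01 h1 l (a l) n⟩, ?_, ?_⟩
  · constructor <;> intro l n <;> dsimp only
    · exact (hilBlock_natCast (a l) n).1
    · exact (hilBlock_neg_add_one (a l) n).1
    · exact (hilOp_natCast _ n).1
    · exact (hilOp_neg_add_one _ n).1
    · exact (hilOp_neg_add_one _ n).2.1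
    · exact (hilOp_natCast _ n).2.1
    · exact evenSeq_natCast h0 h01 h1 l (a l) n
    · conv_lhs => rw [ha l]
      exact systemMap_natCast h0 h01 h1 l (a l) n
    · conv_lhs => rw [ha l]
      exact systemMap_neg_add_one h0 h01 h1 l (a l) n
    · exact evenSeq_neg_add_one h0 h01 h1 l (a l) n
  · intro K hK
    choose a' ha' e1 e2 e3 e4 using fun l => hK.exists_fixedPoint h0 h01 h1 l
    obtain rfl : a' = a := funext fun l => hu l _ (ha' l)
    cases K
    simp only at e1 e2 e3 e4
    congr
    · ext l n; exact e1 l n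
    · ext l n; exact e2 l n
    · ext l n; exact e4 l n
    · ext l n; exact e3 l n

/-! ### Series of simple fractions with integer poles. -/

section PoleSeries

/-- The series of simple fractions with poles at the integers `a m` and residues `c m`. -/
noncomputable def poleSeries (a : ℕ → ℤ) (c : ℕ → ℂ) (s : ℂ) : ℂ := ∑' m, c m / (s - a m)

/-- The points at distance at least `δ` from all integers. -/
def farSet (δ : ℝ) : Set ℂ := {s | ∀ k : ℤ, δ ≤ ‖s - k‖}

variable {a : ℕ → ℤ} {c : ℕ → ℂ} {δ : ℝ} {s : ℂ}

theorem norm_div_sub_le (hδ : 0 < δ) (hs : ∀ m, δ ≤ ‖s - a m‖) (m : ℕ) :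
    ‖c m / (s - a m)‖ ≤ ‖c m‖ * δ⁻¹ := by
  rw [norm_div, div_eq_mul_inv]
  gcongr
  exact hs m

theorem summable_poleSeries (hc : Summable fun m => ‖c m‖) (hδ : 0 < δ)
    (hs : ∀ m, δ ≤ ‖s - a m‖) : Summable fun m => c m / (s - a m) :=
  Summable.of_norm_bounded (hc.mul_right _) (norm_div_sub_le hδ hs)

/-- Every set of integers is closed in `ℂ`, so a point outside the set has a uniform distance from
all of it. -/
theorem exists_ball_far_of_int {s : ℂ} (hs : ∀ m, s ≠ a m) :
    ∃ ε > 0, ∀ z ∈ Metric.ball s ε, ∀ m, ε ≤ ‖z - a m‖ := by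
  have hcl : IsClosed (Set.range fun m => (a m : ℂ)) := by
    have h : IsClosed (((↑) : ℤ → ℂ) '' (Set.range a)) :=
      Complex.isometry_intCast.isClosedEmbedding.isClosedMap _ (isClosed_discrete _)
    rwa [← Set.range_comp] at h
  have hn : (Set.range fun m => (a m : ℂ))ᶜ ∈ 𝓝 s := hcl.isOpen_compl.mem_nhds (by
    rintro ⟨m, hm⟩; exact hs m hm.symm)
  obtain ⟨ε, hε, h⟩ := Metric.mem_nhds_iff.1 hn
  refine ⟨ε / 2, by positivity, fun z hz m => ?_⟩
  by_contra! hlt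
  refine h (a := (a m : ℂ)) ?_ ⟨m, rfl⟩
  rw [Metric.mem_ball, dist_eq_norm] at hz ⊢
  calc ‖(a m : ℂ) - s‖ ≤ ‖(a m : ℂ) - z‖ + ‖z - s‖ := norm_sub_le_norm_sub_add_norm_sub _ _ _
    _ < ε := by rw [norm_sub_rev]; linarith

theorem differentiableAt_poleSeries (hc : Summable fun m => ‖c m‖) (hs : ∀ m, s ≠ a m) :
    DifferentiableAt ℂ (poleSeries a c) s := by
  obtain ⟨ε, hε, h⟩ := exists_ball_far_of_int hs
  refine (Complex.differentiableOn_tsum_of_summable_norm (hc.mul_right ε⁻¹) (fun m => ?_)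
    Metric.isOpen_ball (fun m z hz => norm_div_sub_le hε (h z hz) m)).differentiableAt
    (Metric.isOpen_ball.mem_nhds (Metric.mem_ball_self hε))
  refine DifferentiableOn.div (by fun_prop) (by fun_prop) fun z hz h0 => ?_
  have := h z hz m
  rw [h0, norm_zero] at this
  linarith

/-- From `|s| ≤ |s - a| + |a|`: one additional moment of the coefficients buys the decay `1 / |s|`,
in all directions, including along the row of poles. -/
theorem norm_mul_norm_poleSeries_le (hc : Summable fun m => ‖c m‖ * (1 + |(a m : ℝ)|))
    (hδ : 0 < δ) (hs : ∀ m, δ ≤ ‖s - a m‖) :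
    ‖s‖ * ‖poleSeries a c s‖ ≤ (∑' m, ‖c m‖ * (1 + |(a m : ℝ)|)) * (1 + δ⁻¹) := by
  rw [← norm_mul, poleSeries, ← tsum_mul_left]
  refine tsum_of_norm_bounded (hc.hasSum.mul_right _) fun m => ?_
  have hp : 0 < ‖s - a m‖ := hδ.trans_le (hs m)
  have h1 : ‖s‖ ≤ ‖s - a m‖ + |(a m : ℝ)| := by
    rw [← Complex.norm_intCast]
    simpa using norm_add_le (s - a m) (a m)
  have h2 : |(a m : ℝ)| / ‖s - a m‖ ≤ |(a m : ℝ)| * δ⁻¹ := by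
    rw [div_eq_mul_inv]; gcongr; exact hs m
  have h3 : ‖s‖ / ‖s - a m‖ ≤ 1 + |(a m : ℝ)| * δ⁻¹ := by
    calc ‖s‖ / ‖s - a m‖ ≤ (‖s - a m‖ + |(a m : ℝ)|) / ‖s - a m‖ := by gcongr
      _ = 1 + |(a m : ℝ)| / ‖s - a m‖ := by rw [add_div, div_self hp.ne']
      _ ≤ _ := by linarith
  have h4 : 1 + |(a m : ℝ)| * δ⁻¹ ≤ (1 + |(a m : ℝ)|) * (1 + δ⁻¹) := by
    have := abs_nonneg (a m : ℝ)
    have := inv_pos.2 hδ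
    nlinarith
  rw [norm_mul, norm_div, mul_div_left_comm, mul_assoc]
  gcongr
  exact h3.trans h4

theorem norm_poleSeries_le (hc : Summable fun m => ‖c m‖) (hδ : 0 < δ)
    (hs : ∀ m, δ ≤ ‖s - a m‖) : ‖poleSeries a c s‖ ≤ (∑' m, ‖c m‖) * δ⁻¹ :=
  tsum_of_norm_bounded (hc.hasSum.mul_right _) (norm_div_sub_le hδ hs)

theorem int_dist_ge {n k : ℤ} (h : k ≠ n) {z : ℂ} {r : ℝ} (hz : ‖z - n‖ ≤ r) :
    1 - r ≤ ‖z - k‖ := by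
  have h1 : 1 ≤ ‖((n - k : ℤ) : ℂ)‖ := one_le_norm_intCast (by omega)
  have h2 : ‖((n - k : ℤ) : ℂ)‖ ≤ ‖z - n‖ + ‖z - k‖ := by
    rw [norm_sub_rev z n]; push_cast
    exact norm_sub_le_norm_sub_add_norm_sub _ _ _
  linarith

/-- The residue of a series of simple fractions at an integer. -/
theorem tendsto_sub_mul_poleSeries (hc : Summable fun m => ‖c m‖) (n : ℤ) :
    Tendsto (fun z => (z - n) * poleSeries a c z) (𝓝[≠] (n : ℂ))
      (𝓝 (∑' m, if a m = n then c m else 0)) := by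
  simp only [poleSeries, ← tsum_mul_left]
  refine tendsto_tsum_of_dominated_convergence hc (fun m => ?_) ?_
  · split_ifs with h
    · subst h
      refine tendsto_const_nhds.congr' ?_
      filter_upwards [self_mem_nhdsWithin] with z hz
      have : z - a m ≠ 0 := sub_ne_zero.2 hz
      field_simp
    · have : ContinuousAt (fun z : ℂ => (z - n) * (c m / (z - a m))) n := by
        refine ContinuousAt.mul (by fun_prop) (ContinuousAt.div (by fun_prop) (by fun_prop) ?_)
        rw [sub_ne_zero]
        exact fun h' => h (by exact_mod_cast h'.symm)
      simpa using this.tendsto.mono_left nhdsWithin_le_nhds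
  · have hb : Metric.ball (n : ℂ) (1 / 2) ∈ 𝓝[≠] (n : ℂ) :=
      mem_nhdsWithin_of_mem_nhds (Metric.ball_mem_nhds _ (by norm_num))
    filter_upwards [hb, self_mem_nhdsWithin] with z hz hz' m
    rw [Metric.mem_ball, dist_eq_norm] at hz
    -- In the disc of radius `1 / 2` no integer is closer to `z` than `n`; hence `(z - n) / (z - a
    -- m)` has norm at most one and `‖c m‖` dominates.
    have hle : ‖z - n‖ ≤ ‖z - a m‖ := by
      by_cases h : a m = n
      · rw [h]
      · have := int_dist_ge h hz.le
        linarith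
    rw [norm_mul, norm_div, mul_div_left_comm]
    refine mul_le_of_le_one_right (norm_nonneg _) (div_le_one_of_le₀ hle (norm_nonneg _))

theorem tendsto_sub_mul_poleSeries_of_mem (hc : Summable fun m => ‖c m‖)
    (ha : Function.Injective a) {n : ℤ} (m : ℕ) (h : a m = n) :
    Tendsto (fun z => (z - n) * poleSeries a c z) (𝓝[≠] (n : ℂ)) (𝓝 (c m)) := by
  convert tendsto_sub_mul_poleSeries (a := a) hc n using 2
  rw [tsum_eq_single m fun m' hm' => if_neg fun h' => hm' (ha (h'.trans h.symm)), if_pos h]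

theorem tendsto_sub_mul_poleSeries_of_notMem (hc : Summable fun m => ‖c m‖) {n : ℤ}
    (h : ∀ m, a m ≠ n) :
    Tendsto (fun z => (z - n) * poleSeries a c z) (𝓝[≠] (n : ℂ)) (𝓝 0) := by
  convert tendsto_sub_mul_poleSeries (a := a) hc n using 2
  simp [h]

end PoleSeries

/-! ### Bounds and residues of `cot (π s / 2)` and `tan (π s / 2)`. -/

section Trigonometry

theorem norm_sin_sq (z : ℂ) : ‖Complex.sin z‖ ^ 2 = Real.sin z.re ^ 2 + Real.sinh z.im ^ 2 := by
  rw [Complex.sin_eq, ← Complex.normSq_eq_norm_sq, Complex.normSq_apply]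
  have h1 : (Complex.sin z.re * Complex.cosh z.im + Complex.cos z.re * Complex.sinh z.im *
      Complex.I) = ((Real.sin z.re * Real.cosh z.im : ℝ) : ℂ) +
      ((Real.cos z.re * Real.sinh z.im : ℝ) : ℂ) * Complex.I := by push_cast; ring
  rw [h1]
  simp only [Complex.add_re, Complex.add_im, Complex.re_ofReal_mul, Complex.im_ofReal_mul,
    Complex.ofReal_re, Complex.ofReal_im, Complex.I_re, Complex.I_im]
  have h2 := Real.cosh_sq z.im
  have h3 := Real.sin_sq_add_cos_sq z.re
  linear_combination (Real.sin z.re) ^ 2 * h2 + (Real.sinh z.im) ^ 2 * h3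

theorem sq_le_sinh_sq (y : ℝ) : y ^ 2 ≤ Real.sinh y ^ 2 := by
  rw [sq_le_sq, Real.abs_sinh]
  exact Real.self_le_sinh_iff.2 (abs_nonneg y)

/-- `|sin (x + iy)|² = sin² x + sinh² y`; Jordan's inequality handles the first summand in the strip
and `|sinh y| ≥ |y|` the second. -/
theorem norm_le_norm_sin_half_pi {u : ℂ} (hu : |u.re| ≤ 1) :
    ‖u‖ ≤ ‖Complex.sin (Real.pi * u / 2)‖ := by
  refine le_of_sq_le_sq ?_ (norm_nonneg _)
  have e : (Real.pi * u / 2 : ℂ) = ((Real.pi / 2 : ℝ) : ℂ) * u := by push_cast; ring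
  rw [norm_sin_sq, e, Complex.re_ofReal_mul, Complex.im_ofReal_mul, ← Complex.normSq_eq_norm_sq,
    Complex.normSq_apply, ← sq, ← sq]
  have hpi := Real.pi_pos
  refine add_le_add ?_ ?_
  · rw [sq_le_sq]
    have h := Real.mul_abs_le_abs_sin (x := Real.pi / 2 * u.re) (by
      rw [abs_mul, abs_of_pos (by positivity : 0 < Real.pi / 2)]
      exact mul_le_of_le_one_right (by positivity) hu)
    rw [abs_mul, abs_of_pos (by positivity : 0 < Real.pi / 2)] at h
    calc |u.re| = 2 / Real.pi * (Real.pi / 2 * |u.re|) := by field_simp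
      _ ≤ _ := h
  · refine le_trans ?_ (sq_le_sinh_sq _)
    rw [mul_pow]
    exact le_mul_of_one_le_left (sq_nonneg _) (by nlinarith [Real.pi_gt_three])

/-- Antiperiodicity moves the nearest even integer to the origin, where `norm_le_norm_sin_half_pi`
applies. -/
theorem norm_sin_half_pi_ge {s : ℂ} {δ : ℝ} (hs : ∀ k : ℤ, δ ≤ ‖s - 2 * k‖) :
    δ ≤ ‖Complex.sin (Real.pi * s / 2)‖ := by
  set k : ℤ := round (s.re / 2)
  have h1 : |(s - 2 * k).re| ≤ 1 := by
    have := abs_sub_round (s.re / 2)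
    have e : (s - 2 * k).re = 2 * (s.re / 2 - k) := by simp; ring
    rw [e, abs_mul, abs_of_pos (by norm_num : (0 : ℝ) < 2)]
    linarith
  have h2 : Complex.sin (Real.pi * s / 2) =
      (-1) ^ k * Complex.sin (Real.pi * (s - 2 * k) / 2) := by
    rw [← Int.cast_negOnePow ℂ k, ← zsmul_eq_mul, ← Complex.sin_antiperiodic.add_zsmul_eq]
    congr 1; rw [zsmul_eq_mul]; ring
  rw [h2, norm_mul, norm_zpow, norm_neg, norm_one, one_zpow, one_mul]
  exact (hs k).trans (norm_le_norm_sin_half_pi h1)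

/-- From `cos² = 1 - sin²` one gets `|cos| ≤ 1 + |sin|`, and `|sin|` is at least `δ`. -/
theorem norm_cot_half_pi_le {s : ℂ} {δ : ℝ} (hδ : 0 < δ) (hs : ∀ k : ℤ, δ ≤ ‖s - 2 * k‖) :
    ‖Complex.cot (Real.pi * s / 2)‖ ≤ 1 + δ⁻¹ := by
  have h := norm_sin_half_pi_ge hs
  set z : ℂ := Real.pi * s / 2
  have h0 : 0 < ‖Complex.sin z‖ := hδ.trans_le h
  have h1 : ‖Complex.cos z‖ ≤ 1 + ‖Complex.sin z‖ := by
    refine le_of_sq_le_sq ?_ (by positivity)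
    rw [← norm_pow, Complex.cos_sq']
    refine (norm_sub_le _ _).trans ?_
    rw [norm_one, norm_pow]
    nlinarith
  rw [Complex.cot, norm_div]
  calc ‖Complex.cos z‖ / ‖Complex.sin z‖ ≤ (1 + ‖Complex.sin z‖) / ‖Complex.sin z‖ := by gcongr
    _ = 1 + ‖Complex.sin z‖⁻¹ := by field_simp; ring
    _ ≤ 1 + δ⁻¹ := by gcongr

theorem tan_half_pi_eq (s : ℂ) :
    Complex.tan (Real.pi * s / 2) = -Complex.cot (Real.pi * (s - 1) / 2) := by
  rw [show (Real.pi * (s - 1) / 2 : ℂ) = Real.pi * s / 2 - Real.pi / 2 by ring, Complex.cot,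
    Complex.tan, Complex.cos_sub_pi_div_two, Complex.sin_sub_pi_div_two, div_neg, neg_neg]

theorem norm_tan_half_pi_le {s : ℂ} {δ : ℝ} (hδ : 0 < δ) (hs : ∀ k : ℤ, δ ≤ ‖s - (2 * k + 1)‖) :
    ‖Complex.tan (Real.pi * s / 2)‖ ≤ 1 + δ⁻¹ := by
  rw [tan_half_pi_eq, norm_neg]
  exact norm_cot_half_pi_le hδ fun k => by rw [sub_sub, add_comm]; exact hs k

theorem sin_half_pi_ne_zero {s : ℂ} (hs : ∀ k : ℤ, s ≠ 2 * k) :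
    Complex.sin (Real.pi * s / 2) ≠ 0 := by
  rw [Ne, Complex.sin_eq_zero_iff]
  rintro ⟨k, hk⟩
  have hpi : (Real.pi : ℂ) ≠ 0 := by exact_mod_cast Real.pi_ne_zero
  refine hs k (mul_left_cancel₀ hpi ?_)
  linear_combination 2 * hk

theorem cos_half_pi_ne_zero {s : ℂ} (hs : ∀ k : ℤ, s ≠ 2 * k + 1) :
    Complex.cos (Real.pi * s / 2) ≠ 0 := by
  rw [Ne, Complex.cos_eq_zero_iff]
  rintro ⟨k, hk⟩
  have hpi : (Real.pi : ℂ) ≠ 0 := by exact_mod_cast Real.pi_ne_zero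
  refine hs k (mul_left_cancel₀ hpi ?_)
  linear_combination 2 * hk

theorem differentiableAt_cot_half_pi {s : ℂ} (hs : ∀ k : ℤ, s ≠ 2 * k) :
    DifferentiableAt ℂ (fun s : ℂ => Complex.cot (Real.pi * s / 2)) s := by
  simp only [Complex.cot]
  exact DifferentiableAt.div (by fun_prop) (by fun_prop) (sin_half_pi_ne_zero hs)

theorem differentiableAt_tan_half_pi {s : ℂ} (hs : ∀ k : ℤ, s ≠ 2 * k + 1) :
    DifferentiableAt ℂ (fun s : ℂ => Complex.tan (Real.pi * s / 2)) s := by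
  simp only [Complex.tan]
  exact DifferentiableAt.div (by fun_prop) (by fun_prop) (cos_half_pi_ne_zero hs)

/-- The slope of `sin (π z / 2)` at its zero tends to `(π / 2) cos`, so the cosine cancels and the
residue is `2 / π` at every even integer. -/
theorem tendsto_sub_mul_cot (k : ℤ) :
    Tendsto (fun z : ℂ => (z - (2 * k : ℤ)) * Complex.cot (Real.pi * z / 2))
      (𝓝[≠] ((2 * k : ℤ) : ℂ)) (𝓝 (2 / Real.pi)) := by
  set n : ℂ := ((2 * k : ℤ) : ℂ) with hn
  have hpi : (Real.pi : ℂ) ≠ 0 := by exact_mod_cast Real.pi_ne_zero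
  have hcos : Complex.cos (Real.pi * n / 2) ≠ 0 := cos_half_pi_ne_zero fun j h => by
    rw [hn] at h
    have : (2 * k : ℤ) = 2 * j + 1 := by exact_mod_cast h
    omega
  have hsin : Complex.sin (Real.pi * n / 2) = 0 := by
    rw [Complex.sin_eq_zero_iff]; exact ⟨k, by rw [hn]; push_cast; ring⟩
  have hd : HasDerivAt (fun z : ℂ => Complex.sin (Real.pi * z / 2))
      (Complex.cos (Real.pi * n / 2) * (Real.pi / 2)) n := by
    have h1 : HasDerivAt (fun z : ℂ => (Real.pi * z / 2 : ℂ)) (Real.pi / 2) n := by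
      simpa using ((hasDerivAt_id n).const_mul (Real.pi : ℂ)).div_const 2
    exact h1.csin
  have h2 := (hasDerivAt_iff_tendsto_slope.1 hd).inv₀ (mul_ne_zero hcos (by simp))
  have h3 : Tendsto (fun z : ℂ => Complex.cos (Real.pi * z / 2)) (𝓝[≠] n)
      (𝓝 (Complex.cos (Real.pi * n / 2))) :=
    (Continuous.tendsto (by fun_prop) n).mono_left nhdsWithin_le_nhds
  have h4 := h2.mul h3
  convert h4 using 2 with z
  · rw [slope_def_field, hsin, Complex.cot]
    simp only [sub_zero, inv_div]
    ring
  · field_simp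

theorem tendsto_sub_mul_tan (k : ℤ) :
    Tendsto (fun z : ℂ => (z - (2 * k + 1 : ℤ)) * Complex.tan (Real.pi * z / 2))
      (𝓝[≠] ((2 * k + 1 : ℤ) : ℂ)) (𝓝 (-(2 / Real.pi))) := by
  have hs : Tendsto (fun z : ℂ => z - 1) (𝓝[≠] ((2 * k + 1 : ℤ) : ℂ)) (𝓝[≠] ((2 * k : ℤ) : ℂ)) := by
    refine tendsto_nhdsWithin_iff.2 ⟨?_, ?_⟩
    · have : Tendsto (fun z : ℂ => z - 1) (𝓝 ((2 * k + 1 : ℤ) : ℂ))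
          (𝓝 (((2 * k + 1 : ℤ) : ℂ) - 1)) := Continuous.tendsto (by fun_prop) _
      convert this.mono_left nhdsWithin_le_nhds using 2
      push_cast; ring
    · filter_upwards [self_mem_nhdsWithin] with z hz h
      refine hz ?_
      simp only [Set.mem_singleton_iff] at h ⊢
      push_cast at h ⊢
      linear_combination h
  refine ((tendsto_sub_mul_cot k).comp hs).neg.congr fun z => ?_
  simp only [Function.comp_apply]
  rw [tan_half_pi_eq]
  push_cast
  ring

end Trigonometry

/-! ### Extension by limits across removable singularities. -/

section RemovableSingularities

theorem eventually_ne_int (c : ℂ) : ∀ᶠ z : ℂ in 𝓝[≠] c, ∀ k : ℤ, z ≠ k := by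
  by_cases hc : ∃ n : ℤ, c = n
  · obtain ⟨n, rfl⟩ := hc
    have hb : Metric.ball (n : ℂ) (1 / 2) ∈ 𝓝[≠] (n : ℂ) :=
      mem_nhdsWithin_of_mem_nhds (Metric.ball_mem_nhds _ (by norm_num))
    filter_upwards [hb, self_mem_nhdsWithin] with z hz hz' k hk
    rw [Metric.mem_ball, dist_eq_norm] at hz
    rcases eq_or_ne k n with rfl | h
    · exact hz' hk
    · have := int_dist_ge h hz.le
      rw [hk, sub_self, norm_zero] at this
      linarith
  · push Not at hc
    -- All integers are listed as a sequence, since the lemma speaks of sequences of poles.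
    obtain ⟨ε, hε, h⟩ := exists_ball_far_of_int
      (a := fun m : ℕ => (Equiv.intEquivNat.symm m : ℤ)) (s := c) (fun m => hc _)
    filter_upwards [mem_nhdsWithin_of_mem_nhds (Metric.ball_mem_nhds c hε)] with z hz k hk
    have := h z hz (Equiv.intEquivNat k)
    rw [Equiv.symm_apply_apply, hk, sub_self, norm_zero] at this
    linarith

variable {f : ℂ → ℂ}

theorem limUnder_eq_of_continuousAt {s : ℂ} (h : ContinuousAt f s) :
    limUnder (𝓝[≠] s) f = f s :=
  (h.tendsto.mono_left nhdsWithin_le_nhds).limUnder_eq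

/-- Riemann's removable singularity theorem. It changes the value at `c` only; at nearby nonintegers
`f` is continuous, so the punctured limit returns `f` itself. -/
theorem analyticAt_limUnder {c : ℂ} (hd : ∀ s : ℂ, (∀ k : ℤ, s ≠ k) → DifferentiableAt ℂ f s)
    (ho : Tendsto (fun z => (z - c) * f z) (𝓝[≠] c) (𝓝 0)) :
    AnalyticAt ℂ (fun s => limUnder (𝓝[≠] s) f) c := by
  set S : Set ℂ := insert c {z | ∀ k : ℤ, z ≠ k} with hS
  have hSc : S ∈ 𝓝 c := insert_mem_nhds_iff.2 (eventually_ne_int c)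
  have hdS : DifferentiableOn ℂ f (S \ {c}) := fun z hz =>
    (hd z (hz.1.resolve_left hz.2)).differentiableWithinAt
  -- The criterion subtracts the value `f c`, which carries no information; it adds only `(z - c) f
  -- c`, which tends to zero.
  have ho' : (fun z => f z - f c) =o[𝓝[≠] c] fun z => (z - c)⁻¹ := by
    rw [isLittleO_iff_tendsto']
    · have h1 : Tendsto (fun z => (z - c) * f c) (𝓝[≠] c) (𝓝 0) := by
        have : Tendsto (fun z => (z - c) * f c) (𝓝 c) (𝓝 ((c - c) * f c)) :=
          Continuous.tendsto (by fun_prop) c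
        rw [sub_self, zero_mul] at this
        exact this.mono_left nhdsWithin_le_nhds
      have h2 := ho.sub h1
      rw [sub_zero] at h2
      refine h2.congr fun z => ?_
      rw [div_inv_eq_mul]; ring
    · filter_upwards [self_mem_nhdsWithin] with z hz h
      exact absurd (inv_eq_zero.1 h) (sub_ne_zero.2 hz)
  have h := (Complex.differentiableOn_update_limUnder_of_isLittleO hSc hdS ho').analyticAt hSc
  refine h.congr ?_
  filter_upwards [hSc] with z hz
  by_cases hzc : z = c
  · rw [hzc, Function.update_self]
  · rw [Function.update_of_ne hzc]
    exact (limUnder_eq_of_continuousAt (hd z (hz.resolve_left hzc)).continuousAt).symm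

end RemovableSingularities

/-! ### Boundedness and sectorial limits via the maximum principle. -/

section Tame

/-- `f` is differentiable off the integers, its singularities at the integers of the half-plane
`η ≤ σ Re s` are removable, and away from the integers of that half-plane it is bounded and
approaches `L` at least as fast as `1 / (σ Re s)`. -/
structure Tame (σ η δ : ℝ) (f : ℂ → ℂ) (L : ℂ) : Prop where
  diff : ∀ s : ℂ, (∀ k : ℤ, s ≠ k) → DifferentiableAt ℂ f s
  removable : ∀ n : ℤ, η ≤ σ * n → Tendsto (fun z => (z - n) * f z) (𝓝[≠] (n : ℂ)) (𝓝 0)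
  bound : ∃ C, ∀ s ∈ farSet δ, η ≤ σ * s.re →
    ‖f s - L‖ ≤ C ∧ (0 < σ * s.re → ‖f s - L‖ * (σ * s.re) ≤ C)

/-- The discs of radius `δ` about the integers which meet the half-plane `η ≤ σ Re s` lie in it. -/
structure Margin (σ η δ : ℝ) : Prop where
  sign : σ = 1 ∨ σ = -1
  pos : 0 < δ
  le : δ ≤ 1 / 4
  inside : ∀ (n : ℤ) (s z : ℂ), η ≤ σ * s.re → ‖s - n‖ ≤ δ → ‖z - n‖ ≤ δ → η ≤ σ * z.re

variable {σ η δ : ℝ} {f : ℂ → ℂ} {L : ℂ}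

theorem Tame.const_mul (h : Tame σ η δ f L) (c : ℂ) : Tame σ η δ (fun s => c * f s) (c * L) where
  diff s hs := (h.diff s hs).const_mul c
  removable n hn := by
    have := (h.removable n hn).const_mul c
    rw [mul_zero] at this
    exact this.congr fun z => by ring
  bound := by
    obtain ⟨C, hC⟩ := h.bound
    refine ⟨‖c‖ * C, fun s hs hs' => ?_⟩
    obtain ⟨h1, h2⟩ := hC s hs hs'
    rw [← mul_sub, norm_mul]
    refine ⟨by gcongr, fun h3 => ?_⟩
    rw [mul_assoc]
    have := h2 h3
    gcongr

theorem Tame.limUnder_eq (h : Tame σ η δ f L) {s : ℂ} (hs : ∀ k : ℤ, s ≠ k) :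
    limUnder (𝓝[≠] s) f = f s := limUnder_eq_of_continuousAt (h.diff s hs).continuousAt

theorem Tame.analyticAt (h : Tame σ η δ f L) {s : ℂ} (hs : η ≤ σ * s.re) :
    AnalyticAt ℂ (fun s => limUnder (𝓝[≠] s) f) s := by
  by_cases hk : ∃ n : ℤ, s = n
  · obtain ⟨n, rfl⟩ := hk
    exact analyticAt_limUnder h.diff (h.removable n (by simpa using hs))
  · push Not at hk
    refine analyticAt_limUnder h.diff ?_
    have hc : ContinuousAt (fun z => (z - s) * f z) s :=
      ContinuousAt.mul (by fun_prop) (h.diff s hk).continuousAt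
    simpa using hc.tendsto.mono_left nhdsWithin_le_nhds

theorem ne_int_of_mem_farSet (hδ : 0 < δ) {s : ℂ} (hs : s ∈ farSet δ) (k : ℤ) : s ≠ k := by
  rintro rfl
  have := hs k
  rw [sub_self, norm_zero] at this
  linarith

theorem exists_near_int {s : ℂ} (hs : s ∉ farSet δ) : ∃ n : ℤ, ‖s - n‖ < δ := by
  by_contra! h
  exact hs h

theorem mem_farSet_of_norm_eq (hδ : δ ≤ 1 / 4) {n : ℤ} {z : ℂ} (hz : ‖z - n‖ = δ) :
    z ∈ farSet δ := fun k => by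
  rcases eq_or_ne k n with rfl | h
  · exact hz.ge
  · have := int_dist_ge h hz.le
    linarith

/-- The maximum principle on the discs about the integers. -/
theorem Tame.norm_sub_le_of_near (h : Tame σ η δ f L) (hm : Margin σ η δ) {s : ℂ}
    (hs : η ≤ σ * s.re) {n : ℤ} (hn : ‖s - n‖ ≤ δ) {B : ℝ}
    (hB : ∀ z ∈ farSet δ, η ≤ σ * z.re → ‖z - n‖ = δ → ‖f z - L‖ ≤ B) :
    ‖limUnder (𝓝[≠] s) f - L‖ ≤ B := by
  have hfr : frontier (Metric.ball (n : ℂ) δ) = Metric.sphere (n : ℂ) δ :=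
    frontier_ball _ hm.pos.ne'
  have hcl : closure (Metric.ball (n : ℂ) δ) = Metric.closedBall (n : ℂ) δ :=
    closure_ball _ hm.pos.ne'
  refine Complex.norm_le_of_forall_mem_frontier_norm_le (U := Metric.ball (n : ℂ) δ)
    (f := fun s => limUnder (𝓝[≠] s) f - L) Metric.isBounded_ball ?_ ?_ ?_
  · refine DifferentiableOn.diffContOnCl fun z hz => ?_
    rw [hcl, Metric.mem_closedBall, dist_eq_norm] at hz
    exact ((h.analyticAt (hm.inside n s z hs hn hz)).differentiableAt.sub_const
      L).differentiableWithinAt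
  · intro z hz
    rw [hfr, mem_sphere_iff_norm] at hz
    have hfar := mem_farSet_of_norm_eq hm.le hz
    rw [h.limUnder_eq (ne_int_of_mem_farSet hm.pos hfar)]
    exact hB z hfar (hm.inside n s z hs hn hz.le) hz
  · rwa [hcl, Metric.mem_closedBall, dist_eq_norm]

theorem Tame.exists_norm_sub_le (h : Tame σ η δ f L) (hm : Margin σ η δ) :
    ∃ C, ∀ s : ℂ, η ≤ σ * s.re → ‖limUnder (𝓝[≠] s) f - L‖ ≤ C := by
  obtain ⟨C, hC⟩ := h.bound
  refine ⟨C, fun s hs => ?_⟩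
  by_cases hf : s ∈ farSet δ
  · rw [h.limUnder_eq (ne_int_of_mem_farSet hm.pos hf)]
    exact (hC s hf hs).1
  · obtain ⟨n, hn⟩ := exists_near_int hf
    exact h.norm_sub_le_of_near hm hs hn.le fun z hz hz' _ => (hC z hz hz').1

theorem eventually_norm_ge_atInfinityIn (D : Set ℂ) (R : ℝ) :
    ∀ᶠ s in atInfinityIn D, R ≤ ‖s‖ ∧ s ∈ D := by
  have h1 : ∀ᶠ s in Bornology.cobounded ℂ, R ≤ ‖s‖ :=
    (tendsto_norm_cobounded_atTop (E := ℂ)).eventually_ge_atTop R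
  exact (h1.filter_mono inf_le_left).and ((eventually_principal.2 fun _ h => h).filter_mono
    inf_le_right)

theorem Margin.abs_sign (hm : Margin σ η δ) : |σ| = 1 := by
  rcases hm.sign with h | h <;> simp [h]

/-- In the sector `‖s‖ ≤ (1 + M) σ Re s`, so decay in `σ Re s` is decay in `‖s‖`. Close to an
integer the bound is taken from the circle of radius `δ` about it. -/
theorem Tame.isBigO (h : Tame σ η δ f L) (hm : Margin σ η δ) {M : ℝ} (hM : 0 < M) :
    (fun s => limUnder (𝓝[≠] s) f - L)
      =O[atInfinityIn {s | |s.im| ≤ M * (σ * s.re)}] (fun s => s⁻¹) := by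
  obtain ⟨C, hC⟩ := h.bound
  refine IsBigO.of_bound (|C| * (2 + M)) ?_
  -- The radius `(1 + M) |η|` guarantees `η ≤ σ Re s`; the radius `1` absorbs the disc diameter in
  -- the second case.
  filter_upwards [eventually_norm_ge_atInfinityIn _ (max 1 ((1 + M) * |η|))] with s hs
  obtain ⟨hs1, hs2⟩ := hs
  have hsn : 1 ≤ ‖s‖ := (le_max_left _ _).trans hs1
  have hsη : (1 + M) * |η| ≤ ‖s‖ := (le_max_right _ _).trans hs1
  have hs2 : |s.im| ≤ M * (σ * s.re) := hs2
  have hre0 : 0 ≤ σ * s.re := by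
    by_contra! hneg
    have := abs_nonneg s.im
    nlinarith
  have hre1 : |s.re| = σ * s.re := by
    rw [← abs_of_nonneg hre0, abs_mul, hm.abs_sign, one_mul]
  have hre2 : ‖s‖ ≤ (1 + M) * (σ * s.re) := by
    have := Complex.norm_le_abs_re_add_abs_im s
    rw [hre1] at this
    linarith
  have hre3 : 0 < σ * s.re := by nlinarith
  have hD : η ≤ σ * s.re := by
    have h3 : (1 + M) * |η| ≤ (1 + M) * (σ * s.re) := hsη.trans hre2
    exact (le_abs_self η).trans (le_of_mul_le_mul_left h3 (by positivity))
  have hCabs := le_abs_self C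
  rw [norm_inv, ← div_eq_mul_inv, le_div_iff₀ (by positivity)]
  by_cases hf : s ∈ farSet δ
  · rw [h.limUnder_eq (ne_int_of_mem_farSet hm.pos hf)]
    have h4 := (hC s hf hD).2 hre3
    calc ‖f s - L‖ * ‖s‖ ≤ ‖f s - L‖ * ((1 + M) * (σ * s.re)) := by gcongr
      _ = (1 + M) * (‖f s - L‖ * (σ * s.re)) := by ring
      _ ≤ (1 + M) * |C| := by gcongr; exact h4.trans hCabs
      _ ≤ |C| * (2 + M) := by nlinarith [abs_nonneg C]
  · obtain ⟨n, hn⟩ := exists_near_int hf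
    have hδ := hm.le
    have hstep : ∀ z : ℂ, ‖z - n‖ ≤ δ → |σ * z.re - σ * n| ≤ 1 / 4 := fun z hz => by
      rw [← mul_sub, abs_mul, hm.abs_sign, one_mul]
      have := Complex.abs_re_le_norm (z - n)
      simp only [Complex.sub_re, Complex.intCast_re] at this
      linarith
    -- An integer this close to the sector lies on its side of the origin, so `σ n = |n|` and `‖s‖ ≤
    -- |n| + 1 / 4`.
    have hn1 : -1 < σ * n := by
      have := (abs_le.1 (hstep s hn.le)).2
      linarith
    have hn2 : σ * n = |(n : ℝ)| := by
      rcases hm.sign with hσ | hσ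
      · rw [hσ, one_mul] at hn1 ⊢
        have : -1 < n := by exact_mod_cast hn1
        rw [abs_of_nonneg (by exact_mod_cast (by omega : 0 ≤ n))]
      · rw [hσ, neg_one_mul] at hn1 ⊢
        have : n < 1 := by exact_mod_cast (by linarith : (n : ℝ) < 1)
        rw [abs_of_nonpos (by exact_mod_cast (by omega : n ≤ 0))]
    have hn3 : ‖s‖ ≤ |(n : ℝ)| + 1 / 4 := by
      rw [← Complex.norm_intCast]
      have := norm_add_le (s - n) (n : ℂ)
      rw [sub_add_cancel] at this
      linarith
    have hB := h.norm_sub_le_of_near hm hD hn.le (B := 2 * |C| / ‖s‖) fun z hz hz' hzn => by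
      have h5 := (abs_le.1 (hstep z hzn.le)).1
      -- Two errors of `1 / 4` give `σ Re z ≥ ‖s‖ - 1 / 2`, and `‖s‖ ≥ 1`.
      have h6 : ‖s‖ / 2 ≤ σ * z.re := by linarith
      rw [le_div_iff₀ (by positivity)]
      have h7 := (hC z hz hz').2 (by linarith)
      calc ‖f z - L‖ * ‖s‖ = 2 * (‖f z - L‖ * (‖s‖ / 2)) := by ring
        _ ≤ 2 * (‖f z - L‖ * (σ * z.re)) := by gcongr
        _ ≤ 2 * |C| := by gcongr; exact h7.trans hCabs
    rw [le_div_iff₀ (by positivity)] at hB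
    nlinarith [abs_nonneg C]

end Tame

/-! ### Cancellation of poles at the integers. -/

section Removable

theorem tendsto_punctured_of_continuousAt {f : ℂ → ℂ} {c : ℂ} (h : ContinuousAt f c) :
    Tendsto f (𝓝[≠] c) (𝓝 (f c)) := h.tendsto.mono_left nhdsWithin_le_nhds

theorem tendsto_sub_mul_of_continuousAt {f : ℂ → ℂ} {c : ℂ} (h : ContinuousAt f c) :
    Tendsto (fun z => (z - c) * f z) (𝓝[≠] c) (𝓝 0) := by
  have : ContinuousAt (fun z => (z - c) * f z) c := ContinuousAt.mul (by fun_prop) h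
  simpa using tendsto_punctured_of_continuousAt this

variable {h U V : ℂ → ℂ} {n : ℤ}

theorem int_ne_two_mul_of_odd {k : ℤ} (hk : n = 2 * k + 1) (j : ℤ) : (n : ℂ) ≠ 2 * j := by
  intro h
  have : n = 2 * j := by exact_mod_cast h
  omega

theorem int_ne_two_mul_add_one_of_even {k : ℤ} (hk : n = 2 * k) (j : ℤ) :
    (n : ℂ) ≠ 2 * j + 1 := by
  intro h
  have : n = 2 * j + 1 := by exact_mod_cast h
  omega

/-- At even integers the residue `2 / π` of the cotangent, times `h U`, is cancelled by that of `V`;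
at odd integers nothing is singular enough to matter. -/
theorem removable_cot (hh : ContinuousAt h n) (hU : ContinuousAt U n)
    (he : ∀ k, n = 2 * k → Tendsto (fun z => (z - n) * V z) (𝓝[≠] (n : ℂ))
      (𝓝 (-(2 / Real.pi) * h n * U n)))
    (ho : ∀ k, n = 2 * k + 1 → Tendsto (fun z => (z - n) * V z) (𝓝[≠] (n : ℂ)) (𝓝 0)) :
    Tendsto (fun z => (z - n) * (h z * Complex.cot (Real.pi * z / 2) * U z + V z))
      (𝓝[≠] (n : ℂ)) (𝓝 0) := by
  have hh' := tendsto_punctured_of_continuousAt hh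
  have hU' := tendsto_punctured_of_continuousAt hU
  obtain ⟨k, hk | hk⟩ := Int.even_or_odd' n
  · have h1 := tendsto_sub_mul_cot k
    rw [← hk] at h1
    have h2 := ((hh'.mul h1).mul hU').add (he k hk)
    rw [show h n * (2 / Real.pi : ℂ) * U n + -(2 / Real.pi) * h n * U n = 0 by ring] at h2
    exact h2.congr fun z => by ring
  · have h1 := tendsto_sub_mul_of_continuousAt
      (differentiableAt_cot_half_pi (int_ne_two_mul_of_odd hk)).continuousAt
    have h2 := ((hh'.mul h1).mul hU').add (ho k hk)
    rw [mul_zero, zero_mul, add_zero] at h2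
    exact h2.congr fun z => by ring

/-- At odd integers the residue `-(2 / π)` of the tangent is cancelled by `V`. At even integers `U`
may have a simple pole, since the tangent vanishes there. -/
theorem removable_tan (hh : ContinuousAt h n)
    (he : ∀ k, n = 2 * k → (∃ b, Tendsto (fun z => (z - n) * U z) (𝓝[≠] (n : ℂ)) (𝓝 b)) ∧
      Tendsto (fun z => (z - n) * V z) (𝓝[≠] (n : ℂ)) (𝓝 0))
    (ho : ∀ k, n = 2 * k + 1 → ContinuousAt U n ∧
      Tendsto (fun z => (z - n) * V z) (𝓝[≠] (n : ℂ)) (𝓝 (2 / Real.pi * h n * U n))) :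
    Tendsto (fun z => (z - n) * (h z * Complex.tan (Real.pi * z / 2) * U z + V z))
      (𝓝[≠] (n : ℂ)) (𝓝 0) := by
  have hh' := tendsto_punctured_of_continuousAt hh
  obtain ⟨k, hk | hk⟩ := Int.even_or_odd' n
  · obtain ⟨⟨b, hb⟩, hV⟩ := he k hk
    have h1 := tendsto_punctured_of_continuousAt
      (differentiableAt_tan_half_pi (int_ne_two_mul_add_one_of_even hk)).continuousAt
    have h3 : Complex.tan (Real.pi * (n : ℂ) / 2) = 0 := by
      rw [Complex.tan, show (Real.pi * (n : ℂ) / 2) = k * Real.pi by rw [hk]; push_cast; ring,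
        Complex.sin_int_mul_pi, zero_div]
    rw [h3] at h1
    have h2 := ((hh'.mul h1).mul hb).add hV
    rw [mul_zero, zero_mul, add_zero] at h2
    exact h2.congr fun z => by ring
  · obtain ⟨hU, hV⟩ := ho k hk
    have h1 := tendsto_sub_mul_tan k
    rw [← hk] at h1
    have h2 := ((hh'.mul h1).mul (tendsto_punctured_of_continuousAt hU)).add hV
    rw [show h n * (-(2 / Real.pi) : ℂ) * U n + 2 / Real.pi * h n * U n = 0 by ring] at h2
    exact h2.congr fun z => by ring

end Removable

/-! ### Tameness of an exponential term plus a decaying one. -/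

section TameEntries

theorem norm_ofReal_cpow_mul {ρ : ℝ} (hρ : 0 < ρ) (σ : ℝ) (s : ℂ) :
    ‖(ρ : ℂ) ^ ((σ : ℂ) * s)‖ = ρ ^ (σ * s.re) := by
  rw [Complex.norm_cpow_eq_rpow_re_of_pos hρ, Complex.re_ofReal_mul]

/-- `t ≤ exp t` with `t = -x log ρ`, which gives the constant `1 / (-log ρ)`. -/
theorem exists_rpow_mul_le {ρ : ℝ} (h0 : 0 < ρ) (h1 : ρ < 1) : ∃ C, ∀ x : ℝ, ρ ^ x * x ≤ C := by
  have hl : 0 < -Real.log ρ := neg_pos.2 (Real.log_neg h0 h1)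
  refine ⟨(-Real.log ρ)⁻¹, fun x => ?_⟩
  have h2 : -Real.log ρ * x ≤ Real.exp (-(Real.log ρ * x)) := by
    have := Real.add_one_le_exp (-(Real.log ρ * x))
    linarith
  rw [Real.rpow_def_of_pos h0, ← one_div, le_div_iff₀ hl]
  calc Real.exp (Real.log ρ * x) * x * -Real.log ρ
      = Real.exp (Real.log ρ * x) * (-Real.log ρ * x) := by ring
    _ ≤ Real.exp (Real.log ρ * x) * Real.exp (-(Real.log ρ * x)) := by gcongr
    _ = 1 := by rw [← Real.exp_add, add_neg_cancel, Real.exp_zero]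

variable {σ η δ ρ : ℝ} {E T U V : ℂ → ℂ} {L : ℂ}

theorem bound_of_decay (hm : Margin σ η δ) (hV : ∃ C, ∀ s ∈ farSet δ, ‖s‖ * ‖V s - L‖ ≤ C) :
    ∃ C, ∀ s ∈ farSet δ, η ≤ σ * s.re →
      ‖V s - L‖ ≤ C ∧ (0 < σ * s.re → ‖V s - L‖ * (σ * s.re) ≤ C) := by
  obtain ⟨C, hC⟩ := hV
  refine ⟨|C| * max 1 δ⁻¹, fun s hs _ => ?_⟩
  have h1 := (hC s hs).trans (le_abs_self C)
  -- Zero is itself an integer, so the decay estimate also gives boundedness.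
  have h2 : δ ≤ ‖s‖ := by simpa using hs 0
  have hδ := hm.pos
  constructor
  · have h3 : δ * ‖V s - L‖ ≤ |C| := le_trans (by gcongr) h1
    calc ‖V s - L‖ = δ * ‖V s - L‖ * δ⁻¹ := by field_simp
      _ ≤ |C| * max 1 δ⁻¹ := by gcongr; exact le_max_right _ _
  · intro h3
    have h4 : σ * s.re ≤ ‖s‖ := by
      refine (le_abs_self _).trans ?_
      rw [abs_mul, hm.abs_sign, one_mul]
      exact Complex.abs_re_le_norm s
    calc ‖V s - L‖ * (σ * s.re) ≤ ‖V s - L‖ * ‖s‖ := by gcongr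
      _ ≤ |C| * 1 := by rw [mul_comm, mul_one]; exact h1
      _ ≤ |C| * max 1 δ⁻¹ := by gcongr; exact le_max_left _ _

/-- The exponential has modulus `ρ ^ (σ Re s)`. It is at most `ρ⁻¹` on the half-plane because `η ≥
-1`, and remains bounded after multiplication by `σ Re s > 0`; so only `V` contributes to the limit.
-/
theorem tame_of_exponential (hm : Margin σ η δ) (hη : -1 ≤ η) (hρ0 : 0 < ρ) (hρ1 : ρ < 1)
    (hE : ∀ s, E s = (ρ : ℂ) ^ ((σ : ℂ) * s))
    (hdT : ∀ s : ℂ, (∀ k : ℤ, s ≠ k) → DifferentiableAt ℂ T s)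
    (hdU : ∀ s : ℂ, (∀ k : ℤ, s ≠ k) → DifferentiableAt ℂ U s)
    (hdV : ∀ s : ℂ, (∀ k : ℤ, s ≠ k) → DifferentiableAt ℂ V s)
    (hr : ∀ n : ℤ, η ≤ σ * n →
      Tendsto (fun z => (z - n) * (E z * T z * U z + V z)) (𝓝[≠] (n : ℂ)) (𝓝 0))
    (hT : ∃ C, ∀ s ∈ farSet δ, ‖T s‖ ≤ C) (hU : ∃ C, ∀ s ∈ farSet δ, ‖U s‖ ≤ C)
    (hV : ∃ C, ∀ s ∈ farSet δ, ‖s‖ * ‖V s - L‖ ≤ C) :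
    Tame σ η δ (fun s => E s * T s * U s + V s) L := by
  refine ⟨fun s hs => ?_, hr, ?_⟩
  · have hE' : E = fun s => (ρ : ℂ) ^ ((σ : ℂ) * s) := funext hE
    refine ((DifferentiableAt.mul ?_ (hdT s hs)).mul (hdU s hs)).add (hdV s hs)
    rw [hE']
    exact DifferentiableAt.const_cpow (by fun_prop) (Or.inl (by exact_mod_cast hρ0.ne'))
  · obtain ⟨CT, hT⟩ := hT
    obtain ⟨CU, hU⟩ := hU
    obtain ⟨CE, hCE⟩ := exists_rpow_mul_le hρ0 hρ1
    obtain ⟨C, hC⟩ := bound_of_decay (η := η) hm hV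
    refine ⟨(max ρ⁻¹ CE) * (|CT| * |CU|) + C, fun s hs hs' => ?_⟩
    obtain ⟨h1, h2⟩ := hC s hs hs'
    have hTU : ‖T s‖ * ‖U s‖ ≤ |CT| * |CU| := by
      gcongr
      · exact (hT s hs).trans (le_abs_self _)
      · exact (hU s hs).trans (le_abs_self _)
    have hEs : ‖E s‖ = ρ ^ (σ * s.re) := by rw [hE, norm_ofReal_cpow_mul hρ0]
    have hE1 : ‖E s‖ ≤ max ρ⁻¹ CE := by
      rw [hEs, ← Real.rpow_neg_one]
      exact (Real.rpow_le_rpow_of_exponent_ge hρ0 hρ1.le (hη.trans hs')).trans (le_max_left _ _)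
    have hM : 0 ≤ max ρ⁻¹ CE := (norm_nonneg _).trans hE1
    have h3 : ‖E s * T s * U s + V s - L‖ ≤ ‖E s‖ * (‖T s‖ * ‖U s‖) + ‖V s - L‖ := by
      rw [add_sub_assoc]
      refine (norm_add_le _ _).trans_eq ?_
      rw [norm_mul, norm_mul, mul_assoc]
    refine ⟨h3.trans (add_le_add (by gcongr) h1), fun h4 => ?_⟩
    calc ‖E s * T s * U s + V s - L‖ * (σ * s.re)
        ≤ (‖E s‖ * (‖T s‖ * ‖U s‖) + ‖V s - L‖) * (σ * s.re) := by gcongr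
      _ = (‖E s‖ * (σ * s.re)) * (‖T s‖ * ‖U s‖) + ‖V s - L‖ * (σ * s.re) := by ring
      _ ≤ (max ρ⁻¹ CE) * (|CT| * |CU|) + C := by
        refine add_le_add ?_ (h2 h4)
        gcongr
        rw [hEs]
        exact (hCE _).trans (le_max_right _ _)

end TameEntries

/-! ### The systems as residue conditions. -/

section Rows

variable {lam0 lam1 : ℝ} {K : Coeffs} {l : Fin 3}

/-- The function `Ψ⁺ + δ_{l1}`. -/
noncomputable def rowP (K : Coeffs) (l : Fin 3) (s : ℂ) : ℂ := PsiP K l s + kron l 0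

/-- The function `Ω⁻ + Ω⁺ + δ_{l2}`. -/
noncomputable def rowO (K : Coeffs) (l : Fin 3) (s : ℂ) : ℂ := OmM K l s + OmP K l s + kron l 1

/-- The function `Ψ⁻ + δ_{l3}`. -/
noncomputable def rowQ (K : Coeffs) (l : Fin 3) (s : ℂ) : ℂ := PsiM K l s + kron l 2

theorem PsiP_eq (K : Coeffs) (l : Fin 3) :
    PsiP K l = poleSeries (fun m => 2 * m + 1) (K.Ap l) := by
  ext s; refine tsum_congr fun m => ?_
  push_cast; rw [sub_sub]

theorem PsiM_eq (K : Coeffs) (l : Fin 3) :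
    PsiM K l = poleSeries (fun m => -(2 * m + 1)) (K.Am l) := by
  ext s; refine tsum_congr fun m => ?_
  push_cast; rw [sub_neg_eq_add, add_assoc]

theorem OmP_eq (K : Coeffs) (l : Fin 3) :
    OmP K l = poleSeries (fun m => 2 * m + 2) (K.Bp l) := by
  ext s; refine tsum_congr fun m => ?_
  push_cast; rw [sub_sub]

theorem OmM_eq (K : Coeffs) (l : Fin 3) :
    OmM K l = poleSeries (fun m => -(2 * m)) (K.Bm l) := by
  ext s; refine tsum_congr fun m => ?_
  push_cast; rw [sub_neg_eq_add]

/-- The poles grow linearly in `m`, so geometric decay supplies the first moment needed for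
`norm_mul_norm_poleSeries_le`. -/
theorem GeomDecay.summable_weight {ρ : ℝ} (h0 : 0 ≤ ρ) (h1 : ρ < 1) {p : ℕ → ℂ}
    (h : GeomDecay ρ p) {a : ℕ → ℤ} (ha : ∀ m, |a m| ≤ 2 * m + 2) :
    Summable fun m => ‖p m‖ * (1 + |(a m : ℝ)|) := by
  obtain ⟨C, hC⟩ := h
  have s1 : Summable fun n : ℕ => (n : ℝ) ^ 1 * ρ ^ n :=
    summable_pow_mul_geometric_of_norm_lt_one 1 (by rwa [Real.norm_of_nonneg h0])
  have s2 : Summable fun n : ℕ => ρ ^ n := summable_geometric_of_lt_one h0 h1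
  have s3 : Summable fun n : ℕ => 2 * ((n : ℝ) ^ 1 * ρ ^ n) + 3 * ρ ^ n :=
    (s1.mul_left 2).add (s2.mul_left 3)
  have hs : Summable fun n : ℕ => C * (2 * ((n : ℝ) ^ 1 * ρ ^ n) + 3 * ρ ^ n) := s3.mul_left C
  refine Summable.of_nonneg_of_le (fun _ => by positivity) (fun m => ?_) hs
  have h2 : |(a m : ℝ)| ≤ 2 * m + 2 := by exact_mod_cast ha m
  have h3 := (norm_nonneg _).trans (hC m)
  calc ‖p m‖ * (1 + |(a m : ℝ)|) ≤ (C * ρ ^ m) * (1 + (2 * m + 2)) := by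
        gcongr; exact hC m
    _ = _ := by ring

theorem GeomDecay.exists_poleSeries_le {ρ : ℝ} (h0 : 0 ≤ ρ) (h1 : ρ < 1) {p : ℕ → ℂ}
    (h : GeomDecay ρ p) {a : ℕ → ℤ} (ha : ∀ m, |a m| ≤ 2 * m + 2) {δ : ℝ} (hδ : 0 < δ) :
    ∃ C, ∀ s ∈ farSet δ, ‖poleSeries a p s‖ ≤ C ∧ ‖s‖ * ‖poleSeries a p s‖ ≤ C := by
  refine ⟨max ((∑' m, ‖p m‖) * δ⁻¹) ((∑' m, ‖p m‖ * (1 + |(a m : ℝ)|)) * (1 + δ⁻¹)),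
    fun s hs => ⟨?_, ?_⟩⟩
  · exact (norm_poleSeries_le (h.summable_norm h0 h1) hδ fun m => hs (a m)).trans
      (le_max_left _ _)
  · exact (norm_mul_norm_poleSeries_le (h.summable_weight h0 h1 ha) hδ fun m => hs (a m)).trans
      (le_max_right _ _)

theorem tendsto_sub_mul_add_const {F : ℂ → ℂ} {c r : ℂ}
    (h : Tendsto (fun z => (z - c) * F z) (𝓝[≠] c) (𝓝 r)) (d : ℂ) :
    Tendsto (fun z => (z - c) * (F z + d)) (𝓝[≠] c) (𝓝 r) := by
  have := h.add (tendsto_sub_mul_of_continuousAt (f := fun _ => d) (c := c) continuousAt_const)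
  rw [add_zero] at this
  exact this.congr fun z => by ring

theorem tendsto_sub_mul_add_add_const {F G : ℂ → ℂ} {c r r' : ℂ}
    (h : Tendsto (fun z => (z - c) * F z) (𝓝[≠] c) (𝓝 r))
    (h' : Tendsto (fun z => (z - c) * G z) (𝓝[≠] c) (𝓝 r')) (d : ℂ) :
    Tendsto (fun z => (z - c) * (F z + G z + d)) (𝓝[≠] c) (𝓝 (r + r')) := by
  refine ((tendsto_sub_mul_add_const h d).add h').congr fun z => ?_
  ring

/-- The analytic properties of the functions `P = Ψ⁺ + δ_{l1}`, `O = Ω⁻ + Ω⁺ + δ_{l2}`,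
`Q = Ψ⁻ + δ_{l3}` built from a solution of the systems. -/
structure RowData (lam0 lam1 : ℝ) (P O Q : ℂ → ℂ) (d0 d1 d2 : ℂ) : Prop where
  diffP : ∀ s : ℂ, (∀ m : ℕ, s ≠ (2 * m + 1 : ℤ)) → DifferentiableAt ℂ P s
  diffO : ∀ s : ℂ, (∀ k : ℤ, s ≠ 2 * k) → DifferentiableAt ℂ O s
  diffQ : ∀ s : ℂ, (∀ m : ℕ, s ≠ (-(2 * m + 1) : ℤ)) → DifferentiableAt ℂ Q s
  resP : ∀ n : ℕ, Tendsto (fun z => (z - (2 * n + 1 : ℤ)) * P z) (𝓝[≠] ((2 * n + 1 : ℤ) : ℂ))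
    (𝓝 (2 / Real.pi * (lam1 : ℂ) ^ (2 * n + 1) * O (2 * n + 1 : ℤ)))
  resQ : ∀ n : ℕ, Tendsto (fun z => (z - (-(2 * n + 1) : ℤ)) * Q z)
    (𝓝[≠] ((-(2 * n + 1) : ℤ) : ℂ))
    (𝓝 (2 / Real.pi * ((lam0 : ℂ) / lam1) ^ (2 * n + 1) * O (-(2 * n + 1) : ℤ)))
  resOM : ∀ n : ℕ, Tendsto (fun z => (z - (-(2 * n) : ℤ)) * O z) (𝓝[≠] ((-(2 * n) : ℤ) : ℂ))
    (𝓝 (-(2 / Real.pi) * (lam1 : ℂ) ^ (2 * n) * P (-(2 * n) : ℤ)))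
  resOP : ∀ n : ℕ, Tendsto (fun z => (z - (2 * n + 2 : ℤ)) * O z) (𝓝[≠] ((2 * n + 2 : ℤ) : ℂ))
    (𝓝 (-(2 / Real.pi) * ((lam0 : ℂ) / lam1) ^ (2 * n + 2) * Q (2 * n + 2 : ℤ)))
  bound : ∀ δ > 0, ∃ C, ∀ s ∈ farSet δ, (‖P s‖ ≤ C ∧ ‖O s‖ ≤ C ∧ ‖Q s‖ ≤ C) ∧
    ‖s‖ * ‖P s - d0‖ ≤ C ∧ ‖s‖ * ‖O s - d1‖ ≤ C ∧ ‖s‖ * ‖Q s - d2‖ ≤ C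

/-- A coefficient is the residue at its pole, and the sum on the right of its equation is, up to
sign, the value at that pole of `P`, `O` or `Q`. Thus `eq_Ap`, `eq_Am`, `eq_Bm`, `eq_Bp` become
`resP`, `resQ`, `resOM`, `resOP`. -/
theorem SolvesSystems.rowData (h0 : 0 < lam0) (h01 : lam0 < lam1) (h1 : lam1 < 1)
    (hK : SolvesSystems lam0 lam1 K) (l : Fin 3) :
    RowData lam0 lam1 (rowP K l) (rowO K l) (rowQ K l) (kron l 0) (kron l 1) (kron l 2) := by
  obtain ⟨gAp, gAm, gBp, gBm⟩ := hK.geomDecay h0 h01 h1 l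
  have hr0 := ratio_nonneg (lam0 := lam0) (h0.trans h01)
  have hr1 := ratio_lt_one h0 h01 h1
  have sAp := gAp.summable_norm hr0 hr1
  have sAm := gAm.summable_norm hr0 hr1
  have sBp := gBp.summable_norm hr0 hr1
  have sBm := gBm.summable_norm hr0 hr1
  constructor
  · intro s hs
    unfold rowP
    rw [PsiP_eq]
    exact (differentiableAt_poleSeries sAp hs).add_const _
  · intro s hs
    unfold rowO
    rw [OmM_eq, OmP_eq]
    refine ((differentiableAt_poleSeries sBm fun m => ?_).add
      (differentiableAt_poleSeries sBp fun m => ?_)).add_const _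
    · convert hs (-m) using 1; push_cast; ring
    · convert hs (m + 1) using 1; push_cast; ring
  · intro s hs
    unfold rowQ
    rw [PsiM_eq]
    exact (differentiableAt_poleSeries sAm hs).add_const _
  · intro n
    convert tendsto_sub_mul_add_const (tendsto_sub_mul_poleSeries_of_mem sAp
      (a := fun m => 2 * m + 1) (fun x y h => by simpa using h) n rfl) (kron l 0) using 2
    · rw [rowP, PsiP_eq]
    · rw [hK.eq_Ap, rowO, OmM, OmP]
      have e1 : ∀ m : ℕ, K.Bm l m / (((2 * n + 1 : ℤ) : ℂ) + 2 * m) =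
        K.Bm l m / (2 * n + 2 * m + 1) := fun m => by push_cast; ring_nf
      have e2 : ∀ m : ℕ, K.Bp l m / (((2 * n + 1 : ℤ) : ℂ) - 2 * m - 2) =
        K.Bp l m / (2 * n - 2 * m - 1) := fun m => by push_cast; ring_nf
      rw [tsum_congr e1, tsum_congr e2]
      ring
  · intro n
    convert tendsto_sub_mul_add_const (tendsto_sub_mul_poleSeries_of_mem sAm
      (a := fun m => -(2 * m + 1)) (fun x y h => by simpa using h) n rfl) (kron l 2) using 2
    · rw [rowQ, PsiM_eq]
    · rw [hK.eq_Am, rowO, OmM, OmP]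
      have e1 : ∀ m : ℕ, K.Bm l m / (((-(2 * n + 1) : ℤ) : ℂ) + 2 * m) =
        -(K.Bm l m / (2 * n - 2 * m + 1)) := fun m => by
          rw [← div_neg]; push_cast; ring_nf
      have e2 : ∀ m : ℕ, K.Bp l m / (((-(2 * n + 1) : ℤ) : ℂ) - 2 * m - 2) =
        -(K.Bp l m / (2 * n + 2 * m + 3)) := fun m => by
          rw [← div_neg]; push_cast; ring_nf
      rw [tsum_congr e1, tsum_congr e2, tsum_neg, tsum_neg]
      ring
  · intro n
    have t1 := tendsto_sub_mul_poleSeries_of_mem sBm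
      (a := fun m => -(2 * m)) (fun x y h => by simpa using h) n rfl
    have t2 := tendsto_sub_mul_poleSeries_of_notMem sBp (n := -(2 * n))
      (a := fun m => 2 * m + 2) (fun m => by omega)
    convert tendsto_sub_mul_add_add_const t1 t2 (kron l 1) using 2
    · rw [rowO, OmP_eq, OmM_eq]
    · rw [hK.eq_Bm, rowP, PsiP]
      have e1 : ∀ m : ℕ, K.Ap l m / (((-(2 * n) : ℤ) : ℂ) - 2 * m - 1) =
        -(K.Ap l m / (2 * n + 2 * m + 1)) := fun m => by
          rw [← div_neg]; push_cast; ring_nf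
      rw [tsum_congr e1, tsum_neg]
      ring
  · intro n
    have t1 := tendsto_sub_mul_poleSeries_of_mem sBp
      (a := fun m => 2 * m + 2) (fun x y h => by simpa using h) n rfl
    have t2 := tendsto_sub_mul_poleSeries_of_notMem sBm (n := 2 * n + 2)
      (a := fun m => -(2 * m)) (fun m => by omega)
    convert tendsto_sub_mul_add_add_const t2 t1 (kron l 1) using 2
    · rw [rowO, OmP_eq, OmM_eq]
    · rw [hK.eq_Bp, rowQ, PsiM]
      have e1 : ∀ m : ℕ, K.Am l m / (((2 * n + 2 : ℤ) : ℂ) + 2 * m + 1) =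
        K.Am l m / (2 * n + 2 * m + 3) := fun m => by push_cast; ring_nf
      rw [tsum_congr e1]
      ring
  · intro δ hδ
    have key : ∀ {p : ℕ → ℂ} {a : ℕ → ℤ}, GeomDecay (ratio lam0 lam1) p →
        (∀ m, |a m| ≤ 2 * m + 2) → ∃ C, ∀ s ∈ farSet δ,
          ‖poleSeries a p s‖ ≤ C ∧ ‖s‖ * ‖poleSeries a p s‖ ≤ C := fun hp ha =>
      hp.exists_poleSeries_le hr0 hr1 ha hδ
    obtain ⟨C1, hC1⟩ := key gAp (a := fun m => 2 * m + 1) (fun m => abs_le.2 ⟨by omega, by omega⟩)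
    obtain ⟨C2, hC2⟩ := key gAm (a := fun m => -(2 * m + 1)) (fun m => abs_le.2 ⟨by omega, by omega⟩)
    obtain ⟨C3, hC3⟩ := key gBp (a := fun m => 2 * m + 2) (fun m => abs_le.2 ⟨by omega, by omega⟩)
    obtain ⟨C4, hC4⟩ := key gBm (a := fun m => -(2 * m)) (fun m => abs_le.2 ⟨by omega, by omega⟩)
    rw [← PsiP_eq] at hC1
    rw [← PsiM_eq] at hC2
    rw [← OmP_eq] at hC3
    rw [← OmM_eq] at hC4
    refine ⟨|C1| + |C2| + |C3| + |C4| + 1, fun s hs => ?_⟩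
    obtain ⟨a1, b1⟩ := hC1 s hs
    obtain ⟨a2, b2⟩ := hC2 s hs
    obtain ⟨a3, b3⟩ := hC3 s hs
    obtain ⟨a4, b4⟩ := hC4 s hs
    have c1 := le_abs_self C1
    have c2 := le_abs_self C2
    have c3 := le_abs_self C3
    have c4 := le_abs_self C4
    have d1 := abs_nonneg C1
    have d2 := abs_nonneg C2
    have d3 := abs_nonneg C3
    have d4 := abs_nonneg C4
    have k0 := norm_kron_le l 0
    have k1 := norm_kron_le l 1
    have k2 := norm_kron_le l 2
    simp only [rowP, rowO, rowQ, add_sub_cancel_right]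
    refine ⟨⟨?_, ?_, ?_⟩, ?_, ?_, ?_⟩
    · have := norm_add_le (PsiP K l s) (kron l 0); linarith
    · have := norm_add₃_le (a := OmM K l s) (b := OmP K l s) (c := kron l 1); linarith
    · have := norm_add_le (PsiM K l s) (kron l 2); linarith
    · linarith
    · have := mul_le_mul_of_nonneg_left (norm_add_le (OmM K l s) (OmP K l s)) (norm_nonneg s)
      linarith
    · linarith

end Rows

/-! ### Discs about the integers kept away from the contour. -/

section Margins

variable {γ : ℝ}

/-- A radius for the discs about the integers, small with respect to the contour `Re s = γ`. -/
noncomputable def discRadius (γ : ℝ) : ℝ := min (1 / 4) (min (γ / 2) ((1 - γ) / 2))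

/-- A disc meeting `Re s ≤ γ` has center `n ≤ γ + (1 - γ) / 2 < 1`, hence `n ≤ 0`, and reaches no
further right than `γ / 2`. -/
theorem margin_plus (h0 : 0 < γ) (h1 : γ < 1) : Margin (-1) (-γ) (discRadius γ) := by
  have hδ1 : discRadius γ ≤ γ / 2 := (min_le_right _ _).trans (min_le_left _ _)
  have hδ2 : discRadius γ ≤ (1 - γ) / 2 := (min_le_right _ _).trans (min_le_right _ _)
  refine ⟨Or.inr rfl, lt_min (by norm_num) (lt_min (by linarith) (by linarith)), min_le_left _ _,
    fun n s z hs hsn hzn => ?_⟩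
  have h2 := (abs_le.1 ((Complex.abs_re_le_norm (s - n)).trans hsn)).1
  have h3 := (abs_le.1 ((Complex.abs_re_le_norm (z - n)).trans hzn)).2
  simp only [Complex.sub_re, Complex.intCast_re] at h2 h3
  have h4 : n < 1 := by exact_mod_cast (by linarith : (n : ℝ) < 1)
  have h5 : (n : ℝ) ≤ 0 := by exact_mod_cast (by omega : n ≤ 0)
  linarith

theorem margin_minus (h0 : 0 < γ) (h1 : γ < 1) : Margin 1 γ (discRadius γ) := by
  have hδ1 : discRadius γ ≤ γ / 2 := (min_le_right _ _).trans (min_le_left _ _)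
  have hδ2 : discRadius γ ≤ (1 - γ) / 2 := (min_le_right _ _).trans (min_le_right _ _)
  refine ⟨Or.inl rfl, lt_min (by norm_num) (lt_min (by linarith) (by linarith)), min_le_left _ _,
    fun n s z hs hsn hzn => ?_⟩
  have h2 := (abs_le.1 ((Complex.abs_re_le_norm (s - n)).trans hsn)).2
  have h3 := (abs_le.1 ((Complex.abs_re_le_norm (z - n)).trans hzn)).1
  simp only [Complex.sub_re, Complex.intCast_re] at h2 h3
  have h4 : 0 < n := by exact_mod_cast (by linarith : (0 : ℝ) < n)
  have h5 : (1 : ℝ) ≤ n := by exact_mod_cast (by omega : 1 ≤ n)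
  linarith

end Margins

/-! ### Analyticity, bounds and limits of the entries of `X^±`. -/

section Entries

theorem exists_cot_le {δ : ℝ} (hδ : 0 < δ) :
    ∃ C, ∀ s ∈ farSet δ, ‖Complex.cot (Real.pi * s / 2)‖ ≤ C :=
  ⟨1 + δ⁻¹, fun s hs => norm_cot_half_pi_le hδ fun k => by exact_mod_cast hs (2 * k)⟩

theorem exists_tan_le {δ : ℝ} (hδ : 0 < δ) :
    ∃ C, ∀ s ∈ farSet δ, ‖Complex.tan (Real.pi * s / 2)‖ ≤ C :=
  ⟨1 + δ⁻¹, fun s hs => norm_tan_half_pi_le hδ fun k => by exact_mod_cast hs (2 * k + 1)⟩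

theorem continuousAt_cpow_neg {ρ : ℂ} (h : ρ ≠ 0) (s : ℂ) : ContinuousAt (fun z => ρ ^ (-z)) s :=
  (DifferentiableAt.const_cpow (by fun_prop) (Or.inl h)).continuousAt

theorem continuousAt_cpow {ρ : ℂ} (h : ρ ≠ 0) (s : ℂ) : ContinuousAt (fun z => ρ ^ z) s :=
  (DifferentiableAt.const_cpow (by fun_prop) (Or.inl h)).continuousAt

theorem diff_cot {s : ℂ} (hs : ∀ k : ℤ, s ≠ k) :
    DifferentiableAt ℂ (fun s : ℂ => Complex.cot (Real.pi * s / 2)) s :=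
  differentiableAt_cot_half_pi fun k => by exact_mod_cast hs (2 * k)

theorem diff_tan {s : ℂ} (hs : ∀ k : ℤ, s ≠ k) :
    DifferentiableAt ℂ (fun s : ℂ => Complex.tan (Real.pi * s / 2)) s :=
  differentiableAt_tan_half_pi fun k => by exact_mod_cast hs (2 * k + 1)

variable {lam0 lam1 γ : ℝ} {P O Q : ℂ → ℂ} {d0 d1 d2 : ℂ}

theorem RowData.diffP_int (R : RowData lam0 lam1 P O Q d0 d1 d2) {n : ℤ}
    (h : ∀ m : ℕ, n ≠ 2 * m + 1) : DifferentiableAt ℂ P n :=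
  R.diffP _ fun m => by exact_mod_cast h m

theorem RowData.diffQ_int (R : RowData lam0 lam1 P O Q d0 d1 d2) {n : ℤ}
    (h : ∀ m : ℕ, n ≠ -(2 * m + 1)) : DifferentiableAt ℂ Q n :=
  R.diffQ _ fun m => by exact_mod_cast h m

theorem RowData.diffO_int (R : RowData lam0 lam1 P O Q d0 d1 d2) {n k : ℤ}
    (h : n = 2 * k + 1) : DifferentiableAt ℂ O n :=
  R.diffO _ (int_ne_two_mul_of_odd h)

theorem RowData.diffO_nonint (R : RowData lam0 lam1 P O Q d0 d1 d2) {s : ℂ}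
    (h : ∀ k : ℤ, s ≠ k) : DifferentiableAt ℂ O s :=
  R.diffO _ fun k => by exact_mod_cast h (2 * k)

theorem nonpos_of_plus (hγ1 : γ < 1) {n : ℤ} (hn : -γ ≤ -1 * (n : ℝ)) : n ≤ 0 := by
  have : n < 1 := by exact_mod_cast (by linarith : (n : ℝ) < 1)
  omega

theorem pos_of_minus (hγ0 : 0 < γ) {n : ℤ} (hn : γ ≤ 1 * (n : ℝ)) : 1 ≤ n := by
  have : 0 < n := by exact_mod_cast (by linarith : (0 : ℝ) < n)
  omega

theorem RowData.tame_rowP (R : RowData lam0 lam1 P O Q d0 d1 d2) (hγ0 : 0 < γ) (hγ1 : γ < 1) :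
    Tame (-1) (-γ) (discRadius γ) P d0 := by
  have hm := margin_plus hγ0 hγ1
  obtain ⟨C, hC⟩ := R.bound _ hm.pos
  refine ⟨fun s hs => R.diffP s fun m => hs _, fun n hn => ?_,
    bound_of_decay hm ⟨C, fun s hs => (hC s hs).2.1⟩⟩
  have := nonpos_of_plus hγ1 hn
  exact tendsto_sub_mul_of_continuousAt (R.diffP_int fun m => by omega).continuousAt

theorem RowData.tame_rowQ (R : RowData lam0 lam1 P O Q d0 d1 d2) (hγ0 : 0 < γ) (hγ1 : γ < 1) :
    Tame 1 γ (discRadius γ) Q d2 := by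
  have hm := margin_minus hγ0 hγ1
  obtain ⟨C, hC⟩ := R.bound _ hm.pos
  refine ⟨fun s hs => R.diffQ s fun m => hs _, fun n hn => ?_,
    bound_of_decay hm ⟨C, fun s hs => (hC s hs).2.2.2⟩⟩
  have := pos_of_minus hγ0 hn
  exact tendsto_sub_mul_of_continuousAt (R.diffQ_int fun m => by omega).continuousAt

/-- Among the integers `n ≤ 0`, only the even ones are singular: there `resOM` cancels the
cotangent, and `P` is regular. -/
theorem RowData.tame_first_plus (R : RowData lam0 lam1 P O Q d0 d1 d2) (h0 : 0 < lam1)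
    (h1 : lam1 < 1) (hγ0 : 0 < γ) (hγ1 : γ < 1) :
    Tame (-1) (-γ) (discRadius γ)
      (fun s => (lam1 : ℂ) ^ (-s) * Complex.cot (Real.pi * s / 2) * P s + O s) d1 := by
  have hm := margin_plus hγ0 hγ1
  have hne : (lam1 : ℂ) ≠ 0 := by exact_mod_cast h0.ne'
  obtain ⟨C, hC⟩ := R.bound _ hm.pos
  refine tame_of_exponential (ρ := lam1) hm (by linarith) h0 h1 (fun s => by simp)
    (fun s hs => diff_cot hs) (fun s hs => R.diffP s fun m => hs _)
    (fun s hs => R.diffO_nonint hs) (fun n hn => ?_) (exists_cot_le hm.pos)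
    ⟨C, fun s hs => (hC s hs).1.1⟩ ⟨C, fun s hs => (hC s hs).2.2.1⟩
  have hn0 := nonpos_of_plus hγ1 hn
  refine removable_cot (continuousAt_cpow_neg hne _)
    (R.diffP_int fun m => by omega).continuousAt (fun k hk => ?_)
    (fun k hk => tendsto_sub_mul_of_continuousAt (R.diffO_int hk).continuousAt)
  obtain ⟨m, hm⟩ := Int.eq_ofNat_of_zero_le (a := -k) (by omega)
  obtain rfl : n = -(2 * m) := by omega
  convert R.resOM m using 4
  rw [← Complex.cpow_natCast]; push_cast; rw [neg_neg]

/-- At the positive odd integers the pole of `P` cancels the tangent by `resP`; at the positive even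
ones the zero of the tangent absorbs the pole of `O`. -/
theorem RowData.tame_first_minus (R : RowData lam0 lam1 P O Q d0 d1 d2) (h0 : 0 < lam1)
    (h1 : lam1 < 1) (hγ0 : 0 < γ) (hγ1 : γ < 1) :
    Tame 1 γ (discRadius γ)
      (fun s => (lam1 : ℂ) ^ s * Complex.tan (Real.pi * s / 2) * O s + P s) d0 := by
  have hm := margin_minus hγ0 hγ1
  have hne : (lam1 : ℂ) ≠ 0 := by exact_mod_cast h0.ne'
  obtain ⟨C, hC⟩ := R.bound _ hm.pos
  refine tame_of_exponential (ρ := lam1) hm (by linarith) h0 h1 (fun s => by simp)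
    (fun s hs => diff_tan hs) (fun s hs => R.diffO_nonint hs)
    (fun s hs => R.diffP s fun m => hs _) (fun n hn => ?_) (exists_tan_le hm.pos)
    ⟨C, fun s hs => (hC s hs).1.2.1⟩ ⟨C, fun s hs => (hC s hs).2.1⟩
  have hn0 := pos_of_minus hγ0 hn
  refine removable_tan (continuousAt_cpow hne _) (fun k hk => ⟨?_, ?_⟩) (fun k hk => ⟨?_, ?_⟩)
  · obtain ⟨m, hm⟩ := Int.eq_ofNat_of_zero_le (a := k - 1) (by omega)
    obtain rfl : n = 2 * m + 2 := by omega
    exact ⟨_, R.resOP m⟩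
  · exact tendsto_sub_mul_of_continuousAt (R.diffP_int fun m => by omega).continuousAt
  · exact (R.diffO_int hk).continuousAt
  · obtain ⟨m, hm⟩ := Int.eq_ofNat_of_zero_le (a := k) (by omega)
    obtain rfl : n = 2 * m + 1 := by omega
    convert R.resP m using 4
    rw [← Complex.cpow_natCast]; push_cast; rfl

/-- At the negative odd integers `resQ` provides the cancellation; at `0, -2, …` the zero of the
tangent absorbs the pole of `O`. -/
theorem RowData.tame_second_plus (R : RowData lam0 lam1 P O Q d0 d1 d2) (h0 : 0 < lam0)
    (h01 : lam0 < lam1) (hγ0 : 0 < γ) (hγ1 : γ < 1) :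
    Tame (-1) (-γ) (discRadius γ)
      (fun s => ((lam0 / lam1 : ℝ) : ℂ) ^ (-s) * Complex.tan (Real.pi * s / 2) * O s + Q s)
      d2 := by
  have hm := margin_plus hγ0 hγ1
  have hmu : 0 < lam0 / lam1 := div_pos h0 (h0.trans h01)
  have hne : ((lam0 / lam1 : ℝ) : ℂ) ≠ 0 := by exact_mod_cast hmu.ne'
  obtain ⟨C, hC⟩ := R.bound _ hm.pos
  refine tame_of_exponential (ρ := lam0 / lam1) hm (by linarith) hmu
    ((div_lt_one (h0.trans h01)).2 h01) (fun s => by simp)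
    (fun s hs => diff_tan hs) (fun s hs => R.diffO_nonint hs)
    (fun s hs => R.diffQ s fun m => hs _) (fun n hn => ?_) (exists_tan_le hm.pos)
    ⟨C, fun s hs => (hC s hs).1.2.1⟩ ⟨C, fun s hs => (hC s hs).2.2.2⟩
  have hn0 := nonpos_of_plus hγ1 hn
  refine removable_tan (continuousAt_cpow_neg hne _) (fun k hk => ⟨?_, ?_⟩) (fun k hk => ⟨?_, ?_⟩)
  · obtain ⟨m, hm⟩ := Int.eq_ofNat_of_zero_le (a := -k) (by omega)
    obtain rfl : n = -(2 * m) := by omega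
    exact ⟨_, R.resOM m⟩
  · exact tendsto_sub_mul_of_continuousAt (R.diffQ_int fun m => by omega).continuousAt
  · exact (R.diffO_int hk).continuousAt
  · obtain ⟨m, hm⟩ := Int.eq_ofNat_of_zero_le (a := -k - 1) (by omega)
    obtain rfl : n = -(2 * m + 1) := by omega
    convert R.resQ m using 4
    rw [← Complex.cpow_natCast, Complex.ofReal_div]; push_cast; rw [neg_neg]

/-- Among the positive integers only `2m + 2` is singular, and there `resOP` cancels the cotangent.
-/
theorem RowData.tame_second_minus (R : RowData lam0 lam1 P O Q d0 d1 d2) (h0 : 0 < lam0)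
    (h01 : lam0 < lam1) (hγ0 : 0 < γ) (hγ1 : γ < 1) :
    Tame 1 γ (discRadius γ)
      (fun s => ((lam0 / lam1 : ℝ) : ℂ) ^ s * Complex.cot (Real.pi * s / 2) * Q s + O s)
      d1 := by
  have hm := margin_minus hγ0 hγ1
  have hmu : 0 < lam0 / lam1 := div_pos h0 (h0.trans h01)
  have hne : ((lam0 / lam1 : ℝ) : ℂ) ≠ 0 := by exact_mod_cast hmu.ne'
  obtain ⟨C, hC⟩ := R.bound _ hm.pos
  refine tame_of_exponential (ρ := lam0 / lam1) hm (by linarith) hmu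
    ((div_lt_one (h0.trans h01)).2 h01) (fun s => by simp)
    (fun s hs => diff_cot hs) (fun s hs => R.diffQ s fun m => hs _)
    (fun s hs => R.diffO_nonint hs) (fun n hn => ?_) (exists_cot_le hm.pos)
    ⟨C, fun s hs => (hC s hs).1.2.2⟩ ⟨C, fun s hs => (hC s hs).2.2.1⟩
  have hn0 := pos_of_minus hγ0 hn
  refine removable_cot (continuousAt_cpow hne _)
    (R.diffQ_int fun m => by omega).continuousAt (fun k hk => ?_)
    (fun k hk => tendsto_sub_mul_of_continuousAt (R.diffO_int hk).continuousAt)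
  obtain ⟨m, hm⟩ := Int.eq_ofNat_of_zero_le (a := k - 1) (by omega)
  obtain rfl : n = 2 * m + 2 := by omega
  convert R.resOP m using 4
  rw [← Complex.cpow_natCast, Complex.ofReal_div]; push_cast; rfl

theorem XplusFormula_zero (lam0 lam1 : ℝ) (K : Coeffs) (s : ℂ) (l : Fin 3) :
    XplusFormula lam0 lam1 K s 0 l = 1 / 2 *
      ((lam1 : ℂ) ^ (-s) * Complex.cot (Real.pi * s / 2) * rowP K l s + rowO K l s) := by
  simp only [XplusFormula, rowP, rowO, Matrix.of_apply, Matrix.cons_val]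
  ring

theorem XplusFormula_one (lam0 lam1 : ℝ) (K : Coeffs) (s : ℂ) (l : Fin 3) :
    XplusFormula lam0 lam1 K s 1 l = 1 / (lam0 : ℂ) *
      (((lam0 / lam1 : ℝ) : ℂ) ^ (-s) * Complex.tan (Real.pi * s / 2) * rowO K l s + rowQ K l s) := by
  simp only [XplusFormula, rowO, rowQ, Matrix.of_apply, Matrix.cons_val]
  ring

theorem XplusFormula_two (lam0 lam1 : ℝ) (K : Coeffs) (s : ℂ) (l : Fin 3) :
    XplusFormula lam0 lam1 K s 2 l = rowP K l s := by
  simp only [XplusFormula, rowP, Matrix.of_apply, Matrix.cons_val]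

theorem XminusFormula_zero (lam0 lam1 : ℝ) (K : Coeffs) (s : ℂ) (l : Fin 3) :
    XminusFormula lam0 lam1 K s 0 l = 1 / 2 *
      ((lam1 : ℂ) ^ s * Complex.tan (Real.pi * s / 2) * rowO K l s + rowP K l s) := by
  simp only [XminusFormula, rowP, rowO, Matrix.of_apply, Matrix.cons_val]
  ring

theorem XminusFormula_one (lam0 lam1 : ℝ) (K : Coeffs) (s : ℂ) (l : Fin 3) :
    XminusFormula lam0 lam1 K s 1 l = 1 / (lam1 : ℂ) *
      (((lam0 / lam1 : ℝ) : ℂ) ^ s * Complex.cot (Real.pi * s / 2) * rowQ K l s + rowO K l s) := by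
  simp only [XminusFormula, rowO, rowQ, Matrix.of_apply, Matrix.cons_val]
  ring

theorem XminusFormula_two (lam0 lam1 : ℝ) (K : Coeffs) (s : ℂ) (l : Fin 3) :
    XminusFormula lam0 lam1 K s 2 l = 1 / 2 * rowQ K l s := by
  simp only [XminusFormula, rowQ, Matrix.of_apply, Matrix.cons_val]

theorem XplusInfinity_zero (lam0 : ℝ) (l : Fin 3) : XplusInfinity lam0 0 l = 1 / 2 * kron l 1 := by
  fin_cases l <;> simp [XplusInfinity, kron]

theorem XplusInfinity_one (lam0 : ℝ) (l : Fin 3) : XplusInfinity lam0 1 l = 1 / (lam0 : ℂ) * kron l 2 := by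
  fin_cases l <;> simp [XplusInfinity, kron]

theorem XplusInfinity_two (lam0 : ℝ) (l : Fin 3) : XplusInfinity lam0 2 l = kron l 0 := by
  fin_cases l <;> simp [XplusInfinity, kron]

theorem XminusInfinity_zero (lam1 : ℝ) (l : Fin 3) : XminusInfinity lam1 0 l = 1 / 2 * kron l 0 := by
  fin_cases l <;> simp [XminusInfinity, kron]

theorem XminusInfinity_one (lam1 : ℝ) (l : Fin 3) : XminusInfinity lam1 1 l = 1 / (lam1 : ℂ) * kron l 1 := by
  fin_cases l <;> simp [XminusInfinity, kron]

theorem XminusInfinity_two (lam1 : ℝ) (l : Fin 3) : XminusInfinity lam1 2 l = 1 / 2 * kron l 2 := by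
  fin_cases l <;> simp [XminusInfinity, kron]

theorem SolvesSystems.tame_plus {K : Coeffs} (hK : SolvesSystems lam0 lam1 K) (h0 : 0 < lam0)
    (h01 : lam0 < lam1) (h1 : lam1 < 1) (hγ0 : 0 < γ) (hγ1 : γ < 1) (i l : Fin 3) :
    Tame (-1) (-γ) (discRadius γ) (fun s => XplusFormula lam0 lam1 K s i l)
      (XplusInfinity lam0 i l) := by
  have R := hK.rowData h0 h01 h1 l
  revert i
  refine Fin.forall_fin_succ.2 ⟨?_, Fin.forall_fin_two.2 ⟨?_, ?_⟩⟩
  · change Tame _ _ _ (fun s => XplusFormula lam0 lam1 K s 0 l) (XplusInfinity lam0 0 l)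
    simp only [XplusFormula_zero, XplusInfinity_zero]
    exact (R.tame_first_plus (h0.trans h01) h1 hγ0 hγ1).const_mul (1 / 2)
  · change Tame _ _ _ (fun s => XplusFormula lam0 lam1 K s 1 l) (XplusInfinity lam0 1 l)
    simp only [XplusFormula_one, XplusInfinity_one]
    exact (R.tame_second_plus h0 h01 hγ0 hγ1).const_mul (1 / (lam0 : ℂ))
  · change Tame _ _ _ (fun s => XplusFormula lam0 lam1 K s 2 l) (XplusInfinity lam0 2 l)
    simp only [XplusFormula_two, XplusInfinity_two]
    exact R.tame_rowP hγ0 hγ1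

theorem SolvesSystems.tame_minus {K : Coeffs} (hK : SolvesSystems lam0 lam1 K) (h0 : 0 < lam0)
    (h01 : lam0 < lam1) (h1 : lam1 < 1) (hγ0 : 0 < γ) (hγ1 : γ < 1) (i l : Fin 3) :
    Tame 1 γ (discRadius γ) (fun s => XminusFormula lam0 lam1 K s i l)
      (XminusInfinity lam1 i l) := by
  have R := hK.rowData h0 h01 h1 l
  revert i
  refine Fin.forall_fin_succ.2 ⟨?_, Fin.forall_fin_two.2 ⟨?_, ?_⟩⟩
  · change Tame _ _ _ (fun s => XminusFormula lam0 lam1 K s 0 l) (XminusInfinity lam1 0 l)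
    simp only [XminusFormula_zero, XminusInfinity_zero]
    exact (R.tame_first_minus (h0.trans h01) h1 hγ0 hγ1).const_mul (1 / 2)
  · change Tame _ _ _ (fun s => XminusFormula lam0 lam1 K s 1 l) (XminusInfinity lam1 1 l)
    simp only [XminusFormula_one, XminusInfinity_one]
    exact (R.tame_second_minus h0 h01 hγ0 hγ1).const_mul (1 / (lam1 : ℂ))
  · change Tame _ _ _ (fun s => XminusFormula lam0 lam1 K s 2 l) (XminusInfinity lam1 2 l)
    simp only [XminusFormula_two, XminusInfinity_two]
    exact (R.tame_rowQ hγ0 hγ1).const_mul (1 / 2)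

end Entries

/-! ### Calculus of orders at infinity. -/

section Orders

variable {E E' : Type*} [NormedAddCommGroup E] [NormedAddCommGroup E'] {D D₁ D₂ : Set ℂ}
  {y : ℂ → E} {y' : ℂ → E'} {α β : ℝ}

theorem eventually_atInfinityIn {p : ℂ → Prop} :
    (∀ᶠ s in atInfinityIn D, p s) ↔ ∀ᶠ s in Bornology.cobounded ℂ, s ∈ D → p s :=
  eventually_inf_principal

theorem eventually_one_le_norm (D : Set ℂ) : ∀ᶠ s in atInfinityIn D, 1 ≤ ‖s‖ :=
  (eventually_norm_ge_atInfinityIn D 1).mono fun _ h => h.1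

theorem atInfinityIn_neBot {c : ℂ} (hc : c ≠ 0) (h : ∀ n : ℕ, c * n ∈ D) :
    (atInfinityIn D).NeBot := by
  have ht : Tendsto (fun n : ℕ => c * n) atTop (atInfinityIn D) := by
    refine tendsto_inf.2 ⟨?_, tendsto_principal.2 (Eventually.of_forall h)⟩
    rw [← tendsto_norm_atTop_iff_cobounded]
    simp only [norm_mul, Complex.norm_natCast]
    exact tendsto_natCast_atTop_atTop.const_mul_atTop (norm_pos_iff.2 hc)
  exact ht.neBot

theorem atInfinityIn_DPlus_neBot {γ : ℝ} (hγ : 0 < γ) : (atInfinityIn (DPlus γ)).NeBot :=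
  atInfinityIn_neBot (c := -1) (by simp) fun n => by
    have : (0 : ℝ) ≤ n := n.cast_nonneg
    simp only [DPlus, Set.mem_ofPred_eq, neg_one_mul, Complex.neg_re, Complex.natCast_re]
    linarith

/-- Orders depend on norms only up to two-sided constants, even for values in different spaces. -/
theorem HasOrderAtInfinity.transfer (h : HasOrderAtInfinity D y α) {a b : ℝ} (ha : 0 < a)
    (hb : 0 ≤ b) (hy : ∀ s ∈ D, a * ‖y s‖ ≤ ‖y' s‖ ∧ ‖y' s‖ ≤ b * ‖y s‖) :
    HasOrderAtInfinity D y' α := by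
  obtain ⟨c, C, hc, h⟩ := h
  refine ⟨a * c, b * C, by positivity, ?_⟩
  rw [eventually_atInfinityIn] at h ⊢
  filter_upwards [h] with s hs hsD
  obtain ⟨h1, h2⟩ := hs hsD
  obtain ⟨h3, h4⟩ := hy s hsD
  constructor
  · calc a * c ≤ a * (‖s‖ ^ α * ‖y s‖) := by gcongr
      _ = ‖s‖ ^ α * (a * ‖y s‖) := by ring
      _ ≤ ‖s‖ ^ α * ‖y' s‖ := by gcongr
  · calc ‖s‖ ^ α * ‖y' s‖ ≤ ‖s‖ ^ α * (b * ‖y s‖) := by gcongr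
      _ = b * (‖s‖ ^ α * ‖y s‖) := by ring
      _ ≤ b * C := by gcongr

theorem HasOrderAtInfinity.union (h₁ : HasOrderAtInfinity D₁ y α)
    (h₂ : HasOrderAtInfinity D₂ y α) (hD : D₁ ∪ D₂ = Set.univ) :
    HasOrderAtInfinity Set.univ y α := by
  obtain ⟨c₁, C₁, hc₁, h₁⟩ := h₁
  obtain ⟨c₂, C₂, hc₂, h₂⟩ := h₂
  refine ⟨min c₁ c₂, max C₁ C₂, lt_min hc₁ hc₂, ?_⟩
  rw [eventually_atInfinityIn] at h₁ h₂ ⊢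
  filter_upwards [h₁, h₂] with s hs₁ hs₂ _
  rcases (hD ▸ Set.mem_univ s : s ∈ D₁ ∪ D₂) with h | h
  · exact ⟨(min_le_left _ _).trans (hs₁ h).1, (hs₁ h).2.trans (le_max_left _ _)⟩
  · exact ⟨(min_le_right _ _).trans (hs₂ h).1, (hs₂ h).2.trans (le_max_right _ _)⟩

theorem HasOrderAtInfinity.inv {g : ℂ → ℂ} (h : HasOrderAtInfinity D g α) :
    HasOrderAtInfinity D (fun s => (g s)⁻¹) (-α) := by
  obtain ⟨c, C, hc, h⟩ := h
  refine ⟨(max C 1)⁻¹, c⁻¹, by positivity, ?_⟩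
  filter_upwards [h] with s hs
  rw [norm_inv, Real.rpow_neg (norm_nonneg _), ← mul_inv]
  have : 0 < ‖s‖ ^ α * ‖g s‖ := hc.trans_le hs.1
  exact ⟨inv_anti₀ this (hs.2.trans (le_max_left _ _)), inv_anti₀ hc hs.1⟩

theorem tendsto_norm_rpow_atInfinityIn (D : Set ℂ) (h : 0 < α) :
    Tendsto (fun s : ℂ => ‖s‖ ^ α) (atInfinityIn D) atTop :=
  (tendsto_rpow_atTop h).comp (tendsto_norm_cobounded_atTop.mono_left inf_le_left)

/-- If `β > α`, the lower bound of order `α` makes `‖s‖ ^ β ‖y s‖` grow like `‖s‖ ^ (β - α)`. On a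
bounded domain every order would hold vacuously, hence the `NeBot` assumption. -/
theorem HasOrderAtInfinity.le_of_neBot [(atInfinityIn D).NeBot] (hα : HasOrderAtInfinity D y α)
    (hβ : HasOrderAtInfinity D y β) : β ≤ α := by
  by_contra! hlt
  obtain ⟨c, _, hc, h₁⟩ := hα
  obtain ⟨_, C, _, h₂⟩ := hβ
  have h₃ := (tendsto_norm_rpow_atInfinityIn D (sub_pos.2 hlt)).eventually_gt_atTop (C / c)
  obtain ⟨s, hs₁, hs₂, hs₃, hs₄⟩ :=
    (h₁.and (h₂.and (h₃.and (eventually_one_le_norm D)))).exists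
  have h0 : 0 < ‖s‖ := one_pos.trans_le hs₄
  rw [div_lt_iff₀ hc] at hs₃
  have : C < ‖s‖ ^ β * ‖y s‖ := by
    calc C < ‖s‖ ^ (β - α) * c := hs₃
      _ ≤ ‖s‖ ^ (β - α) * (‖s‖ ^ α * ‖y s‖) := by gcongr; exact hs₁.1
      _ = ‖s‖ ^ β * ‖y s‖ := by rw [← mul_assoc, ← Real.rpow_add h0, sub_add_cancel]
  linarith [hs₂.2]

theorem HasOrderAtInfinity.unique [(atInfinityIn D).NeBot] (hα : HasOrderAtInfinity D y α)
    (hβ : HasOrderAtInfinity D y β) : α = β :=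
  le_antisymm (hβ.le_of_neBot hα) (hα.le_of_neBot hβ)

/-- Liouville's theorem: an entire function has no positive order at infinity. -/
theorem HasOrderAtInfinity.nonpos_of_entire [NormedSpace ℂ E]
    (h : HasOrderAtInfinity Set.univ y α) (hy : Differentiable ℂ y) : α ≤ 0 := by
  by_contra! hα
  obtain ⟨c, C, hc, h⟩ := h
  have hcob : atInfinityIn Set.univ = Bornology.cobounded ℂ := by
    simp [atInfinityIn]
  have ht : Tendsto y (cocompact ℂ) (𝓝 0) := by
    rw [← Metric.cobounded_eq_cocompact, ← hcob, tendsto_zero_iff_norm_tendsto_zero]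
    have h1 : Tendsto (fun s : ℂ => C * (‖s‖ ^ α)⁻¹) (atInfinityIn Set.univ) (𝓝 0) := by
      simpa using (tendsto_norm_rpow_atInfinityIn Set.univ hα).inv_tendsto_atTop.const_mul C
    refine squeeze_zero' (Eventually.of_forall fun _ => norm_nonneg _) ?_ h1
    filter_upwards [h, eventually_one_le_norm Set.univ] with s hs hs1
    have : 0 < ‖s‖ ^ α := Real.rpow_pos_of_pos (one_pos.trans_le hs1) _
    rw [← div_eq_mul_inv, le_div_iff₀ this, mul_comm]
    exact hs.2
  have hz : ∀ s, y s = 0 := fun s => hy.apply_eq_of_tendsto_cocompact s ht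
  have : (atInfinityIn (Set.univ : Set ℂ)).NeBot :=
    atInfinityIn_neBot (c := 1) one_ne_zero fun _ => Set.mem_univ _
  obtain ⟨s, hs⟩ := h.exists
  rw [hz, norm_zero, mul_zero] at hs
  linarith [hs.1]

end Orders

/-! ### Gluing across the contour. -/

section Gluing

variable {γ : ℝ}

theorem DPlus_union_DMinus (γ : ℝ) : DPlus γ ∪ DMinus γ = Set.univ :=
  Set.eq_univ_of_forall fun s => le_total s.re γ

/-- Two functions analytic on the closed half-planes which agree on the contour are restrictions
of an entire function. -/
theorem exists_entire_of_eqOn_contour {A B : ℂ → ℂ} (hA : AnalyticOnNhd ℂ A (DPlus γ))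
    (hB : AnalyticOnNhd ℂ B (DMinus γ)) (hAB : ∀ s ∈ contour γ, A s = B s) :
    ∃ F : ℂ → ℂ, Differentiable ℂ F ∧ (∀ s ∈ DPlus γ, F s = A s) ∧ ∀ s ∈ DMinus γ, F s = B s := by
  classical
  have hF2 : ∀ s ∈ DMinus γ, (if s.re ≤ γ then A s else B s) = B s := fun s hs => by
    split_ifs with h
    · exact hAB s (le_antisymm h hs)
    · rfl
  refine ⟨fun s => if s.re ≤ γ then A s else B s, fun s => ?_, fun s hs => if_pos hs, hF2⟩
  rcases lt_trichotomy s.re γ with h | h | h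
  · refine (hA s h.le).differentiableAt.congr_of_eventuallyEq ?_
    filter_upwards [(isOpen_Iio.preimage Complex.continuous_re).mem_nhds h] with z hz
    exact if_pos (le_of_lt hz)
  · have hAs := hA s h.le
    have hBs := hB s h.ge
    -- The points `s + it` of the contour accumulate at `s`, so the identity theorem makes both
    -- functions agree in a full neighbourhood.
    have hfreq : ∃ᶠ z in 𝓝[≠] s, A z = B z := by
      have ht : Tendsto (fun t : ℝ => s + t * Complex.I) (𝓝[≠] 0) (𝓝[≠] s) := by
        refine tendsto_nhdsWithin_iff.2 ⟨?_, ?_⟩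
        · have : Tendsto (fun t : ℝ => s + t * Complex.I) (𝓝 0) (𝓝 (s + (0 : ℝ) * Complex.I)) :=
            Continuous.tendsto (by fun_prop) _
          simp only [Complex.ofReal_zero, zero_mul, add_zero] at this
          exact this.mono_left nhdsWithin_le_nhds
        · filter_upwards [self_mem_nhdsWithin] with t ht h'
          refine ht ?_
          have : (t : ℂ) * Complex.I = 0 := by simpa using h'
          simpa using this
      refine ht.frequently (Eventually.frequently (Eventually.of_forall fun t => ?_))
      refine hAB _ ?_
      simp [contour, h]
    have hev := (hAs.frequently_eq_iff_eventually_eq hBs).1 hfreq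
    refine hAs.differentiableAt.congr_of_eventuallyEq ?_
    filter_upwards [hev] with z hz
    split_ifs
    · rfl
    · exact hz.symm
  · refine (hB s h.le).differentiableAt.congr_of_eventuallyEq ?_
    filter_upwards [(isOpen_Ioi.preimage Complex.continuous_re).mem_nhds h] with z hz
    exact if_neg (not_le.2 hz)

end Gluing

/-! ### Determinant, adjugate and product estimates. -/

section Matrices

/-- Each of the `3!` terms of the Leibniz formula contains exactly one entry of column `j`. Keeping
that column separate later bounds it from below by the determinant. -/
theorem norm_det_le {M : Matrix (Fin 3) (Fin 3) ℂ} {C ε : ℝ} (hM : ∀ i j, ‖M i j‖ ≤ C)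
    (j : Fin 3) (hj : ∀ i, ‖M i j‖ ≤ ε) : ‖M.det‖ ≤ 6 * C ^ 2 * ε := by
  have hC : 0 ≤ C := (norm_nonneg _).trans (hM 0 0)
  have hε : 0 ≤ ε := (norm_nonneg _).trans (hj 0)
  rw [Matrix.det_apply]
  refine (norm_sum_le_of_le (f := fun σ : Equiv.Perm (Fin 3) =>
    Equiv.Perm.sign σ • ∏ i, M (σ i) i) Finset.univ (n := fun _ => C ^ 2 * ε) fun σ _ => ?_).trans_eq
    ?_
  · have h1 : ‖Equiv.Perm.sign σ • ∏ i, M (σ i) i‖ = ∏ i, ‖M (σ i) i‖ := by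
      rw [← norm_prod]
      rcases Int.units_eq_one_or (Equiv.Perm.sign σ) with h | h <;> simp [h]
    rw [h1, ← Finset.mul_prod_erase _ _ (Finset.mem_univ j)]
    have h2 : ∏ i ∈ Finset.univ.erase j, ‖M (σ i) i‖ ≤ C ^ 2 := by
      refine (Finset.prod_le_prod (fun _ _ => norm_nonneg _) fun i _ => hM (σ i) i).trans_eq ?_
      rw [Finset.prod_const, Finset.card_erase_of_mem (Finset.mem_univ j)]
      simp
    rw [mul_comm]
    have := hj (σ j)
    gcongr
  · rw [Finset.sum_const, Finset.card_univ, Fintype.card_perm, Fintype.card_fin]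
    simp [Nat.factorial]
    ring

theorem norm_mul_apply_le {M N : Matrix (Fin 3) (Fin 3) ℂ} {C : ℝ} (hM : ∀ i j, ‖M i j‖ ≤ C)
    (j : Fin 3) : ‖fun i => (M * N) i j‖ ≤ 3 * C * ‖fun i => N i j‖ := by
  have hC : 0 ≤ C := (norm_nonneg _).trans (hM 0 0)
  rw [pi_norm_le_iff_of_nonneg (by positivity)]
  intro i
  rw [Matrix.mul_apply]
  refine (norm_sum_le_of_le (f := fun k => M i k * N k j) Finset.univ
    (n := fun _ => C * ‖fun i => N i j‖) fun k _ => ?_).trans_eq ?_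
  · rw [norm_mul]
    have := norm_le_pi_norm (fun i => N i j) k
    gcongr
    exact hM i k
  · simp; ring

/-- A cofactor is the determinant after replacing a row by a unit vector; `1 ≤ C` keeps the new
entries within the bound. -/
theorem norm_adjugate_le {M : Matrix (Fin 3) (Fin 3) ℂ} {C : ℝ} (hC : 1 ≤ C)
    (hM : ∀ i j, ‖M i j‖ ≤ C) (i j : Fin 3) : ‖M.adjugate i j‖ ≤ 6 * C ^ 2 * C := by
  rw [Matrix.adjugate_apply]
  have : ∀ a b, ‖M.updateRow j (Pi.single i 1) a b‖ ≤ C := fun a b => by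
    rw [Matrix.updateRow_apply]
    split_ifs
    · rw [Pi.single_apply]
      split_ifs
      · simpa using hC
      · simpa using zero_le_one.trans hC
    · exact hM a b
  exact norm_det_le this 0 fun a => this a 0

theorem analyticAt_det {M : ℂ → Matrix (Fin 3) (Fin 3) ℂ} {s : ℂ}
    (h : ∀ i j, AnalyticAt ℂ (fun s => M s i j) s) : AnalyticAt ℂ (fun s => (M s).det) s := by
  simp only [Matrix.det_apply']
  refine Finset.analyticAt_fun_sum _ fun σ _ => analyticAt_const.mul ?_
  exact Finset.analyticAt_fun_prod _ fun i _ => h _ _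

theorem analyticAt_adjugate {M : ℂ → Matrix (Fin 3) (Fin 3) ℂ} {s : ℂ}
    (h : ∀ i j, AnalyticAt ℂ (fun s => M s i j) s) (i j : Fin 3) :
    AnalyticAt ℂ (fun s => (M s).adjugate i j) s := by
  simp only [Matrix.adjugate_apply]
  refine analyticAt_det fun a b => ?_
  simp only [Matrix.updateRow_apply]
  split_ifs
  · exact analyticAt_const
  · exact h a b

theorem analyticAt_mul_apply {M N : ℂ → Matrix (Fin 3) (Fin 3) ℂ} {s : ℂ}
    (hM : ∀ i j, AnalyticAt ℂ (fun s => M s i j) s)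
    (hN : ∀ i j, AnalyticAt ℂ (fun s => N s i j) s) (i j : Fin 3) :
    AnalyticAt ℂ (fun s => (M s * N s) i j) s := by
  simp only [Matrix.mul_apply]
  exact Finset.analyticAt_fun_sum _ fun k _ => (hM i k).mul (hN k j)

end Matrices

/-! ### Uniqueness of the partial indices. -/

section Uniqueness

variable {γ : ℝ} {D : Set ℂ} {X : ℂ → Matrix (Fin 3) (Fin 3) ℂ} {d : ℂ} {C : ℝ}

/-- A bounded matrix function with constant nonzero determinant has columns of order zero. -/
theorem hasOrderAtInfinity_column_zero (hd : d ≠ 0) (hC : 1 ≤ C)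
    (hX : ∀ s ∈ D, ∀ i j, ‖X s i j‖ ≤ C) (hdet : ∀ s ∈ D, (X s).det = d) (j : Fin 3) :
    HasOrderAtInfinity D (column X j) 0 := by
  refine ⟨‖d‖ / (6 * C ^ 2), C, div_pos (norm_pos_iff.2 hd) (by positivity), ?_⟩
  filter_upwards [eventually_norm_ge_atInfinityIn D 0] with s hs
  rw [Real.rpow_zero, one_mul]
  constructor
  · rw [div_le_iff₀ (by positivity), ← hdet s hs.2, mul_comm]
    exact norm_det_le (hX s hs.2) j fun i => norm_le_pi_norm (column X j s) i
  · exact (pi_norm_le_iff_of_nonneg (zero_le_one.trans hC)).2 fun i => hX s hs.2 i j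

theorem hasOrderAtInfinity_const (hd : d ≠ 0) {f : ℂ → ℂ} (hf : ∀ s ∈ D, f s = d) :
    HasOrderAtInfinity D f 0 := by
  refine ⟨‖d‖, ‖d‖, norm_pos_iff.2 hd, ?_⟩
  filter_upwards [eventually_norm_ge_atInfinityIn D 0] with s hs
  rw [Real.rpow_zero, one_mul, hf s hs.2]
  exact ⟨le_rfl, le_rfl⟩

theorem isNormalAtInfinity_of_det_const (hd : d ≠ 0) (hC : 1 ≤ C)
    (hX : ∀ s ∈ D, ∀ i j, ‖X s i j‖ ≤ C) (hdet : ∀ s ∈ D, (X s).det = d) :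
    IsNormalAtInfinity D X :=
  ⟨0, fun _ => 0, hasOrderAtInfinity_const hd hdet,
    hasOrderAtInfinity_column_zero hd hC hX hdet, by simp⟩

theorem nonsing_inv_apply_of_det {M : Matrix (Fin 3) (Fin 3) ℂ} (hM : M.det = d) (i j : Fin 3) :
    M⁻¹ i j = d⁻¹ * M.adjugate i j := by
  rw [Matrix.inv_def, hM, Ring.inverse_eq_inv', Matrix.smul_apply, smul_eq_mul]

variable {Y Z : ℂ → Matrix (Fin 3) (Fin 3) ℂ}

/-- Both `X` and `X⁻¹` are bounded, the latter through the adjugate, so multiplication by `X⁻¹`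
changes column norms only by constants. -/
theorem hasOrderAtInfinity_column_of_mul (hd : d ≠ 0) (hC : 1 ≤ C)
    (hX : ∀ s ∈ D, ∀ i j, ‖X s i j‖ ≤ C) (hdet : ∀ s ∈ D, (X s).det = d)
    (hZ : ∀ s ∈ D, Z s = (X s)⁻¹ * Y s) {j : Fin 3} {κ : ℝ}
    (hY : HasOrderAtInfinity D (column Y j) κ) : HasOrderAtInfinity D (column Z j) κ := by
  have hu : ∀ s ∈ D, IsUnit (X s).det := fun s hs => by
    rw [hdet s hs]; exact isUnit_iff_ne_zero.2 hd
  refine hY.transfer (a := (3 * C)⁻¹) (b := 3 * (‖d⁻¹‖ * (6 * C ^ 2 * C)))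
    (by positivity) (by positivity) fun s hs => ⟨?_, ?_⟩
  · have hYs : Y s = X s * Z s := by
      rw [hZ s hs, Matrix.mul_nonsing_inv_cancel_left _ _ (hu s hs)]
    have := norm_mul_apply_le (N := Z s) (hX s hs) j
    rw [← hYs] at this
    rw [inv_mul_le_iff₀ (by positivity)]
    exact this
  · have hinv : ∀ a b, ‖(X s)⁻¹ a b‖ ≤ ‖d⁻¹‖ * (6 * C ^ 2 * C) := fun a b => by
      rw [nonsing_inv_apply_of_det (hdet s hs), norm_mul]
      gcongr
      exact norm_adjugate_le hC (hX s hs) a b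
    have := norm_mul_apply_le (N := Y s) hinv j
    rw [← hZ s hs] at this
    exact this

theorem hasOrderAtInfinity_det_of_mul (hd : d ≠ 0) (hdet : ∀ s ∈ D, (X s).det = d)
    (hZ : ∀ s ∈ D, Z s = (X s)⁻¹ * Y s) {κ : ℝ}
    (hY : HasOrderAtInfinity D (fun s => (Y s).det) κ) :
    HasOrderAtInfinity D (fun s => (Z s).det) κ := by
  have hdp : 0 < ‖d⁻¹‖ := norm_pos_iff.2 (inv_ne_zero hd)
  have h : ∀ s ∈ D, ‖(Z s).det‖ = ‖d⁻¹‖ * ‖(Y s).det‖ := fun s hs => by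
    rw [hZ s hs, Matrix.det_mul, Matrix.det_nonsing_inv, hdet s hs, Ring.inverse_eq_inv', norm_mul]
  exact hY.transfer hdp hdp.le fun s hs => ⟨(h s hs).ge, (h s hs).le⟩

/-- Normality comes with its own column orders; uniqueness of orders identifies them with the given
`κ`. -/
theorem IsNormalAtInfinity.det_order [(atInfinityIn D).NeBot] (h : IsNormalAtInfinity D Y)
    {κ : Fin 3 → ℝ} (hκ : ∀ j, HasOrderAtInfinity D (column Y j) (κ j)) :
    HasOrderAtInfinity D (fun s => (Y s).det) (∑ j, κ j) := by
  obtain ⟨α, κ', hα, hκ', rfl⟩ := h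
  rwa [Finset.sum_congr rfl fun j _ => (hκ j).unique (hκ' j)]

/-- With constant determinant the inverse is `d⁻¹` times the adjugate, which is polynomial in the
entries and so visibly analytic. -/
theorem analyticAt_const_mul_adjugate_mul {s : ℂ} (hX : ∀ i j, AnalyticAt ℂ (fun s => X s i j) s)
    (hY : ∀ i j, AnalyticAt ℂ (fun s => Y s i j) s) (i j : Fin 3) :
    AnalyticAt ℂ (fun s => d⁻¹ * ((X s).adjugate * Y s) i j) s :=
  analyticAt_const.mul (analyticAt_mul_apply (analyticAt_adjugate hX) hY i j)

theorem inv_mul_apply_of_det {M N : Matrix (Fin 3) (Fin 3) ℂ} (hM : M.det = d) (i j : Fin 3) :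
    (M⁻¹ * N) i j = d⁻¹ * (M.adjugate * N) i j := by
  rw [Matrix.inv_def, hM, Ring.inverse_eq_inv', Matrix.smul_mul, Matrix.smul_apply, smul_eq_mul]

theorem atInfinityIn_DMinus_neBot (γ : ℝ) : (atInfinityIn (DMinus γ)).NeBot := by
  have h : ∀ n : ℕ, γ ≤ ((|γ| + 1 : ℝ) * (n + 1 : ℝ)) := fun n => by
    have h1 := le_abs_self γ
    have h2 := abs_nonneg γ
    have h3 : (0 : ℝ) ≤ n := n.cast_nonneg
    nlinarith
  have hc : (0 : ℝ) < |γ| + 1 := by positivity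
  have ht : Tendsto (fun n : ℕ => (((|γ| + 1 : ℝ) * (n + 1 : ℝ) : ℝ) : ℂ)) atTop
      (atInfinityIn (DMinus γ)) := by
    refine tendsto_inf.2 ⟨?_, tendsto_principal.2 (Eventually.of_forall fun n => ?_)⟩
    · rw [← tendsto_norm_atTop_iff_cobounded]
      simp only [Complex.norm_real]
      refine tendsto_norm_atTop_atTop.comp (Tendsto.const_mul_atTop hc ?_)
      exact tendsto_atTop_add_const_right _ _ tendsto_natCast_atTop_atTop
    · simpa only [DMinus, Set.mem_ofPred_eq, Complex.ofReal_re] using h n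
  exact ht.neBot

/-- If a factorization consists of bounded matrix functions with constant nonzero determinants,
then all systems of partial indices vanish. -/
theorem IsPartialIndices.eq_zero {G Xp Xm : ℂ → Matrix (Fin 3) (Fin 3) ℂ} {dp dm : ℂ}
    (hγ0 : 0 < γ) (hfac : IsCanonicalFactorization γ G Xp Xm) (hdp : dp ≠ 0) (hdm : dm ≠ 0)
    (hC : 1 ≤ C) (hXp : ∀ s ∈ DPlus γ, ∀ i j, ‖Xp s i j‖ ≤ C)
    (hXm : ∀ s ∈ DMinus γ, ∀ i j, ‖Xm s i j‖ ≤ C) (hdetp : ∀ s ∈ DPlus γ, (Xp s).det = dp)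
    (hdetm : ∀ s ∈ DMinus γ, (Xm s).det = dm) {κ : Fin 3 → ℤ} (h : IsPartialIndices γ G κ)
    (j : Fin 3) : κ j = 0 := by
  obtain ⟨Yp, Ym, hY, hκ⟩ := h
  have : (atInfinityIn (DPlus γ)).NeBot := atInfinityIn_DPlus_neBot hγ0
  have : (atInfinityIn (DMinus γ)).NeBot := atInfinityIn_DMinus_neBot γ
  -- Both factorizations represent the same `G`, so `Xp Xm⁻¹ = Yp Ym⁻¹`.
  have hagree : ∀ s ∈ contour γ, (Xp s)⁻¹ * Yp s = (Xm s)⁻¹ * Ym s := fun s hs => by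
    have hsp : s ∈ DPlus γ := le_of_eq hs
    have hsm : s ∈ DMinus γ := ge_of_eq hs
    have up : IsUnit (Xp s).det := isUnit_iff_ne_zero.2 (hfac.det_plus_ne_zero s hsp)
    have um : IsUnit (Ym s).det := isUnit_iff_ne_zero.2 (hY.det_minus_ne_zero s hsm)
    have h1 := hfac.factorization s hs
    rw [hY.factorization s hs] at h1
    have h2 : Yp s = Xp s * (Xm s)⁻¹ * Ym s := by
      rw [← h1, Matrix.nonsing_inv_mul_cancel_right _ _ um]
    rw [h2, Matrix.mul_assoc, Matrix.nonsing_inv_mul_cancel_left _ _ up]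
  have hglue : ∀ i j : Fin 3, ∃ F : ℂ → ℂ, Differentiable ℂ F ∧
      (∀ s ∈ DPlus γ, F s = ((Xp s)⁻¹ * Yp s) i j) ∧
      ∀ s ∈ DMinus γ, F s = ((Xm s)⁻¹ * Ym s) i j := fun i j => by
    obtain ⟨F, hF, hFp, hFm⟩ := exists_entire_of_eqOn_contour (γ := γ)
      (A := fun s => dp⁻¹ * ((Xp s).adjugate * Yp s) i j)
      (B := fun s => dm⁻¹ * ((Xm s).adjugate * Ym s) i j)
      (fun s hs => analyticAt_const_mul_adjugate_mul (fun a b => hfac.analytic_plus a b s hs)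
        (fun a b => hY.analytic_plus a b s hs) i j)
      (fun s hs => analyticAt_const_mul_adjugate_mul (fun a b => hfac.analytic_minus a b s hs)
        (fun a b => hY.analytic_minus a b s hs) i j)
      (fun s hs => by
        have hsp : s ∈ DPlus γ := le_of_eq hs
        have hsm : s ∈ DMinus γ := ge_of_eq hs
        rw [← inv_mul_apply_of_det (hdetp s hsp), ← inv_mul_apply_of_det (hdetm s hsm),
          hagree s hs])
    exact ⟨F, hF, fun s hs => (hFp s hs).trans (inv_mul_apply_of_det (hdetp s hs) i j).symm,
      fun s hs => (hFm s hs).trans (inv_mul_apply_of_det (hdetm s hs) i j).symm⟩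
  choose F hF hFp hFm using hglue
  set Z : ℂ → Matrix (Fin 3) (Fin 3) ℂ := fun s => Matrix.of fun i j => F i j s
  have hZp : ∀ s ∈ DPlus γ, Z s = (Xp s)⁻¹ * Yp s := fun s hs =>
    Matrix.ext fun i j => hFp i j s hs
  have hZm : ∀ s ∈ DMinus γ, Z s = (Xm s)⁻¹ * Ym s := fun s hs =>
    Matrix.ext fun i j => hFm i j s hs
  -- The columns of `Z` are entire of order `κ j` on the whole plane.
  have hcol : ∀ j, (κ j : ℝ) ≤ 0 := fun j =>
    ((hasOrderAtInfinity_column_of_mul hdp hC hXp hdetp hZp (hκ j).1).union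
      (hasOrderAtInfinity_column_of_mul hdm hC hXm hdetm hZm (hκ j).2)
      (DPlus_union_DMinus γ)).nonpos_of_entire (differentiable_pi.2 fun i => hF i j)
  have hZdet : Differentiable ℂ fun s => (Z s).det := fun s =>
    (analyticAt_det fun i j => (hF i j).analyticAt s).differentiableAt
  have hZne : ∀ s, (Z s).det ≠ 0 := fun s => by
    rcases (DPlus_union_DMinus γ ▸ Set.mem_univ s : s ∈ DPlus γ ∪ DMinus γ) with hs | hs
    · rw [hZp s hs, Matrix.det_mul, Matrix.det_nonsing_inv, hdetp s hs, Ring.inverse_eq_inv']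
      exact mul_ne_zero (inv_ne_zero hdp) (hY.det_plus_ne_zero s hs)
    · rw [hZm s hs, Matrix.det_mul, Matrix.det_nonsing_inv, hdetm s hs, Ring.inverse_eq_inv']
      exact mul_ne_zero (inv_ne_zero hdm) (hY.det_minus_ne_zero s hs)
  -- The reciprocal of `det Z` is also entire; inversion reverses the order, giving the opposite
  -- inequality for the sum.
  have hsum : -∑ j, (κ j : ℝ) ≤ 0 :=
    ((hasOrderAtInfinity_det_of_mul hdp hdetp hZp
      (hY.normal_plus.det_order fun j => (hκ j).1)).union
      (hasOrderAtInfinity_det_of_mul hdm hdetm hZm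
      (hY.normal_minus.det_order fun j => (hκ j).2))
      (DPlus_union_DMinus γ)).inv.nonpos_of_entire (hZdet.inv hZne)
  have h0 : ∑ j, (κ j : ℝ) = 0 :=
    le_antisymm (Finset.sum_nonpos fun j _ => hcol j) (by linarith)
  exact_mod_cast (Finset.sum_eq_zero_iff_of_nonpos fun j _ => hcol j).1 h0 j (Finset.mem_univ j)

end Uniqueness

/-! ### Determinants, the factorization identity and the conclusion. -/

section Factorization

variable {lam0 lam1 γ : ℝ} {K : Coeffs} {s : ℂ}

theorem summable_div_of_ne_int {a : ℕ → ℤ} {c : ℕ → ℂ} (hc : Summable fun m => ‖c m‖)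
    (hs : ∀ k : ℤ, s ≠ k) {f : ℕ → ℂ} (hf : ∀ m, f m = s - a m) : Summable fun m => c m / f m := by
  obtain ⟨ε, hε, h⟩ := exists_ball_far_of_int fun m => hs (a m)
  simp only [hf]
  exact summable_poleSeries hc hε (h s (Metric.mem_ball_self hε))

theorem SolvesSystems.seriesConverge (hK : SolvesSystems lam0 lam1 K) (h0 : 0 < lam0)
    (h01 : lam0 < lam1) (h1 : lam1 < 1) (hs : ∀ k : ℤ, s ≠ k) (l : Fin 3) :
    SeriesConverge K l s := by
  obtain ⟨gAp, gAm, gBp, gBm⟩ := hK.geomDecay h0 h01 h1 l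
  have hr0 := ratio_nonneg (lam0 := lam0) (h0.trans h01)
  have hr1 := ratio_lt_one h0 h01 h1
  refine ⟨summable_div_of_ne_int (a := fun m => 2 * m + 1) (gAp.summable_norm hr0 hr1) hs ?_,
    summable_div_of_ne_int (a := fun m => -(2 * m + 1)) (gAm.summable_norm hr0 hr1) hs ?_,
    summable_div_of_ne_int (a := fun m => 2 * m + 2) (gBp.summable_norm hr0 hr1) hs ?_,
    summable_div_of_ne_int (a := fun m => -(2 * m)) (gBm.summable_norm hr0 hr1) hs ?_⟩ <;>
  · intro m; push_cast; ring

/-- Expanding the determinant of the rows `P`, `O`, `Q` reveals `chi`. The rows of both closed forms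
arise from these by scaling, adding multiples of other rows and an even permutation, so both
determinants are multiples of it. -/
theorem chi_eq_det (K : Coeffs) (s : ℂ) : chi K s =
    (Matrix.of ![fun l => rowP K l s, fun l => rowO K l s, fun l => rowQ K l s]).det := by
  rw [Matrix.det_fin_three]
  simp only [chi, rowP, rowO, rowQ, kron, Matrix.of_apply, Matrix.cons_val, Fin.isValue,
    Fin.reduceEq, if_true, if_false, add_zero]
  ring

theorem det_XplusFormula (h0 : lam0 ≠ 0) :
    2 * (lam0 : ℂ) * (XplusFormula lam0 lam1 K s).det = chi K s := by
  have : (lam0 : ℂ) ≠ 0 := by exact_mod_cast h0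
  rw [chi_eq_det, Matrix.det_fin_three, Matrix.det_fin_three]
  simp only [XplusFormula_zero, XplusFormula_one, XplusFormula_two, Matrix.of_apply,
    Matrix.cons_val]
  field_simp
  ring

theorem det_XminusFormula (h1 : lam1 ≠ 0) :
    4 * (lam1 : ℂ) * (XminusFormula lam0 lam1 K s).det = chi K s := by
  have : (lam1 : ℂ) ≠ 0 := by exact_mod_cast h1
  rw [chi_eq_det, Matrix.det_fin_three, Matrix.det_fin_three]
  simp only [XminusFormula_zero, XminusFormula_one, XminusFormula_two, Matrix.of_apply,
    Matrix.cons_val]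
  field_simp
  ring

theorem cot_mul_tan_half_pi (hs : ∀ k : ℤ, s ≠ k) :
    Complex.cot (Real.pi * s / 2) * Complex.tan (Real.pi * s / 2) = 1 := by
  have h1 : Complex.sin (Real.pi * s / 2) ≠ 0 :=
    sin_half_pi_ne_zero fun k => by exact_mod_cast hs (2 * k)
  have h2 : Complex.cos (Real.pi * s / 2) ≠ 0 :=
    cos_half_pi_ne_zero fun k => by exact_mod_cast hs (2 * k + 1)
  rw [Complex.cot, Complex.tan]
  field_simp

/-- Only `cot · tan = 1` off the integers and `λ₀^s = λ₁^s μ^s` are needed, together with the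
functional equation of the powers. -/
theorem G0_mul_XminusFormula (h0 : 0 < lam0) (h1 : 0 < lam1) (hs : ∀ k : ℤ, s ≠ k) :
    G0 lam0 lam1 s * XminusFormula lam0 lam1 K s = XplusFormula lam0 lam1 K s := by
  have hct := cot_mul_tan_half_pi hs
  have hl0 : (lam0 : ℂ) ≠ 0 := by exact_mod_cast h0.ne'
  have hl1 : (lam1 : ℂ) ≠ 0 := by exact_mod_cast h1.ne'
  have hmu : ((lam0 / lam1 : ℝ) : ℂ) ≠ 0 := by exact_mod_cast (div_pos h0 h1).ne'
  have e1 : (lam1 : ℂ) ^ (-s) * (lam1 : ℂ) ^ s = 1 := by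
    rw [← Complex.cpow_add _ _ hl1, neg_add_cancel, Complex.cpow_zero]
  have e2 : ((lam0 / lam1 : ℝ) : ℂ) ^ (-s) * ((lam0 / lam1 : ℝ) : ℂ) ^ s = 1 := by
    rw [← Complex.cpow_add _ _ hmu, neg_add_cancel, Complex.cpow_zero]
  have e3 : (lam0 : ℂ) ^ s = (lam1 : ℂ) ^ s * ((lam0 / lam1 : ℝ) : ℂ) ^ s := by
    rw [← Complex.mul_cpow_ofReal_nonneg h1.le (div_pos h0 h1).le, ← Complex.ofReal_mul,
      mul_div_cancel₀ _ h1.ne']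
  have e4 : (lam1 : ℂ) ^ (s + 1) = (lam1 : ℂ) ^ s * lam1 := by
    rw [Complex.cpow_add _ _ hl1, Complex.cpow_one]
  have e5 : ((lam0 / lam1 : ℝ) : ℂ) ^ (-s - 1) =
      ((lam0 / lam1 : ℝ) : ℂ) ^ (-s) * (lam1 / lam0) := by
    rw [Complex.cpow_sub _ _ hmu, Complex.cpow_one, Complex.ofReal_div]
    field_simp
  ext i l
  rw [Matrix.mul_apply, Fin.sum_univ_three, XminusFormula_zero, XminusFormula_one,
    XminusFormula_two]
  revert i
  refine Fin.forall_fin_succ.2 ⟨?_, Fin.forall_fin_two.2 ⟨?_, ?_⟩⟩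
  · change G0 lam0 lam1 s 0 0 * _ + G0 lam0 lam1 s 0 1 * _ + G0 lam0 lam1 s 0 2 * _ =
      XplusFormula lam0 lam1 K s 0 l
    rw [XplusFormula_zero]
    simp only [G0, Matrix.of_apply, Matrix.cons_val]
    linear_combination (1 / 2 * rowO K l s) * (Complex.cot (Real.pi * s / 2) * Complex.tan (Real.pi * s / 2)) * e1
      + (1 / 2 * rowO K l s) * hct
  · change G0 lam0 lam1 s 1 0 * _ + G0 lam0 lam1 s 1 1 * _ + G0 lam0 lam1 s 1 2 * _ =
      XplusFormula lam0 lam1 K s 1 l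
    rw [XplusFormula_one]
    simp only [G0, Matrix.of_apply, Matrix.cons_val]
    rw [e5]
    have e6 : (1 / lam0 : ℂ) = lam1 / lam0 * (1 / lam1) := by field_simp
    rw [e6]
    linear_combination (lam1 / lam0 * (1 / lam1) * rowQ K l s) *
      (Complex.cot (Real.pi * s / 2) * Complex.tan (Real.pi * s / 2)) * e2 + (lam1 / lam0 * (1 / lam1) * rowQ K l s) * hct
  · change G0 lam0 lam1 s 2 0 * _ + G0 lam0 lam1 s 2 1 * _ + G0 lam0 lam1 s 2 2 * _ =
      XplusFormula lam0 lam1 K s 2 l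
    rw [XplusFormula_two]
    simp only [G0, Matrix.of_apply, Matrix.cons_val]
    rw [e4, e3]
    have e7 : (lam1 : ℂ) * (1 / lam1) = 1 := by field_simp
    linear_combination (-(lam1 : ℂ) ^ s * Complex.tan (Real.pi * s / 2) *
      (((lam0 / lam1 : ℝ) : ℂ) ^ s * Complex.cot (Real.pi * s / 2) * rowQ K l s + rowO K l s)) * e7
      - ((lam1 : ℂ) ^ s * ((lam0 / lam1 : ℝ) : ℂ) ^ s * rowQ K l s) * hct

theorem ne_int_of_mem_contour (h0 : 0 < γ) (h1 : γ < 1) (hs : s ∈ contour γ) (k : ℤ) :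
    s ≠ k := by
  rintro rfl
  have h : (k : ℝ) = γ := by simpa [contour] using hs
  have h2 : (0 : ℝ) < k := by linarith
  have h3 : (k : ℝ) < 1 := by linarith
  have h4 : 0 < k := by exact_mod_cast h2
  have h5 : k < 1 := by exact_mod_cast h3
  omega

theorem mem_DPlus_iff : s ∈ DPlus γ ↔ -γ ≤ -1 * s.re := by
  rw [neg_one_mul, neg_le_neg_iff]; rfl

theorem mem_DMinus_iff : s ∈ DMinus γ ↔ γ ≤ 1 * s.re := by
  rw [one_mul]; rfl

theorem XplusInfinity_det (h0 : lam0 ≠ 0) : 2 * (lam0 : ℂ) * (XplusInfinity lam0).det = 1 := by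
  have : (lam0 : ℂ) ≠ 0 := by exact_mod_cast h0
  rw [Matrix.det_fin_three]
  simp [XplusInfinity]
  field_simp

/-- The hypotheses of the theorem, for a solution of the systems. -/
structure Setting (lam0 lam1 γ : ℝ) (K : Coeffs) : Prop where
  lam0_pos : 0 < lam0
  lam0_lt : lam0 < lam1
  lam1_lt : lam1 < 1
  γ_pos : 0 < γ
  γ_lt : γ < 1
  solves : SolvesSystems lam0 lam1 K

namespace Setting

theorem tame_plus (S : Setting lam0 lam1 γ K) (i l : Fin 3) :
    Tame (-1) (-γ) (discRadius γ) (fun s => XplusFormula lam0 lam1 K s i l)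
      (XplusInfinity lam0 i l) :=
  S.solves.tame_plus S.lam0_pos S.lam0_lt S.lam1_lt S.γ_pos S.γ_lt i l

theorem tame_minus (S : Setting lam0 lam1 γ K) (i l : Fin 3) :
    Tame 1 γ (discRadius γ) (fun s => XminusFormula lam0 lam1 K s i l)
      (XminusInfinity lam1 i l) :=
  S.solves.tame_minus S.lam0_pos S.lam0_lt S.lam1_lt S.γ_pos S.γ_lt i l

theorem lam1_pos (S : Setting lam0 lam1 γ K) : 0 < lam1 := S.lam0_pos.trans S.lam0_lt

theorem Xplus_eq (S : Setting lam0 lam1 γ K) (hs : ∀ k : ℤ, s ≠ k) :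
    Xplus lam0 lam1 K s = XplusFormula lam0 lam1 K s :=
  Matrix.ext fun i l => (S.tame_plus i l).limUnder_eq hs

theorem Xminus_eq (S : Setting lam0 lam1 γ K) (hs : ∀ k : ℤ, s ≠ k) :
    Xminus lam0 lam1 K s = XminusFormula lam0 lam1 K s :=
  Matrix.ext fun i l => (S.tame_minus i l).limUnder_eq hs

theorem analytic_plus (S : Setting lam0 lam1 γ K) (i l : Fin 3) :
    AnalyticOnNhd ℂ (fun s => Xplus lam0 lam1 K s i l) (DPlus γ) := fun _ hs =>
  (S.tame_plus i l).analyticAt (mem_DPlus_iff.1 hs)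

theorem analytic_minus (S : Setting lam0 lam1 γ K) (i l : Fin 3) :
    AnalyticOnNhd ℂ (fun s => Xminus lam0 lam1 K s i l) (DMinus γ) := fun _ hs =>
  (S.tame_minus i l).analyticAt (mem_DMinus_iff.1 hs)

theorem isBigO_plus (S : Setting lam0 lam1 γ K) {M : ℝ} (hM : 0 < M) (i l : Fin 3) :
    (fun s => Xplus lam0 lam1 K s i l - XplusInfinity lam0 i l)
      =O[atInfinityIn (leftSector M)] (fun s => s⁻¹) := by
  have h := (S.tame_plus i l).isBigO (margin_plus S.γ_pos S.γ_lt) hM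
  simp only [neg_one_mul] at h
  exact h

theorem isBigO_minus (S : Setting lam0 lam1 γ K) {M : ℝ} (hM : 0 < M) (i l : Fin 3) :
    (fun s => Xminus lam0 lam1 K s i l - XminusInfinity lam1 i l)
      =O[atInfinityIn (rightSector M)] (fun s => s⁻¹) := by
  have h := (S.tame_minus i l).isBigO (margin_minus S.γ_pos S.γ_lt) hM
  simp only [one_mul] at h
  exact h

theorem exists_bound (S : Setting lam0 lam1 γ K) : ∃ C : ℝ, 1 ≤ C ∧
    (∀ s ∈ DPlus γ, ∀ i j, ‖Xplus lam0 lam1 K s i j‖ ≤ C) ∧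
    ∀ s ∈ DMinus γ, ∀ i j, ‖Xminus lam0 lam1 K s i j‖ ≤ C := by
  have h1 : ∀ i j : Fin 3, ∃ C, ∀ s ∈ DPlus γ, ‖Xplus lam0 lam1 K s i j‖ ≤ C := fun i j => by
    obtain ⟨C, hC⟩ := (S.tame_plus i j).exists_norm_sub_le (margin_plus S.γ_pos S.γ_lt)
    refine ⟨C + ‖XplusInfinity lam0 i j‖, fun s hs => ?_⟩
    exact (norm_le_norm_sub_add _ _).trans (add_le_add (hC s (mem_DPlus_iff.1 hs)) le_rfl)
  have h2 : ∀ i j : Fin 3, ∃ C, ∀ s ∈ DMinus γ, ‖Xminus lam0 lam1 K s i j‖ ≤ C := fun i j => by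
    obtain ⟨C, hC⟩ := (S.tame_minus i j).exists_norm_sub_le (margin_minus S.γ_pos S.γ_lt)
    refine ⟨C + ‖XminusInfinity lam1 i j‖, fun s hs => ?_⟩
    exact (norm_le_norm_sub_add _ _).trans (add_le_add (hC s (mem_DMinus_iff.1 hs)) le_rfl)
  choose C₁ hC₁ using h1
  choose C₂ hC₂ using h2
  refine ⟨1 + ∑ p : Fin 3 × Fin 3, (|C₁ p.1 p.2| + |C₂ p.1 p.2|),
    le_add_of_nonneg_right (Finset.sum_nonneg fun _ _ => by positivity), fun s hs i j => ?_,
    fun s hs i j => ?_⟩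
  all_goals
    have h3 := Finset.single_le_sum (f := fun p : Fin 3 × Fin 3 => |C₁ p.1 p.2| + |C₂ p.1 p.2|)
      (fun _ _ => by positivity) (Finset.mem_univ (i, j))
    have h4 := le_abs_self (C₁ i j)
    have h5 := le_abs_self (C₂ i j)
    have h6 := abs_nonneg (C₁ i j)
    have h7 := abs_nonneg (C₂ i j)
    simp only at h3
  · have := hC₁ i j s hs; linarith
  · have := hC₂ i j s hs; linarith

/-- On the contour both scaled determinants equal `chi`, so they glue to an entire function; it is
bounded because the entries are, hence constant by Liouville's theorem. -/
theorem det_eq (S : Setting lam0 lam1 γ K) :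
    (∀ s ∈ DPlus γ, 2 * (lam0 : ℂ) * (Xplus lam0 lam1 K s).det = 1) ∧
    ∀ s ∈ DMinus γ, 4 * (lam1 : ℂ) * (Xminus lam0 lam1 K s).det = 1 := by
  obtain ⟨F, hF, hFp, hFm⟩ := exists_entire_of_eqOn_contour (γ := γ)
    (A := fun s => 2 * (lam0 : ℂ) * (Xplus lam0 lam1 K s).det)
    (B := fun s => 4 * (lam1 : ℂ) * (Xminus lam0 lam1 K s).det)
    (fun s hs => analyticAt_const.mul (analyticAt_det fun i j => S.analytic_plus i j s hs))
    (fun s hs => analyticAt_const.mul (analyticAt_det fun i j => S.analytic_minus i j s hs))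
    (fun s hs => by
      have hk := ne_int_of_mem_contour S.γ_pos S.γ_lt hs
      rw [S.Xplus_eq hk, S.Xminus_eq hk, det_XplusFormula S.lam0_pos.ne',
        det_XminusFormula S.lam1_pos.ne'])
  obtain ⟨C, hC, hXp, hXm⟩ := S.exists_bound
  have hbdd : Bornology.IsBounded (Set.range F) := by
    refine isBounded_iff_forall_norm_le.2
      ⟨‖2 * (lam0 : ℂ)‖ * (6 * C ^ 2 * C) + ‖4 * (lam1 : ℂ)‖ * (6 * C ^ 2 * C), ?_⟩
    rintro _ ⟨s, rfl⟩
    have hp : 0 ≤ 6 * C ^ 2 * C := by positivity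
    rcases (DPlus_union_DMinus γ ▸ Set.mem_univ s : s ∈ DPlus γ ∪ DMinus γ) with hs | hs
    · rw [hFp s hs, norm_mul]
      refine le_add_of_le_of_nonneg ?_ (by positivity)
      exact mul_le_mul_of_nonneg_left (norm_det_le (hXp s hs) 0 fun i => hXp s hs i 0)
        (norm_nonneg _)
    · rw [hFm s hs, norm_mul]
      refine le_add_of_nonneg_of_le (by positivity) ?_
      exact mul_le_mul_of_nonneg_left (norm_det_le (hXm s hs) 0 fun i => hXm s hs i 0)
        (norm_nonneg _)
  have hconst : ∀ s, F s = F 0 := fun s => hF.apply_eq_apply_of_bounded hbdd s 0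
  have hne : (atInfinityIn (leftSector 1)).NeBot :=
    atInfinityIn_neBot (c := -1) (by simp) fun n => by simp [leftSector]
  have hinv : Tendsto (fun s : ℂ => s⁻¹) (atInfinityIn (leftSector 1)) (𝓝 0) :=
    tendsto_inv₀_cobounded.mono_left inf_le_left
  have hentry : ∀ i j, Tendsto (fun s => Xplus lam0 lam1 K s i j) (atInfinityIn (leftSector 1))
      (𝓝 (XplusInfinity lam0 i j)) := fun i j =>
    tendsto_sub_nhds_zero_iff.1 ((S.isBigO_plus one_pos i j).trans_tendsto hinv)
  have hX : Tendsto (fun s => Xplus lam0 lam1 K s) (atInfinityIn (leftSector 1))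
      (𝓝 (XplusInfinity lam0)) :=
    tendsto_pi_nhds.2 fun i => tendsto_pi_nhds.2 fun j => hentry i j
  -- The constant is found in the left sector, which lies in `DPlus γ` and where `X⁺` converges
  -- entrywise to `XplusInfinity`.
  have hdet : Tendsto F (atInfinityIn (leftSector 1)) (𝓝 1) := by
    have hcont : Continuous fun M : Matrix (Fin 3) (Fin 3) ℂ => 2 * (lam0 : ℂ) * M.det := by
      fun_prop
    have := (hcont.tendsto (XplusInfinity lam0)).comp hX
    rw [XplusInfinity_det S.lam0_pos.ne'] at this
    refine this.congr' ?_
    filter_upwards [eventually_norm_ge_atInfinityIn (leftSector 1) 0] with s hs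
    have h1 : |s.im| ≤ 1 * (-s.re) := hs.2
    refine (hFp s ?_).symm
    have h2 := abs_nonneg s.im
    have h3 := S.γ_pos
    change s.re ≤ γ
    linarith
  have h1 : F 0 = 1 := by
    refine tendsto_nhds_unique ?_ hdet
    exact tendsto_const_nhds.congr fun s => (hconst s).symm
  exact ⟨fun s hs => by rw [← hFp s hs, hconst, h1], fun s hs => by rw [← hFm s hs, hconst, h1]⟩

theorem det_plus (S : Setting lam0 lam1 γ K) (hs : s ∈ DPlus γ) :
    (Xplus lam0 lam1 K s).det = 1 / (2 * (lam0 : ℂ)) := by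
  have h : (lam0 : ℂ) ≠ 0 := by exact_mod_cast S.lam0_pos.ne'
  rw [eq_div_iff (by simpa using h), mul_comm]
  exact S.det_eq.1 s hs

theorem det_minus (S : Setting lam0 lam1 γ K) (hs : s ∈ DMinus γ) :
    (Xminus lam0 lam1 K s).det = 1 / (4 * (lam1 : ℂ)) := by
  have h : (lam1 : ℂ) ≠ 0 := by exact_mod_cast S.lam1_pos.ne'
  rw [eq_div_iff (by simpa using h), mul_comm]
  exact S.det_eq.2 s hs

theorem det_plus_value_ne_zero (S : Setting lam0 lam1 γ K) : 1 / (2 * (lam0 : ℂ)) ≠ 0 := by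
  simpa using S.lam0_pos.ne'

theorem det_minus_value_ne_zero (S : Setting lam0 lam1 γ K) : 1 / (4 * (lam1 : ℂ)) ≠ 0 := by
  simpa using S.lam1_pos.ne'

theorem chi_eq_one (S : Setting lam0 lam1 γ K) (hs : ∀ k : ℤ, s ≠ k) : chi K s = 1 := by
  rcases (DPlus_union_DMinus γ ▸ Set.mem_univ s : s ∈ DPlus γ ∪ DMinus γ) with h | h
  · rw [← det_XplusFormula (lam1 := lam1) S.lam0_pos.ne', ← S.Xplus_eq hs]
    exact S.det_eq.1 s h
  · rw [← det_XminusFormula (lam0 := lam0) S.lam1_pos.ne', ← S.Xminus_eq hs]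
    exact S.det_eq.2 s h

theorem isCanonicalFactorization (S : Setting lam0 lam1 γ K) :
    IsCanonicalFactorization γ (G0 lam0 lam1) (Xplus lam0 lam1 K) (Xminus lam0 lam1 K) := by
  obtain ⟨C, hC, hXp, hXm⟩ := S.exists_bound
  refine ⟨S.analytic_plus, S.analytic_minus, fun s hs => ?_, fun s hs => ?_, fun s hs => ?_,
    isNormalAtInfinity_of_det_const S.det_plus_value_ne_zero hC hXp fun s hs => S.det_plus hs,
    isNormalAtInfinity_of_det_const S.det_minus_value_ne_zero hC hXm fun s hs => S.det_minus hs⟩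
  · have hk := ne_int_of_mem_contour S.γ_pos S.γ_lt hs
    have hu : IsUnit (Xminus lam0 lam1 K s).det := by
      rw [S.det_minus (ge_of_eq hs)]
      exact isUnit_iff_ne_zero.2 S.det_minus_value_ne_zero
    rw [S.Xplus_eq hk, ← G0_mul_XminusFormula S.lam0_pos S.lam1_pos hk, ← S.Xminus_eq hk,
      Matrix.mul_nonsing_inv_cancel_right _ _ hu]
  · rw [S.det_plus hs]; exact S.det_plus_value_ne_zero
  · rw [S.det_minus hs]; exact S.det_minus_value_ne_zero

theorem column_order (S : Setting lam0 lam1 γ K) (j : Fin 3) :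
    HasOrderAtInfinity (DPlus γ) (column (Xplus lam0 lam1 K) j) 0 ∧
      HasOrderAtInfinity (DMinus γ) (column (Xminus lam0 lam1 K) j) 0 := by
  obtain ⟨C, hC, hXp, hXm⟩ := S.exists_bound
  exact ⟨hasOrderAtInfinity_column_zero S.det_plus_value_ne_zero hC hXp
    (fun s hs => S.det_plus hs) j, hasOrderAtInfinity_column_zero S.det_minus_value_ne_zero hC hXm
    (fun s hs => S.det_minus hs) j⟩

theorem isPartialIndices_iff (S : Setting lam0 lam1 γ K) (κ : Fin 3 → ℤ) :
    IsPartialIndices γ (G0 lam0 lam1) κ ↔ ∀ j, κ j = 0 := by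
  obtain ⟨C, hC, hXp, hXm⟩ := S.exists_bound
  refine ⟨fun h j => h.eq_zero S.γ_pos S.isCanonicalFactorization S.det_plus_value_ne_zero
    S.det_minus_value_ne_zero hC hXp hXm (fun s hs => S.det_plus hs)
    (fun s hs => S.det_minus hs) j, fun h => ?_⟩
  refine ⟨_, _, S.isCanonicalFactorization, fun j => ?_⟩
  rw [h j, Int.cast_zero]
  exact S.column_order j

end Setting

end Factorization

end AnnularFactorization

theorem mainTheorem2 (lam0 lam1 γ : ℝ) (hlam0 : 0 < lam0) (hlam01 : lam0 < lam1)
    (hlam1 : lam1 < 1) (hγ0 : 0 < γ) (hγ1 : γ < 1) :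
    (∃! K : Coeffs, SolvesSystems lam0 lam1 K) ∧
    (∀ K : Coeffs, SolvesSystems lam0 lam1 K →
      (∀ s : ℂ, (∀ k : ℤ, s ≠ k) →
        (∀ l, SeriesConverge K l s) ∧
        Xplus lam0 lam1 K s = XplusFormula lam0 lam1 K s ∧
        Xminus lam0 lam1 K s = XminusFormula lam0 lam1 K s ∧
        chi K s = 1) ∧
      (∀ s ∈ DPlus γ, (Xplus lam0 lam1 K s).det = 1 / (2 * (lam0 : ℂ))) ∧
      (∀ s ∈ DMinus γ, (Xminus lam0 lam1 K s).det = 1 / (4 * (lam1 : ℂ))) ∧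
      IsCanonicalFactorization γ (G0 lam0 lam1) (Xplus lam0 lam1 K) (Xminus lam0 lam1 K) ∧
      (∀ j, HasOrderAtInfinity (DPlus γ) (column (Xplus lam0 lam1 K) j) 0 ∧
        HasOrderAtInfinity (DMinus γ) (column (Xminus lam0 lam1 K) j) 0) ∧
      (∀ (M : ℝ), 0 < M → ∀ (i j : Fin 3),
        (fun s => Xplus lam0 lam1 K s i j - XplusInfinity lam0 i j)
          =O[atInfinityIn (leftSector M)] (fun s => s⁻¹) ∧
        (fun s => Xminus lam0 lam1 K s i j - XminusInfinity lam1 i j)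
          =O[atInfinityIn (rightSector M)] (fun s => s⁻¹))) ∧
    (∀ κ : Fin 3 → ℤ, IsPartialIndices γ (G0 lam0 lam1) κ ↔ ∀ j, κ j = 0) := by
  have hex := existsUnique_solvesSystems hlam0 hlam01 hlam1
  refine ⟨hex, fun K hK => ?_, ?_⟩
  · have S : Setting lam0 lam1 γ K := ⟨hlam0, hlam01, hlam1, hγ0, hγ1, hK⟩
    exact ⟨fun s hs => ⟨hK.seriesConverge hlam0 hlam01 hlam1 hs, S.Xplus_eq hs, S.Xminus_eq hs,
      S.chi_eq_one hs⟩, fun s hs => S.det_plus hs, fun s hs => S.det_minus hs,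
      S.isCanonicalFactorization, S.column_order,
      fun M hM i j => ⟨S.isBigO_plus hM i j, S.isBigO_minus hM i j⟩⟩
  · obtain ⟨K, hK, -⟩ := hex
    exact Setting.isPartialIndices_iff ⟨hlam0, hlam01, hlam1, hγ0, hγ1, hK⟩
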